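/- **Setting.** Fix $d,N\in\mathbb N$ with $N\ge 1$, a compact metrizable space $\Omega_0$, and let $\Omega=\prod_{x\in\mathbb Z^d}\Omega_0$ with the shifts $(\tau_y\omega)_x=\omega_{x-y}$. Let $\mathbb P$ be a Borel probability measure on $\Omega$ of full support, invariant and ergodic under the shifts, and invariant under all permutations of the sites. For $L\in\mathbb N$ put $V_L=\{-L,\dots,L\}^d$, so $|V_L|=(2L+1)^d$, and let $s(\hat x)\in V_L$ be the representative of a class $\hat x\in(\mathbb Z/(2L+1)\mathbb Z)^d$. Let $\phi$ be a real antisymmetric $d\times d$ matrix that is *quantized for $L$*: $\phi_{ij}=2\pi n_{ij}/(2L+1)$ with $n_{ij}\in\mathbb Z$. For a compact space $X$, $C_N(X)$ is the $C^*$-algebra of continuous functions $X\to M_N(\mathbb C)$, and $\mathrm{tr}$ is the normalized trace of matrices. *Periodic algebra.* $\widetilde\Omega\subset\Omega$ is the set of $\omega$ with $\tau_{e_j}^{2L+1}\omega=\omega$ for all $j$, $\tilde{\mathfrak q}:\Omega\to\widetilde\Omega$ sends $\omega$ to the periodic configuration equal to $\omega$ on $V_L$, and $\widetilde{\mathbb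 P}=\tilde{\mathfrak q}_*\mathbb P$. $\tilde{\mathcal A}_d$ is the universal $C^*$-algebra generated by $C_N(\widetilde\Omega)$ and unitaries $u_1,\dots,u_d$ with $u_iu_j=e^{i\phi_{ij}}u_ju_i$ and $fu_j=u_j(f\circ\tau_{e_j})$. The torus acts on it by $\rho_\lambda(f)=f$, $\rho_\lambda(u_j)=\lambda_j^{-1}u_j$; with $u_x=e^{-\frac i2\sum_{i<j}\phi_{ij}x_ix_j}u_1^{x_1}\cdots u_d^{x_d}$, the Fourier coefficients of $\tilde a$ are $\tilde a_x=\big(\int_{\mathbb T^d}\lambda^x\rho_\lambda(\tilde a)\,d\mu(\lambda)\big)u_x^*\in C_N(\widetilde\Omega)$. $\tilde{\mathcal A}_d^\infty$ is the set of $\tilde a$ for which $\lambda\mapsto\rho_\lambda(\tilde a)$ is infinitely differentiable, and $\tilde\partial_1,\dots,\tilde\partial_d$ are the generators of $\rho$: $\tilde\partial_j\sum_x\tilde a_xu_x=-i\sum_xx_j\tilde a_xu_x$. The trace is $\widetilde{\mathcal T}(\tilde a)=\int_{\widetilde\Omega}\mathrm{tr}(\tilde a_0)\,d\widetilde{\mathbb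 P}$. *Finite-volume algebra.* $\widehat\Omega=\prod_{\hat x\in(\mathbb Z/(2L+1)\mathbb Z)^d}\Omega_0$ with the induced shifts $\hat\tau$, $\hat{\mathfrak q}:\widetilde\Omega\to\widehat\Omega$ is the homeomorphism $(\hat{\mathfrak q}\omega)_{\hat x}=\omega_{s(\hat x)}$, and $\widehat{\mathbb P}=\hat{\mathfrak q}_*\widetilde{\mathbb P}$. $\hat{\mathcal A}_d$ is the universal $C^*$-algebra generated by $C_N(\widehat\Omega)$ and unitaries $\hat u_1,\dots,\hat u_d$ with the same relations (for $\hat\tau$) and $\hat u_j^{2L+1}=1$. Its elements are uniquely $\hat a=\sum_{x\in V_L}\hat a_x\hat u_x$, with $\hat a_x\in C_N(\widehat\Omega)$ and $\hat u_x$ defined as $u_x$; the approximate derivations are $\hat\partial_j\hat a=-i\sum_{x\in V_L}x_j\hat a_x\hat u_x$, and the trace is $\widehat{\mathcal T}(\hat a)=\int_{\widehat\Omega}\mathrm{tr}(\hat a_0)\,d\widehat{\mathbb P}$. The epimorphism $\hat{\mathfrak p}:\tilde{\mathcal A}_d\to\hat{\mathcal A}_d$ is given by $\hat{\mathfrak p}(u_j)=\hat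 u_j$, $\hat{\mathfrak p}(f)=f\circ\hat{\mathfrak q}^{-1}$. **Theorem.** Let $\alpha_1,\dots,\alpha_n$ be multi-indices, $S\subset\mathbb R$ compact, $G_1,\dots,G_n:\mathbb R\to\mathbb C$ functions that are $C^\infty$ on an open set containing $S$, $(C_k)_{k\in\mathbb N}$ real numbers, and $K\in\mathbb N$. There is a finite constant $A_K$ such that for every $L\in\mathbb N$, every flux matrix $\phi$ quantized for $L$, and every self-adjoint $\tilde h\in\tilde{\mathcal A}_d^\infty$ with $\sigma(\tilde h)\subset S$ and $$(1+|x|_\infty)^k\,\|\tilde h_x\|\le C_k\qquad(k\in\mathbb N,\ x\in\mathbb Z^d),$$ the elements $G_i(\tilde h)$ belong to $\tilde{\mathcal A}_d^\infty$ and, with $\hat h=\hat{\mathfrak p}(\tilde h)$, $$\Big|\widetilde{\mathcal T}\big(\tilde\partial^{\alpha_1}G_1(\tilde h)\cdots\tilde\partial^{\alpha_n}G_n(\tilde h)\big)-\widehat{\mathcal T}\big(\hat\partial^{\alpha_1}G_1(\hat h)\cdots\hat\partial^{\alpha_n}G_n(\hat h)\big)\Big|\le\frac{A_K}{(1+|V_L|)^K}.$$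 -/

import Mathlib

open MeasureTheory Topology
open scoped ENNReal Matrix.Norms.L2Operator

universe u

noncomputable section

namespace NCTorus

/-! ### The universal C⋆-algebra `C⋆(C_N(X), u_1, …, u_d)` -/

/-- The algebra `M_N(ℂ)`, with its C⋆-norm (the operator norm for the Euclidean norm of `ℂ^N`). -/
abbrev Mat (N : ℕ) : Type := Matrix (Fin N) (Fin N) ℂ

/-- The C⋆-algebra `C_N(X)` of continuous functions `X → M_N(ℂ)`, with the supremum norm. -/
abbrev MatFun (N : ℕ) (X : Type u) [TopologicalSpace X] : Type u := C(X, Mat N)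

/-- A representation, in some nonzero unital C⋆-algebra, of the generators `f ∈ C_N(X)` and
`u_1, …, u_d` and of the relations
`u_j u_j⋆ = u_j⋆ u_j = 1`, `u_i u_j = e^{i φ_{ij}} u_j u_i`, `f u_j = u_j (f ∘ T_j)`, `u_j ^ m = 1`.
For `m = 0` the last relation is void. -/
structure TwistedRep (N : ℕ) {d : ℕ} {X : Type u} [TopologicalSpace X] [CompactSpace X]
    (T : Fin d → C(X, X)) (φ : Matrix (Fin d) (Fin d) ℝ) (m : ℕ) : Type (u + 1) where
  carrier : Type u
  [cstar : CStarAlgebra carrier]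
  [nontriv : Nontrivial carrier]
  fn : MatFun N X →⋆ₐ[ℂ] carrier
  gen : Fin d → unitary carrier
  gen_comm : ∀ i j, (gen i : carrier) * gen j =
    Complex.exp (Complex.I * (φ i j : ℂ)) • ((gen j : carrier) * gen i)
  fn_gen : ∀ (f : MatFun N X) (j : Fin d), fn f * (gen j : carrier) = gen j * fn (f.comp (T j))
  gen_pow : ∀ j, gen j ^ m = 1

attribute [instance] TwistedRep.cstar TwistedRep.nontriv

instance lpCStarAlgebra {I : Type*} (A : I → Type*) [∀ i, CStarAlgebra (A i)]
    [∀ i, Nontrivial (A i)] : CStarAlgebra (lp A ∞) where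

section Universal

variable {N : ℕ} {d : ℕ} {X : Type u} [TopologicalSpace X] [CompactSpace X]
  {T : Fin d → C(X, X)} {φ : Matrix (Fin d) (Fin d) ℝ} {m : ℕ}

/-- The C⋆-algebra of all bounded families `(a_r)`, with `a_r` in the target algebra of the
representation `r`, in the norm `sup_r ‖a_r‖`. -/
abbrev Families (N : ℕ) {d : ℕ} {X : Type u} [TopologicalSpace X] [CompactSpace X]
    (T : Fin d → C(X, X)) (φ : Matrix (Fin d) (Fin d) ℝ) (m : ℕ) : Type (u + 1) :=
  lp (fun r : TwistedRep N T φ m => r.carrier) ∞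

theorem norm_starAlgHom_le {A B : Type*} [CStarAlgebra A] [CStarAlgebra B] (f : A →⋆ₐ[ℂ] B)
    (a : A) : ‖f a‖ ≤ ‖a‖ :=
  NonUnitalStarAlgHom.norm_apply_le f a

/-- A family of unital ⋆-homomorphisms, one into each target algebra, as one ⋆-homomorphism. -/
def familyHom {A : Type*} [CStarAlgebra A]
    (ψ : ∀ r : TwistedRep N T φ m, A →⋆ₐ[ℂ] r.carrier) : A →⋆ₐ[ℂ] Families N T φ m where
  toFun a := ⟨fun r => ψ r a, memℓp_infty ⟨‖a‖, by
    rintro _ ⟨r, rfl⟩; exact norm_starAlgHom_le (ψ r) a⟩⟩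
  map_one' := by ext r; exact map_one (ψ r)
  map_mul' a b := by ext r; exact map_mul (ψ r) a b
  map_zero' := by ext r; exact map_zero (ψ r)
  map_add' a b := by ext r; exact map_add (ψ r) a b
  commutes' c := by ext r; exact AlgHomClass.commutes (ψ r) c
  map_star' a := by ext r; exact map_star (ψ r) a

/-- The value of a bounded family at one representation. -/
def evalHom (r : TwistedRep N T φ m) : Families N T φ m →⋆ₐ[ℂ] r.carrier where
  toFun a := a r
  map_one' := rfl
  map_mul' _ _ := rfl
  map_zero' := rfl
  map_add' _ _ := rfl
  commutes' _ := rfl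
  map_star' _ := rfl

/-- The element `f` in all representations. -/
def famFn : MatFun N X →⋆ₐ[ℂ] Families N T φ m := familyHom fun r => r.fn

theorem norm_unitary_le {A : Type*} [CStarAlgebra A] [Nontrivial A] (v : unitary A) :
    ‖(v : A)‖ ≤ 1 := le_of_eq (CStarRing.norm_coe_unitary v)

/-- The generator `u_j` in all representations. -/
def famGen (j : Fin d) : Families N T φ m :=
  ⟨fun r => (r.gen j : r.carrier), memℓp_infty ⟨1, by
    rintro _ ⟨r, rfl⟩; exact norm_unitary_le (r.gen j)⟩⟩

theorem famGen_mem_unitary (j : Fin d) : (famGen j : Families N T φ m) ∈ unitary _ := by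
  rw [Unitary.mem_iff]
  constructor
  · ext r; exact Unitary.coe_star_mul_self (r.gen j)
  · ext r; exact Unitary.coe_mul_star_self (r.gen j)

/-- The closed ⋆-subalgebra generated by the `f`'s and the `u_j`'s. -/
def twistedSubalg (N : ℕ) {d : ℕ} {X : Type u} [TopologicalSpace X] [CompactSpace X]
    (T : Fin d → C(X, X)) (φ : Matrix (Fin d) (Fin d) ℝ) (m : ℕ) :
    StarSubalgebra ℂ (Families N T φ m) :=
  (StarAlgebra.adjoin ℂ (Set.range (famFn (N := N) (T := T) (φ := φ) (m := m)) ∪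
    Set.range fun j => (famGen j : Families N T φ m))).topologicalClosure

/-- The universal C⋆-algebra generated by `C_N(X)` and `u_1, …, u_d` with the relations listed in
`TwistedRep`: the completion of the polynomials in the generators for the norm
`sup_r ‖r(·)‖` over all representations `r` of the relations. The target algebras `r.carrier` may
be taken in the universe of `X`, because any C⋆-algebra generated by a representation of the
relations is isomorphic to one in that universe. -/
def TwistedAlg (N : ℕ) {d : ℕ} {X : Type u} [TopologicalSpace X] [CompactSpace X]
    (T : Fin d → C(X, X)) (φ : Matrix (Fin d) (Fin d) ℝ) (m : ℕ) : Type (u + 1) :=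
  twistedSubalg N T φ m

instance : CStarAlgebra (TwistedAlg N T φ m) :=
  haveI : IsClosed (twistedSubalg N T φ m : Set (Families N T φ m)) :=
    StarSubalgebra.isClosed_topologicalClosure _
  StarSubalgebra.cstarAlgebra (twistedSubalg N T φ m)

namespace TwistedAlg

/-- The inclusion in the algebra of bounded families. -/
def incl : TwistedAlg N T φ m →⋆ₐ[ℂ] Families N T φ m := (twistedSubalg N T φ m).subtype

theorem incl_injective : Function.Injective (incl (N := N) (T := T) (φ := φ) (m := m)) :=
  Subtype.coe_injective

theorem fn_mem (f : MatFun N X) : (famFn f : Families N T φ m) ∈ twistedSubalg N T φ m :=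
  StarSubalgebra.le_topologicalClosure _ (StarAlgebra.subset_adjoin ℂ _ (Or.inl ⟨f, rfl⟩))

theorem gen_mem (j : Fin d) : (famGen j : Families N T φ m) ∈ twistedSubalg N T φ m :=
  StarSubalgebra.le_topologicalClosure _ (StarAlgebra.subset_adjoin ℂ _ (Or.inr ⟨j, rfl⟩))

/-- The canonical map of `C_N(X)` into the universal algebra. -/
def fn : MatFun N X →⋆ₐ[ℂ] TwistedAlg N T φ m := famFn.codRestrict (twistedSubalg N T φ m) fn_mem

/-- The generators `u_j` of the universal algebra. -/
def gen (j : Fin d) : TwistedAlg N T φ m := (⟨famGen j, gen_mem j⟩ : twistedSubalg N T φ m)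

theorem gen_mem_unitary (j : Fin d) : (gen j : TwistedAlg N T φ m) ∈ unitary _ := by
  rw [Unitary.mem_iff]
  constructor
  · exact Subtype.ext (Unitary.star_mul_self_of_mem (famGen_mem_unitary j))
  · exact Subtype.ext (Unitary.mul_star_self_of_mem (famGen_mem_unitary j))

/-- The generators `u_j` of the universal algebra, as elements of its unitary group. -/
def ugen (j : Fin d) : unitary (TwistedAlg N T φ m) := ⟨gen j, gen_mem_unitary j⟩

/-- The universal property: a representation of the relations extends to the universal algebra. -/
def lift (r : TwistedRep N T φ m) : TwistedAlg N T φ m →⋆ₐ[ℂ] r.carrier := (evalHom r).comp incl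

theorem lift_fn (r : TwistedRep N T φ m) (f : MatFun N X) : lift r (fn f) = r.fn f := rfl

theorem lift_gen (r : TwistedRep N T φ m) (j : Fin d) :
    lift r (gen j : TwistedAlg N T φ m) = r.gen j := rfl

theorem gen_comm (i j : Fin d) : (gen i : TwistedAlg N T φ m) * gen j =
    Complex.exp (Complex.I * (φ i j : ℂ)) • ((gen j : TwistedAlg N T φ m) * gen i) :=
  incl_injective (by ext r; exact r.gen_comm i j)

theorem fn_gen (f : MatFun N X) (j : Fin d) :
    fn f * (gen j : TwistedAlg N T φ m) = gen j * fn (f.comp (T j)) :=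
  incl_injective (by ext r; exact r.fn_gen f j)

theorem gen_pow (j : Fin d) : (gen j : TwistedAlg N T φ m) ^ m = 1 := by
  refine incl_injective ?_
  ext r
  have h := congrArg (Subtype.val : unitary r.carrier → r.carrier) (r.gen_pow j)
  have h2 : lift r ((gen j : TwistedAlg N T φ m) ^ m) = 1 := by
    rw [map_pow, lift_gen]; simpa using h
  exact h2

/-- The universal algebra is generated, as a C⋆-algebra, by the `f`'s and the `u_j`'s. -/
theorem eq_top_of_isClosed (S : StarSubalgebra ℂ (TwistedAlg N T φ m))
    (hS : IsClosed (S : Set (TwistedAlg N T φ m))) (hfn : ∀ f, fn f ∈ S)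
    (hgen : ∀ j, (gen j : TwistedAlg N T φ m) ∈ S) : S = ⊤ := by
  have hcl : Topology.IsClosedEmbedding (incl (N := N) (T := T) (φ := φ) (m := m)) :=
    (StarSubalgebra.isClosed_topologicalClosure _).isClosedEmbedding_subtypeVal
  have key : twistedSubalg N T φ m ≤ S.map incl := by
    refine StarSubalgebra.topologicalClosure_minimal (StarAlgebra.adjoin_le ?_) ?_
    · rintro _ (⟨f, rfl⟩ | ⟨j, rfl⟩)
      · exact ⟨fn f, hfn f, rfl⟩
      · exact ⟨gen j, hgen j, rfl⟩
    · rw [StarSubalgebra.coe_map]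
      exact hcl.isClosedMap _ hS
  refine eq_top_iff.2 fun a _ => ?_
  obtain ⟨b, hb, hba⟩ := key (show incl a ∈ twistedSubalg N T φ m from Subtype.property a)
  exact incl_injective hba ▸ hb

theorem continuous_starAlgHom {A B : Type*} [CStarAlgebra A] [CStarAlgebra B]
    (f : A →⋆ₐ[ℂ] B) : Continuous f :=
  AddMonoidHomClass.continuous_of_bound f 1 fun a => by simpa using norm_starAlgHom_le f a

/-- Uniqueness in the universal property. -/
theorem hom_ext {B : Type*} [CStarAlgebra B] {f g : TwistedAlg N T φ m →⋆ₐ[ℂ] B}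
    (hfn : ∀ a, f (fn a) = g (fn a))
    (hgen : ∀ j, f (gen j : TwistedAlg N T φ m) = g (gen j : TwistedAlg N T φ m)) : f = g := by
  have h := eq_top_of_isClosed (StarAlgHom.equalizer f g)
    (isClosed_eq (continuous_starAlgHom f) (continuous_starAlgHom g)) hfn hgen
  ext a
  exact (h ▸ StarSubalgebra.mem_top : a ∈ StarAlgHom.equalizer f g)

/-- Morphisms between universal algebras: if every representation `r` of the second set of
relations yields, in the same C⋆-algebra, a representation `F r` of the first one whose generators
come from the second universal algebra, then the first universal algebra maps to the second. -/
def mapOfRep {N' d' : ℕ} {X' : Type u} [TopologicalSpace X'] [CompactSpace X']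
    {T' : Fin d' → C(X', X')} {φ' : Matrix (Fin d') (Fin d') ℝ} {m' : ℕ}
    (F : TwistedRep N' T' φ' m' → TwistedRep N T φ m)
    (ψ : ∀ r, (F r).carrier →⋆ₐ[ℂ] r.carrier)
    (hfn : ∀ f, ∃ b : TwistedAlg N' T' φ' m', ∀ r, ψ r ((F r).fn f) = lift r b)
    (hgen : ∀ j, ∃ b : TwistedAlg N' T' φ' m', ∀ r, ψ r ((F r).gen j) = lift r b) :
    TwistedAlg N T φ m →⋆ₐ[ℂ] TwistedAlg N' T' φ' m' :=
  (familyHom fun r => (ψ r).comp (lift (F r))).codRestrict (twistedSubalg N' T' φ' m') (by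
    intro a
    have hcl : IsClosed (twistedSubalg N' T' φ' m' : Set (Families N' T' φ' m')) :=
      StarSubalgebra.isClosed_topologicalClosure _
    have h := eq_top_of_isClosed ((twistedSubalg N' T' φ' m').comap
        (familyHom fun r => (ψ r).comp (lift (F r))))
      (by
        rw [StarSubalgebra.coe_comap]
        exact hcl.preimage (continuous_starAlgHom _))
      (fun f => by
        obtain ⟨b, hb⟩ := hfn f
        have : (familyHom fun r => (ψ r).comp (lift (F r))) (fn f) = incl b := by
          ext r; exact hb r
        rw [StarSubalgebra.mem_comap, this]
        exact Subtype.property b)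
      (fun j => by
        obtain ⟨b, hb⟩ := hgen j
        have : (familyHom fun r => (ψ r).comp (lift (F r)))
            (gen j : TwistedAlg N T φ m) = incl b := by
          ext r; exact hb r
        rw [StarSubalgebra.mem_comap, this]
        exact Subtype.property b)
    have ha : a ∈ (⊤ : StarSubalgebra ℂ (TwistedAlg N T φ m)) := StarSubalgebra.mem_top
    rw [← h] at ha
    exact ha)

/-- The symmetric monomials
`u_x = e^{-(i/2) ∑_{i<j} φ_{ij} x_i x_j} u_1^{x_1} ⋯ u_d^{x_d}`, which satisfy `u_x⋆ = u_{-x}`. -/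
def monomial (x : Fin d → ℤ) : TwistedAlg N T φ m :=
  Complex.exp (-(Complex.I / 2) * ∑ i : Fin d, ∑ j ∈ Finset.Ioi i, (φ i j * x i * x j : ℂ)) •
    (((List.ofFn fun j => ugen j ^ x j).prod : unitary (TwistedAlg N T φ m)) :
      TwistedAlg N T φ m)

end TwistedAlg

/-! ### Torus action, smooth elements, derivations and Fourier coefficients (no constraint) -/

theorem smul_unitary_mem {A : Type*} [CStarAlgebra A] (θ : ℝ) (v : unitary A) :
    Complex.exp (Complex.I * θ) • (v : A) ∈ unitary A := by
  have h : star (Complex.exp (Complex.I * θ)) * Complex.exp (Complex.I * θ) = 1 := by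
    rw [Complex.star_def, ← Complex.exp_conj, ← Complex.exp_add]; simp
  rw [Unitary.mem_iff]
  constructor
  · rw [star_smul, smul_mul_smul_comm, h, Unitary.coe_star_mul_self, one_smul]
  · rw [star_smul, smul_mul_smul_comm, mul_comm, h, Unitary.mul_star_self_of_mem v.2, one_smul]

/-- The representation in which `u_j` is replaced by `λ_j⁻¹ u_j`, `λ_j = e^{i θ_j}`. -/
@[reducible] def TwistedRep.rotate (θ : Fin d → ℝ) (r : TwistedRep N T φ 0) :
    TwistedRep N T φ 0 where
  carrier := r.carrier
  fn := r.fn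
  gen j := ⟨Complex.exp (Complex.I * ((-θ j : ℝ) : ℂ)) • (r.gen j : r.carrier),
    smul_unitary_mem _ _⟩
  gen_comm i j := by
    simp only [smul_mul_smul_comm, r.gen_comm i j, smul_smul]
    congr 1; ring
  fn_gen f j := by simp only [mul_smul_comm, smul_mul_assoc, r.fn_gen f j]
  gen_pow j := pow_zero _

namespace TwistedAlg

/-- The torus action `ρ_λ`, `λ_j = e^{i θ_j}`: the automorphism which fixes `C_N(X)` and maps `u_j`
to `λ_j⁻¹ u_j`. -/
def gauge (θ : Fin d → ℝ) : TwistedAlg N T φ 0 →⋆ₐ[ℂ] TwistedAlg N T φ 0 :=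
  mapOfRep (TwistedRep.rotate θ) (fun r => StarAlgHom.id ℂ r.carrier)
    (fun f => ⟨fn f, fun _ => rfl⟩)
    (fun j => ⟨Complex.exp (Complex.I * ((-θ j : ℝ) : ℂ)) • gen j, fun r => by
      rw [map_smul (lift r), lift_gen]; rfl⟩)

theorem gauge_fn (θ : Fin d → ℝ) (f : MatFun N X) :
    gauge θ (fn f : TwistedAlg N T φ 0) = fn f := rfl

theorem gauge_gen (θ : Fin d → ℝ) (j : Fin d) :
    gauge θ (gen j : TwistedAlg N T φ 0) =
      Complex.exp (Complex.I * ((-θ j : ℝ) : ℂ)) • gen j := rfl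

/-- The smooth subalgebra: `λ ↦ ρ_λ(a)` is infinitely differentiable. -/
def IsSmooth (a : TwistedAlg N T φ 0) : Prop :=
  ContDiff ℝ (⊤ : ℕ∞) fun θ : Fin d → ℝ => gauge θ a

/-- The derivation `∂_j`, the generator of the torus action in the `j`-th direction. On smooth
elements, `∂_j ∑ a_x u_x = -i ∑ x_j a_x u_x`. -/
def deriv (j : Fin d) (a : TwistedAlg N T φ 0) : TwistedAlg N T φ 0 :=
  _root_.deriv (fun t : ℝ => gauge (Pi.single j t) a) 0

/-- `Φ_x(a) = (∫_{𝕋^d} λ^x ρ_λ(a) dμ(λ)) u_x⋆`, an element of `C_N(X) ⊆ C⋆(C_N(X), u_1, …, u_d)`. -/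
def fourierElt (a : TwistedAlg N T φ 0) (x : Fin d → ℤ) : TwistedAlg N T φ 0 :=
  (((2 * Real.pi) ^ d : ℝ)⁻¹ • ∫ θ in Set.Icc (0 : Fin d → ℝ) (fun _ => 2 * Real.pi),
    Complex.exp (Complex.I * ∑ j, (x j * θ j : ℂ)) • gauge θ a) * star (monomial x)

/-- The Fourier coefficient `a_x = Φ_x(a)`, as an element of `C_N(X)`. -/
def coeff (a : TwistedAlg N T φ 0) (x : Fin d → ℤ) : MatFun N X :=
  Function.invFun (fn : MatFun N X →⋆ₐ[ℂ] TwistedAlg N T φ 0) (fourierElt a x)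

end TwistedAlg

/-! ### Fourier coefficients and approximate derivations under the constraint `u_j ^ (2L+1) = 1` -/

/-- The cube `V_L = {-L, …, L}^d`. -/
def cube (d L : ℕ) : Finset (Fin d → ℤ) :=
  Fintype.piFinset fun _ => Finset.Icc (-(L : ℤ)) L

theorem zero_mem_cube (d L : ℕ) : (0 : Fin d → ℤ) ∈ cube d L := by
  simp [cube]

namespace TwistedAlg

/-- The element `∑_{x ∈ V_L} c_x u_x`. -/
def synth {L : ℕ} (c : cube d L → MatFun N X) : TwistedAlg N T φ (2 * L + 1) :=
  ∑ x : cube d L, fn (c x) * monomial x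

/-- The coefficients of the expansion `a = ∑_{x ∈ V_L} a_x u_x`. -/
def finCoeff {L : ℕ} (a : TwistedAlg N T φ (2 * L + 1)) : cube d L → MatFun N X :=
  Function.invFun synth a

/-- The approximate derivation `∂_j ∑_{x ∈ V_L} a_x u_x = -i ∑_{x ∈ V_L} x_j a_x u_x`. -/
def finDeriv {L : ℕ} (j : Fin d) (a : TwistedAlg N T φ (2 * L + 1)) :
    TwistedAlg N T φ (2 * L + 1) :=
  synth fun x => (-Complex.I * ((x : Fin d → ℤ) j : ℂ)) • finCoeff a x

end TwistedAlg
end Universal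

/-- `D^α = D_1^{α_1} ⋯ D_d^{α_d}`, for a family of operators `D_1, …, D_d`. -/
def multiDeriv {d : ℕ} {A : Type*} (D : Fin d → A → A) (α : Fin d → ℕ) (a : A) : A :=
  (List.finRange d).foldr (fun j b => (D j)^[α j] b) a

/-- `G(h)` for `G : ℝ → ℂ` and self-adjoint `h`, by the continuous functional calculus. -/
def realFC {A : Type*} [CStarAlgebra A] (G : ℝ → ℂ) (h : A) : A := cfc (fun z : ℂ => G z.re) h

/-- The normalized trace of matrices. -/
def ntr {N : ℕ} (M : Mat N) : ℂ := (N : ℂ)⁻¹ * M.trace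

/-- The integral of the normalized trace of a function in `C_N(X)`. -/
def fnTrace {N : ℕ} {X : Type u} [TopologicalSpace X] [MeasurableSpace X] (μ : Measure X)
    (f : MatFun N X) : ℂ := ∫ w, ntr (f w) ∂μ

/-! ### Disorder configurations -/

/-- The disorder configurations `Ω = ∏_{x ∈ ℤ^d} Ω₀`. -/
abbrev Config (d : ℕ) (Ω₀ : Type u) : Type u := (Fin d → ℤ) → Ω₀

/-- The shift `(τ_y w)_x = w_{x-y}`. -/
def shift {d : ℕ} {Ω₀ : Type u} (y : Fin d → ℤ) (w : Config d Ω₀) : Config d Ω₀ :=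
  fun x => w (x - y)

/-- The standing assumptions on the distribution of the disorder: a probability measure of full
support, invariant and ergodic under the shifts, and invariant under all permutations of the
sites. -/
structure IsDisorderMeasure {d : ℕ} {Ω₀ : Type u} [TopologicalSpace Ω₀] [MeasurableSpace Ω₀]
    (P : Measure (Config d Ω₀)) : Prop where
  prob : IsProbabilityMeasure P
  full_support : ∀ U : Set (Config d Ω₀), IsOpen U → U.Nonempty → 0 < P U
  shift_invariant : ∀ y, P.map (shift y) = P
  ergodic : ∀ s : Set (Config d Ω₀), MeasurableSet s → (∀ y, shift y ⁻¹' s = s) → P s = 0 ∨ P s = 1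
  perm_invariant : ∀ r : Equiv.Perm (Fin d → ℤ), P.map (fun w x => w (r x)) = P

/-- The `(2L+1)`-periodic configurations, a closed subspace of `Ω`. -/
abbrev PerConfig (d : ℕ) (Ω₀ : Type u) (L : ℕ) : Type u :=
  {w : Config d Ω₀ // ∀ j, (shift (Pi.single j 1))^[2 * L + 1] w = w}

/-- The configurations at finite volume, `∏_{x ∈ (ℤ/(2L+1)ℤ)^d} Ω₀`. -/
abbrev FinConfig (d : ℕ) (Ω₀ : Type u) (L : ℕ) : Type u := (Fin d → ZMod (2 * L + 1)) → Ω₀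

/-- The class of `x ∈ ℤ^d` modulo `2L+1`. -/
def cls {d : ℕ} (L : ℕ) (x : Fin d → ℤ) : Fin d → ZMod (2 * L + 1) := fun j => (x j : ℤ)

/-- The representative in `V_L` of a class modulo `2L+1`. -/
def rep {d : ℕ} {L : ℕ} (x : Fin d → ZMod (2 * L + 1)) : Fin d → ℤ := fun j => (x j).valMinAbs

theorem rep_mem_cube {d : ℕ} {L : ℕ} (x : Fin d → ZMod (2 * L + 1)) : rep x ∈ cube d L := by
  simp only [cube, Fintype.mem_piFinset, Finset.mem_Icc, rep]
  intro j
  have := ZMod.valMinAbs_mem_Ioc (x j)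
  simp only [Set.mem_Ioc] at this
  push_cast at this
  omega

theorem cls_rep {d : ℕ} {L : ℕ} (x : Fin d → ZMod (2 * L + 1)) : cls L (rep x) = x := by
  funext j; simp [cls, rep]

section Configurations

variable {d : ℕ} {Ω₀ : Type u} {L : ℕ}

theorem shift_iterate (y : Fin d → ℤ) (k : ℕ) (w : Config d Ω₀) :
    (shift y)^[k] w = shift (k • y) w := by
  induction k with
  | zero => funext x; simp [shift]
  | succ k ih =>
    rw [Function.iterate_succ_apply', ih]
    funext x
    simp only [shift]
    congr 1
    rw [succ_nsmul]; abel

theorem cls_periodic (x : Fin d → ℤ) (j : Fin d) :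
    cls L (x - (2 * L + 1) • Pi.single j 1) = cls L x := by
  funext i
  have h : ((2 * L + 1 : ℕ) : ZMod (2 * L + 1)) = 0 := ZMod.natCast_self _
  have h' : (2 * (L : ZMod (2 * L + 1)) + 1) = 0 := by exact_mod_cast h
  simp [cls, h']

/-- The periodic configuration with a given restriction to a period. -/
def perExtend (w : FinConfig d Ω₀ L) : PerConfig d Ω₀ L :=
  ⟨fun x => w (cls L x), fun j => by
    rw [shift_iterate]; funext x; simp only [shift]; rw [cls_periodic]⟩

/-- The map `Ω → Ω̃` which sends `w` to the periodic configuration equal to `w` on `V_L`. -/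
def perProj (L : ℕ) (w : Config d Ω₀) : PerConfig d Ω₀ L := perExtend fun x => w (rep x)

/-- The map `Ω̃ → Ω̂`, `w ↦ (w_{s(x)})_x`, where `s(x) ∈ V_L` represents the class `x`. -/
def perRestrict (w : PerConfig d Ω₀ L) : FinConfig d Ω₀ L := fun x => w.1 (rep x)

theorem perRestrict_perExtend (w : FinConfig d Ω₀ L) : perRestrict (perExtend w) = w := by
  funext x; simp [perRestrict, perExtend, cls_rep]

variable [TopologicalSpace Ω₀]

theorem continuous_shift (y : Fin d → ℤ) : Continuous (shift (Ω₀ := Ω₀) y) :=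
  continuous_pi fun _ => continuous_apply _

instance [CompactSpace Ω₀] [T2Space Ω₀] : CompactSpace (PerConfig d Ω₀ L) := by
  have h : IsClosed {w : Config d Ω₀ | ∀ j, (shift (Pi.single j 1))^[2 * L + 1] w = w} := by
    rw [Set.ofPred_forall]
    exact isClosed_iInter fun j => isClosed_eq ((continuous_shift _).iterate _) continuous_id
  exact isCompact_iff_compactSpace.1 h.isCompact

/-- The shift `τ_{e_j}` on periodic configurations. -/
def perShift (j : Fin d) : C(PerConfig d Ω₀ L, PerConfig d Ω₀ L) where
  toFun w := ⟨shift (Pi.single j 1) w.1, fun i => by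
    have h := w.2 i
    rw [shift_iterate] at h ⊢
    funext x
    have hx := congrFun h (x - Pi.single j 1)
    simp only [shift] at hx ⊢
    rw [← hx, sub_right_comm]⟩
  continuous_toFun := ((continuous_shift _).comp continuous_subtype_val).subtype_mk _

/-- The shift `τ_{e_j}` on configurations at finite volume. -/
def finShift (j : Fin d) : C(FinConfig d Ω₀ L, FinConfig d Ω₀ L) where
  toFun w x := w (x - Pi.single j 1)
  continuous_toFun := continuous_pi fun _ => continuous_apply _

/-- The homeomorphism `Ω̂ → Ω̃`, as a continuous map. -/
def perExtendMap : C(FinConfig d Ω₀ L, PerConfig d Ω₀ L) where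
  toFun := perExtend
  continuous_toFun := (continuous_pi fun _ => continuous_apply _).subtype_mk _

theorem perExtendMap_shift (j : Fin d) :
    (perExtendMap (d := d) (Ω₀ := Ω₀) (L := L)).comp (finShift j) = (perShift j).comp perExtendMap := by
  refine ContinuousMap.ext fun w => Subtype.ext (funext fun x => ?_)
  change w (cls L x - Pi.single j 1) = w (cls L (x - Pi.single j 1))
  congr 1
  funext i
  by_cases h : i = j
  · subst h; simp [cls]
  · simp [cls, Pi.single_eq_of_ne h]

variable [MeasurableSpace Ω₀]

/-- The push-forward of the disorder measure to the periodic configurations. -/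
def perMeasure (P : Measure (Config d Ω₀)) (L : ℕ) : Measure (PerConfig d Ω₀ L) :=
  P.map (perProj L)

/-- The push-forward of the disorder measure to the configurations at finite volume. -/
def finMeasure (P : Measure (Config d Ω₀)) (L : ℕ) : Measure (FinConfig d Ω₀ L) :=
  (perMeasure P L).map perRestrict

end Configurations

/-! ### The periodic algebra, the finite-volume algebra, and the epimorphism -/

section Algebras

variable {d : ℕ} {Ω₀ : Type u} [TopologicalSpace Ω₀] [CompactSpace Ω₀] [T2Space Ω₀]

/-- The periodic algebra `Ã_d = C⋆(C_N(Ω̃), u_1, …, u_d)`. -/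
abbrev PerAlg (N : ℕ) (d : ℕ) (Ω₀ : Type u) [TopologicalSpace Ω₀] [CompactSpace Ω₀] [T2Space Ω₀]
    (L : ℕ) (φ : Matrix (Fin d) (Fin d) ℝ) : Type (u + 1) :=
  TwistedAlg N (perShift (d := d) (Ω₀ := Ω₀) (L := L)) φ 0

/-- The finite-volume algebra `Â_d = C⋆(C_N(Ω̂), û_1, …, û_d)`, with `û_j ^ (2L+1) = 1`. -/
abbrev FinAlg (N : ℕ) (d : ℕ) (Ω₀ : Type u) [TopologicalSpace Ω₀] [CompactSpace Ω₀]
    (L : ℕ) (φ : Matrix (Fin d) (Fin d) ℝ) : Type (u + 1) :=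
  TwistedAlg N (finShift (d := d) (Ω₀ := Ω₀) (L := L)) φ (2 * L + 1)

variable {N L : ℕ} {φ : Matrix (Fin d) (Fin d) ℝ}

/-- A representation of the finite-volume algebra, seen as one of the periodic algebra. -/
@[reducible] def TwistedRep.ofFin
    (r : TwistedRep N (finShift (d := d) (Ω₀ := Ω₀) (L := L)) φ (2 * L + 1)) :
    TwistedRep N (perShift (d := d) (Ω₀ := Ω₀) (L := L)) φ 0 where
  carrier := r.carrier
  fn := r.fn.comp (ContinuousMap.compStarAlgHom' ℂ (Mat N) perExtendMap)
  gen := r.gen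
  gen_comm := r.gen_comm
  fn_gen f j := by
    have h := r.fn_gen (f.comp perExtendMap) j
    rw [ContinuousMap.comp_assoc, perExtendMap_shift, ← ContinuousMap.comp_assoc] at h
    exact h
  gen_pow j := pow_zero _

/-- The ⋆-homomorphism `Ã_d → Â_d` with `u_j ↦ û_j` and `f ↦ f ∘ q⁻¹`, where `q : Ω̃ → Ω̂` is the
homeomorphism `perRestrict`. -/
def finProj : PerAlg N d Ω₀ L φ →⋆ₐ[ℂ] FinAlg N d Ω₀ L φ :=
  TwistedAlg.mapOfRep TwistedRep.ofFin (fun r => StarAlgHom.id ℂ r.carrier)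
    (fun f => ⟨TwistedAlg.fn (f.comp perExtendMap), fun _ => rfl⟩)
    (fun j => ⟨TwistedAlg.gen j, fun _ => rfl⟩)

theorem finProj_fn (f : MatFun N (PerConfig d Ω₀ L)) :
    finProj (TwistedAlg.fn f : PerAlg N d Ω₀ L φ) = TwistedAlg.fn (f.comp perExtendMap) := rfl

theorem finProj_gen (j : Fin d) :
    finProj (TwistedAlg.gen j : PerAlg N d Ω₀ L φ) = TwistedAlg.gen j := rfl

variable [MeasurableSpace Ω₀]

/-- The trace of the periodic algebra, `∫ tr(a_0(w)) dP̃(w)`. -/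
def perTrace (P : Measure (Config d Ω₀)) (a : PerAlg N d Ω₀ L φ) : ℂ :=
  fnTrace (perMeasure P L) (a.coeff 0)

/-- The trace of the finite-volume algebra, `∫ tr(a_0(w)) dP̂(w)`. -/
def finTrace (P : Measure (Config d Ω₀)) (a : FinAlg N d Ω₀ L φ) : ℂ :=
  fnTrace (finMeasure P L) (a.finCoeff ⟨0, zero_mem_cube d L⟩)

/-- The correlation function of the periodic algebra. -/
def perCorr (P : Measure (Config d Ω₀)) {n : ℕ} (α : Fin n → Fin d → ℕ) (G : Fin n → ℝ → ℂ)
    (h : PerAlg N d Ω₀ L φ) : ℂ :=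
  perTrace P (List.ofFn fun i => multiDeriv TwistedAlg.deriv (α i) (realFC (G i) h)).prod

/-- The correlation function of the finite-volume algebra. -/
def finCorr (P : Measure (Config d Ω₀)) {n : ℕ} (α : Fin n → Fin d → ℕ) (G : Fin n → ℝ → ℂ)
    (h : FinAlg N d Ω₀ L φ) : ℂ :=
  finTrace P (List.ofFn fun i => multiDeriv TwistedAlg.finDeriv (α i) (realFC (G i) h)).prod

end Algebras

/-- The flux matrix is real antisymmetric and quantized: `φ_{ij} = 2 π n_{ij} / (2L+1)`. -/
def IsQuantizedFlux {d : ℕ} (L : ℕ) (φ : Matrix (Fin d) (Fin d) ℝ) : Prop :=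
  (∀ i j, φ i j = -φ j i) ∧
    ∀ i j, ∃ n : ℤ, φ i j = 2 * n * Real.pi / (2 * L + 1)

end NCTorus

end

open NCTorus

/-! The two sides use the same Fourier coefficients, except that modes outside the cube `V_L` are
folded back into it at finite volume. These modes are negligible because every element involved is
smooth, with bounds on its torus orbit fixed by the data given before `L`, `φ` and `h`.

Uniform smoothness. The decay of the coefficients of `h` bounds all derivatives of its torus orbit
(`hasSmoothBound_of_decay`). By a cutoff and Poisson summation, `G` agrees on `S` with a series of
exponentials `c_m e^{imτx}` whose coefficients decrease rapidly (`exists_exponential_series`). For a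
smooth self-adjoint family `H`, the derivatives of `exp(itH)` grow only polynomially in `t`: it is
the `n`-th power, with `n` of order `|t|`, of the contraction `exp(i(t/n)H)`, and the jet norm of
weight `1/n` is submultiplicative (`contDiff_exp_smul_and_bound`). Summing the series bounds the
derivatives of `G(H)` (`exists_bound_realFC`). The torus automorphisms commute with functional
calculus, so this applies to the orbit of `G(h)`; derivations and products preserve such bounds.
Conversely, smooth bounds force rapid decay of the coefficients, and the Fourier series then
converges in norm.

Comparison. In the finite-volume algebra `u_x` is a phase times `u_y`, where `y` in `V_L` represents
the class of `x`. Exact and approximate derivations therefore multiply modes in the cube by the same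
weight, and their difference is a tail of size `(1+L)^{-p}` for any `p`
(`norm_multiDeriv_finProj_sub_le`). The traces also differ by such a tail
(`norm_perTrace_sub_finTrace_le`). A telescoping argument handles the product, and `p = dK` turns
`L` into the volume.

Well-posedness. Coefficients at finite volume exist and are bounded by the norm because the
quantized relations have a concrete representation by weighted shifts on `(ℤ/(2L+1))^d`, in which
distinct modes of the cube occupy disjoint matrix entries (`norm_le_norm_synth`). The same
representation shows that `C_N` embeds in both algebras. In the periodic algebra a peak-kernel
argument shows that coefficients determine the element (`TwistedAlg.eq_zero_of_fourierElt`). -/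

noncomputable section

set_option linter.unusedSectionVars false

namespace NCTorus

/-! ### Jet norms -/

section JetNorm

open Finset Nat

variable {E 𝔸 : Type*} [NormedAddCommGroup E] [NormedSpace ℝ E] [NormedRing 𝔸] [NormedAlgebra ℝ 𝔸]

/-- The norm `∑_{l ≤ k} ε^l / l! ‖D^l F(x)‖` of the `k`-jet of `F` at `x`. -/
def jetNorm (ε : ℝ) (k : ℕ) (F : E → 𝔸) (x : E) : ℝ :=
  ∑ l ∈ range (k + 1), ε ^ l / l ! * ‖iteratedFDeriv ℝ l F x‖

theorem jetNorm_nonneg {ε : ℝ} (hε : 0 ≤ ε) (k : ℕ) (F : E → 𝔸) (x : E) :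
    0 ≤ jetNorm ε k F x :=
  sum_nonneg fun _ _ => by positivity

theorem sum_range_convolution_le {a b : ℕ → ℝ} (ha : ∀ i, 0 ≤ a i) (hb : ∀ i, 0 ≤ b i) (n : ℕ) :
    ∑ l ∈ range n, ∑ i ∈ range (l + 1), a i * b (l - i) ≤
      (∑ i ∈ range n, a i) * ∑ i ∈ range n, b i := by
  rw [sum_range_diag_flip n fun i j => a i * b j, sum_mul_sum]
  refine sum_le_sum fun i _ => sum_le_sum_of_subset_of_nonneg ?_ fun j _ _ =>
    mul_nonneg (ha i) (hb j)
  exact range_subset_range.2 (Nat.sub_le n i)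

/-- The weights `ε^l / l!` absorb the binomial coefficients of Leibniz' rule, so the jet norm of a
product is dominated by a truncated Cauchy product. -/
theorem jetNorm_mul_le {ε : ℝ} (hε : 0 ≤ ε) {k : ℕ} {F G : E → 𝔸} (hF : ContDiff ℝ k F)
    (hG : ContDiff ℝ k G) (x : E) :
    jetNorm ε k (fun y => F y * G y) x ≤ jetNorm ε k F x * jetNorm ε k G x := by
  refine le_trans (sum_le_sum fun l hl => ?_) (sum_range_convolution_le
    (a := fun l => ε ^ l / l ! * ‖iteratedFDeriv ℝ l F x‖)
    (b := fun l => ε ^ l / l ! * ‖iteratedFDeriv ℝ l G x‖)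
    (fun _ => by positivity) (fun _ => by positivity) (k + 1))
  have hl' : l ≤ k := Nat.lt_succ_iff.1 (mem_range.1 hl)
  refine le_trans (mul_le_mul_of_nonneg_left
    (norm_iteratedFDeriv_mul_le hF hG x (n := l) (by exact_mod_cast hl')) (by positivity)) ?_
  rw [mul_sum]
  refine sum_le_sum fun i hi => le_of_eq ?_
  have hi' : i ≤ l := Nat.lt_succ_iff.1 (mem_range.1 hi)
  rw [Nat.cast_choose ℝ hi', ← Nat.add_sub_of_le hi', pow_add]
  simp only [Nat.add_sub_cancel_left]
  field_simp

theorem jetNorm_one_le [NormOneClass 𝔸] (ε : ℝ) (k : ℕ) (x : E) :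
    jetNorm ε k (fun _ : E => (1 : 𝔸)) x ≤ 1 := by
  rw [jetNorm, sum_eq_single 0]
  · simp
  · intro l _ hl
    rw [iteratedFDeriv_const_of_ne hl]; simp
  · simp

theorem jetNorm_pow_le [NormOneClass 𝔸] {ε : ℝ} (hε : 0 ≤ ε) {k : ℕ} {F : E → 𝔸}
    (hF : ContDiff ℝ k F) (x : E) (n : ℕ) :
    jetNorm ε k (fun y => F y ^ n) x ≤ jetNorm ε k F x ^ n := by
  induction n with
  | zero => simpa using jetNorm_one_le ε k x
  | succ n ih =>
    simp only [pow_succ]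
    exact (jetNorm_mul_le hε (hF.pow n) hF x).trans
      (mul_le_mul_of_nonneg_right ih (jetNorm_nonneg hε k F x))

theorem norm_iteratedFDeriv_le_jetNorm {ε : ℝ} (hε : 0 < ε) (k : ℕ) (F : E → 𝔸) (x : E) :
    ‖iteratedFDeriv ℝ k F x‖ ≤ k ! * (ε ^ k)⁻¹ * jetNorm ε k F x := by
  have h : ε ^ k / k ! * ‖iteratedFDeriv ℝ k F x‖ ≤ jetNorm ε k F x :=
    single_le_sum (f := fun l => ε ^ l / l ! * ‖iteratedFDeriv ℝ l F x‖)
      (fun _ _ => by positivity) (self_mem_range_succ k)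
  calc ‖iteratedFDeriv ℝ k F x‖
      = k ! * (ε ^ k)⁻¹ * (ε ^ k / k ! * ‖iteratedFDeriv ℝ k F x‖) := by field_simp
    _ ≤ _ := mul_le_mul_of_nonneg_left h (by positivity)

theorem jetNorm_one_le_sum {F : E → 𝔸} {M : ℕ → ℝ} {x : E}
    (hM : ∀ l, ‖iteratedFDeriv ℝ l F x‖ ≤ M l) (k : ℕ) :
    jetNorm 1 k F x ≤ ∑ l ∈ range (k + 1), M l := by
  refine sum_le_sum fun l _ => ?_
  have h1 : (1 : ℝ) ≤ l ! := by exact_mod_cast Nat.one_le_of_lt (Nat.factorial_pos l)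
  have h2 : (1 : ℝ) ^ l / l ! ≤ 1 := by rw [one_pow]; exact div_le_one_of_le₀ h1 (by positivity)
  calc _ ≤ 1 * ‖iteratedFDeriv ℝ l F x‖ := mul_le_mul_of_nonneg_right h2 (norm_nonneg _)
    _ ≤ M l := by rw [one_mul]; exact hM l

/-- Powers of a contraction: derivatives grow polynomially in the exponent. -/
theorem norm_iteratedFDeriv_pow_le [NormOneClass 𝔸] {V : E → 𝔸} (hV : ContDiff ℝ (⊤ : ℕ∞) V)
    {B : ℕ → ℝ} {x : E} (hB : ∀ l, ‖iteratedFDeriv ℝ l V x‖ ≤ B l) (h1 : ‖V x‖ ≤ 1)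
    {n : ℕ} (hn : 0 < n) (k : ℕ) :
    ‖iteratedFDeriv ℝ k (fun y => V y ^ n) x‖ ≤
      k ! * (n : ℝ) ^ k * Real.exp (∑ l ∈ range (k + 1), B l) := by
  have hn1 : (1 : ℝ) ≤ n := by exact_mod_cast hn
  have hε : (0 : ℝ) < (n : ℝ)⁻¹ := by positivity
  have hε1 : (n : ℝ)⁻¹ ≤ 1 := inv_le_one_of_one_le₀ hn1
  have hB0 : ∀ l, 0 ≤ B l := fun l => (norm_nonneg _).trans (hB l)
  set Q : ℝ := ∑ l ∈ range (k + 1), B l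
  -- With weight `1/n` each derivative of positive order gains a factor `1/n`, while the value
  -- contributes at most `1`. The jet norm is then at most `1 + Q/n`, whose `n`-th power stays below
  -- `e^Q`; undoing the weight costs only `n^k`.
  have hJ : jetNorm (n : ℝ)⁻¹ k V x ≤ Real.exp ((n : ℝ)⁻¹ * Q) := by
    refine le_trans ?_ (Real.add_one_le_exp _)
    rw [jetNorm, sum_range_succ', add_comm ((n : ℝ)⁻¹ * Q) 1, add_comm]
    have hQ : ∑ l ∈ range k, B (l + 1) ≤ Q := by
      simp only [Q]
      rw [sum_range_succ' B]; linarith [hB0 0]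
    refine add_le_add (by simpa using h1) ?_
    refine le_trans ?_ (mul_le_mul_of_nonneg_left hQ hε.le)
    rw [mul_sum]
    refine sum_le_sum fun l _ => mul_le_mul ?_ (hB _) (norm_nonneg _) hε.le
    have h1 : (1 : ℝ) ≤ (l + 1)! := by exact_mod_cast Nat.one_le_of_lt (Nat.factorial_pos _)
    refine (div_le_self (by positivity) h1).trans ?_
    rw [pow_succ]
    exact mul_le_of_le_one_left hε.le (pow_le_one₀ hε.le hε1)
  refine (norm_iteratedFDeriv_le_jetNorm hε k _ x).trans ?_
  rw [inv_pow, inv_inv]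
  refine mul_le_mul_of_nonneg_left ?_ (by positivity)
  refine (jetNorm_pow_le hε.le (hV.of_le (by exact_mod_cast le_top)) x n).trans ?_
  refine (pow_le_pow_left₀ (jetNorm_nonneg hε.le _ _ _) hJ n).trans ?_
  rw [← Real.exp_nat_mul, ← mul_assoc, mul_inv_cancel₀ (by positivity), one_mul]

end JetNorm

/-! ### Derivatives of exponentials of smooth families. -/

section Exponentials

open Finset Nat

variable {E 𝔸 : Type*} [NormedAddCommGroup E] [NormedSpace ℝ E] [NormedRing 𝔸] [NormedAlgebra ℂ 𝔸]
  [CompleteSpace 𝔸] [NormOneClass 𝔸]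

/-- Termwise differentiation of the power series: by submultiplicativity of the jet norm of weight
`1`, the `n`-th term contributes at most `k! Q^n / n!`. -/
theorem contDiff_exp_and_bound {F : E → 𝔸} (hF : ContDiff ℝ (⊤ : ℕ∞) F) {M : ℕ → ℝ}
    (hM : ∀ l x, ‖iteratedFDeriv ℝ l F x‖ ≤ M l) :
    ContDiff ℝ (⊤ : ℕ∞) (fun x => NormedSpace.exp (F x)) ∧
      ∀ k x, ‖iteratedFDeriv ℝ k (fun x => NormedSpace.exp (F x)) x‖ ≤
        k ! * Real.exp (∑ l ∈ range (k + 1), M l) := by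
  have hexp : (fun x => NormedSpace.exp (F x)) =
      fun x => ∑' n : ℕ, ((n ! : ℝ)⁻¹) • F x ^ n := by
    funext x
    rw [NormedSpace.exp_eq_tsum ℝ]
  set Q : ℕ → ℝ := fun k => ∑ l ∈ range (k + 1), M l
  have hcd : ∀ n : ℕ, ContDiff ℝ (⊤ : ℕ∞) fun x => ((n ! : ℝ)⁻¹) • F x ^ n :=
    fun n => (hF.pow n).const_smul _
  have hb : ∀ (k n : ℕ) (x : E), ‖iteratedFDeriv ℝ k (fun x => ((n ! : ℝ)⁻¹) • F x ^ n) x‖ ≤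
      k ! * (Q k ^ n / n !) := by
    intro k n x
    have hk : ContDiff ℝ k F := hF.of_le (by exact_mod_cast le_top)
    rw [iteratedFDeriv_const_smul_apply' (hk.pow n).contDiffAt, norm_smul]
    have h := norm_iteratedFDeriv_le_jetNorm one_pos k (fun y => F y ^ n) x
    have h2 := (jetNorm_pow_le zero_le_one hk x n).trans (pow_le_pow_left₀
      (jetNorm_nonneg zero_le_one _ _ _) (jetNorm_one_le_sum (fun l => hM l x) k) n)
    rw [one_pow, inv_one, mul_one] at h
    rw [Real.norm_of_nonneg (by positivity)]
    calc (n ! : ℝ)⁻¹ * ‖iteratedFDeriv ℝ k (fun y => F y ^ n) x‖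
        ≤ (n ! : ℝ)⁻¹ * (k ! * Q k ^ n) := by
          refine mul_le_mul_of_nonneg_left (h.trans ?_) (by positivity)
          exact mul_le_mul_of_nonneg_left h2 (by positivity)
      _ = _ := by ring
  have hs : ∀ k, Summable fun n : ℕ => (k ! : ℝ) * (Q k ^ n / n !) :=
    fun k => (Real.summable_pow_div_factorial (Q k)).mul_left _
  rw [hexp]
  refine ⟨contDiff_tsum hcd (fun k _ => hs k) fun k n x _ => hb k n x, fun k x => ?_⟩
  rw [iteratedFDeriv_tsum_apply hcd (fun k _ => hs k) (fun k n x _ => hb k n x)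
    (by exact_mod_cast le_top)]
  have := tsum_of_norm_bounded (hs k).hasSum fun n => hb k n x
  rwa [tsum_mul_left, ← congrFun NormedSpace.exp_eq_tsum_div (Q k), ← Real.exp_eq_exp_ℝ] at this

/-- The derivatives of `exp(i t H)` grow polynomially in `t`. -/
theorem contDiff_exp_smul_and_bound {H : E → 𝔸} (hH : ContDiff ℝ (⊤ : ℕ∞) H) {M : ℕ → ℝ}
    (hM : ∀ l x, ‖iteratedFDeriv ℝ l H x‖ ≤ M l)
    (h1 : ∀ (t : ℝ) x, ‖NormedSpace.exp ((Complex.I * t) • H x)‖ ≤ 1) (t : ℝ) :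
    ContDiff ℝ (⊤ : ℕ∞) (fun x => NormedSpace.exp ((Complex.I * t) • H x)) ∧
      ∀ k x, ‖iteratedFDeriv ℝ k (fun x => NormedSpace.exp ((Complex.I * t) • H x)) x‖ ≤
        k ! * (|t| + 2) ^ k * Real.exp (∑ l ∈ range (k + 1),
          l ! * Real.exp (∑ j ∈ range (l + 1), M j)) := by
  -- This choice keeps `|t/n| ≤ 1`, so that `exp(i(t/n)H)` has bounds independent of `t`, and `n ≤
  -- |t| + 2`. The extra `1` keeps `n` positive when `t = 0`.
  set n : ℕ := ⌈|t|⌉₊ + 1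
  have hn : 0 < n := Nat.succ_pos _
  have hn0 : (n : ℝ) ≠ 0 := by positivity
  have htn : |t| ≤ n := (Nat.le_ceil _).trans (by simp [n])
  have hnt : (n : ℝ) ≤ |t| + 2 := by
    have := Nat.ceil_lt_add_one (abs_nonneg t)
    simp only [n]; push_cast; linarith
  have hz : ‖Complex.I * ((t / n : ℝ) : ℂ)‖ ≤ 1 := by
    rw [norm_mul, Complex.norm_I, one_mul, Complex.norm_real, Real.norm_eq_abs, abs_div,
      Nat.abs_cast]
    exact div_le_one_of_le₀ htn (by positivity)
  set z : ℂ := Complex.I * ((t / n : ℝ) : ℂ)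
  have hzH : ContDiff ℝ (⊤ : ℕ∞) fun x => z • H x := hH.const_smul z
  have hzM : ∀ l x, ‖iteratedFDeriv ℝ l (fun x => z • H x) x‖ ≤ M l := by
    intro l x
    have hl : ContDiffAt ℝ l H x := (hH.of_le (by exact_mod_cast le_top)).contDiffAt
    rw [iteratedFDeriv_const_smul_apply' hl, norm_smul]
    exact (mul_le_of_le_one_left (norm_nonneg _) hz).trans (hM l x)
  obtain ⟨hV, hVb⟩ := contDiff_exp_and_bound hzH hzM
  have hpow : (fun x => NormedSpace.exp ((Complex.I * t) • H x)) =
      fun x => NormedSpace.exp (z • H x) ^ n := by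
    funext x
    let +nondep : NormedAlgebra ℚ 𝔸 := NormedAlgebra.restrictScalars ℚ ℂ 𝔸
    rw [← NormedSpace.exp_nsmul, ← Nat.cast_smul_eq_nsmul ℂ n, smul_smul]
    congr 2
    simp only [z]; push_cast
    have : (n : ℂ) ≠ 0 := by exact_mod_cast hn0
    field_simp
  rw [hpow]
  refine ⟨hV.pow n, fun k x => (norm_iteratedFDeriv_pow_le hV (hVb · x) (h1 _ x) hn k).trans ?_⟩
  gcongr

end Exponentials

/-! ### Exponential series of smooth functions and functional calculus -/

section FourierSeries

open Filter Set
open scoped ContDiff Manifold SchwartzMap FourierTransform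

theorem summable_pow_abs_mul_norm_schwartz (f : 𝓢(ℝ, ℂ)) (k : ℕ) :
    Summable fun m : ℤ => |(m : ℝ)| ^ k * ‖f m‖ := by
  obtain ⟨C, _, hC⟩ := f.decay (k + 2) 0
  have hs : Summable fun m : ℤ => C * (1 / |(m : ℝ)| ^ 2) := by
    have h := Real.summable_one_div_int_pow.2 (one_lt_two)
    simpa only [sq_abs] using h.mul_left C
  refine Summable.of_norm_bounded_eventually hs ?_
  rw [eventually_cofinite]
  -- The index `0` is excepted because the comparison term `1 / 0^2` is `0` by convention.
  refine (finite_singleton (0 : ℤ)).subset fun m hm => ?_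
  by_contra hm0
  refine hm ?_
  have hpos : 0 < |(m : ℝ)| := abs_pos.2 (by exact_mod_cast hm0)
  have h := hC m
  rw [norm_iteratedFDeriv_zero, Real.norm_eq_abs] at h
  rw [Real.norm_of_nonneg (by positivity), mul_one_div, le_div_iff₀ (by positivity)]
  calc _ = |(m : ℝ)| ^ (k + 2) * ‖f m‖ := by ring
    _ ≤ C := h

/-- A function which is smooth near a compact set coincides there with a rapidly convergent series
of exponentials. -/
theorem exists_exponential_series {S U : Set ℝ} (hS : IsCompact S) (hU : IsOpen U) (hSU : S ⊆ U)
    {G : ℝ → ℂ} (hG : ContDiffOn ℝ (⊤ : ℕ∞) G U) :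
    ∃ (c : ℤ → ℂ) (τ : ℝ), (∀ k : ℕ, Summable fun m : ℤ => |(m : ℝ)| ^ k * ‖c m‖) ∧
      ∀ x ∈ S, HasSum (fun m : ℤ => c m * Complex.exp (Complex.I * ((m * τ : ℝ) : ℂ) * x)) (G x) := by
  obtain ⟨R, hR0, hR⟩ : ∃ R : ℝ, 0 < R ∧ S ⊆ Metric.ball 0 R := by
    obtain ⟨R, hR⟩ := hS.isBounded.subset_ball (0 : ℝ)
    exact ⟨max R 1, by positivity, hR.trans (Metric.ball_subset_ball (le_max_left _ _))⟩
  set V : Set ℝ := U ∩ Metric.ball 0 R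
  have hV : IsOpen V := hU.inter Metric.isOpen_ball
  obtain ⟨χ, hχ0, hχ1, -⟩ := exists_contMDiffMap_zero_one_nhds_of_isClosed (n := (⊤ : ℕ∞)) 𝓘(ℝ, ℝ)
    hV.isClosed_compl hS.isClosed
    (disjoint_left.2 fun x hx hxS => hx ⟨hSU hxS, hR hxS⟩)
  have hχ : ContDiff ℝ ∞ χ := χ.contMDiff.contDiff
  -- The cutoff vanishes on a neighbourhood of the complement of `V`, so `g` is smooth on the whole
  -- line whatever `G` does outside `U`, and `g = G` on `S`.
  set g : ℝ → ℂ := fun x => (χ x : ℂ) * G x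
  have hg : ContDiff ℝ ∞ g := by
    refine contDiff_iff_contDiffAt.2 fun x => ?_
    by_cases hx : x ∈ V
    · exact (Complex.ofRealCLM.contDiff.comp hχ).contDiffAt.mul
        ((hG x hx.1).contDiffAt (hU.mem_nhds hx.1))
    · have : g =ᶠ[𝓝 x] fun _ => 0 := by
        filter_upwards [eventually_nhdsSet_iff_forall.1 hχ0 x hx] with y hy
        simp [g, hy]
      exact contDiffAt_const.congr_of_eventuallyEq this
  have hg0 : ∀ x, R ≤ |x| → g x = 0 := fun x hx => by
    have : χ x = 0 := hχ0.self_of_nhdsSet x fun h => by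
      have := h.2; rw [mem_ball_zero_iff, Real.norm_eq_abs] at this; linarith
    simp [g, this]
  -- Rescaling puts the support in `[-1/2, 1/2]`, so that integer translates overlap at most at
  -- endpoints, where `f₀` vanishes.
  set f₀ : ℝ → ℂ := fun y => g (2 * R * y)
  have hf₀ : ContDiff ℝ ∞ f₀ := hg.comp (contDiff_const.mul contDiff_id)
  have hf₀0 : ∀ y, 1 / 2 ≤ |y| → f₀ y = 0 := fun y hy => hg0 _ (by
    rw [abs_mul, abs_of_pos (by positivity : 0 < 2 * R)]; nlinarith)
  have hcs : HasCompactSupport f₀ := by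
    refine HasCompactSupport.intro (isCompact_Icc (a := (-1 / 2 : ℝ)) (b := 1 / 2)) fun y hy => ?_
    refine hf₀0 y ?_
    by_contra h
    rw [not_le, abs_lt] at h
    exact hy ⟨by linarith [h.1], by linarith [h.2]⟩
  set f : 𝓢(ℝ, ℂ) := hcs.toSchwartzMap hf₀
  have hf : ∀ y, f y = f₀ y := fun y => rfl
  refine ⟨fun m => 𝓕 f m, 2 * Real.pi / (2 * R), summable_pow_abs_mul_norm_schwartz _, ?_⟩
  intro x hx
  have hxR : |x| < R := by have := hR hx; rwa [mem_ball_zero_iff] at this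
  have hy2 : |x / (2 * R)| < 1 / 2 := by
    rw [abs_div, abs_of_pos (by positivity : 0 < 2 * R), div_lt_iff₀ (by positivity)]; linarith
  have hP := SchwartzMap.tsum_eq_tsum_fourier f (x / (2 * R))
  -- In Poisson's formula at `x/(2R)` only the translate by `0` survives. The other side is the
  -- required series, with the Fourier transform at the integers as coefficients.
  rw [tsum_eq_single 0] at hP
  · have hGx : f (x / (2 * R) + ((0 : ℤ) : ℝ)) = G x := by
      rw [hf]
      simp only [f₀, Int.cast_zero, add_zero]
      rw [mul_div_cancel₀ x (by positivity : 2 * R ≠ 0)]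
      have h1 : χ x = 1 := hχ1.self_of_nhdsSet x hx
      simp [g, h1]
    rw [hGx] at hP
    have hterm : ∀ m : ℤ, 𝓕 f m * fourier m ((x / (2 * R) : ℝ) : UnitAddCircle) =
        𝓕 f m * Complex.exp (Complex.I * ((m * (2 * Real.pi / (2 * R)) : ℝ) : ℂ) * x) := by
      intro m
      rw [fourier_coe_apply]
      congr 2
      push_cast; ring
    simp only [hterm] at hP
    rw [hP]
    refine Summable.hasSum ?_
    refine Summable.of_norm_bounded (summable_pow_abs_mul_norm_schwartz (𝓕 f) 0) fun m => ?_
    rw [norm_mul, pow_zero, one_mul, mul_assoc, ← Complex.ofReal_mul, mul_comm Complex.I,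
      Complex.norm_exp_ofReal_mul_I, mul_one]
  · intro m hm
    refine hf₀0 _ ?_
    have h1 : (1 : ℝ) ≤ |(m : ℝ)| := by exact_mod_cast Int.one_le_abs hm
    have h2 := abs_sub_abs_le_abs_sub (m : ℝ) (-(x / (2 * R)))
    rw [abs_neg, sub_neg_eq_add, add_comm] at h2
    linarith

end FourierSeries

/-! ### Smooth functional calculus through exponential series. -/

section FunctionalCalculus

open Filter

variable {𝔸 : Type*} [CStarAlgebra 𝔸]

theorem spectrum_re_mem {h : 𝔸} (hh : IsSelfAdjoint h) {S : Set ℝ} (hS : spectrum ℝ h ⊆ S) {z : ℂ}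
    (hz : z ∈ spectrum ℂ h) : z.re ∈ S ∧ (z.re : ℂ) = z := by
  have h1 : (z.re : ℂ) = z := (hh.mem_spectrum_eq_re hz).symm
  refine ⟨hS ((spectrum.algebraMap_mem_iff ℂ).1 ?_), h1⟩
  rwa [Complex.coe_algebraMap, h1]

/-- The exponential of `i` times a self-adjoint element is unitary. This is the contraction
hypothesis that makes growth in `t` polynomial rather than exponential. -/
theorem norm_exp_smul_le {h : 𝔸} (hh : IsSelfAdjoint h) (t : ℝ) [Nontrivial 𝔸] :
    ‖NormedSpace.exp ((Complex.I * t) • h)‖ ≤ 1 := by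
  have h1 : IsSelfAdjoint ((t : ℂ) • h) := IsSelfAdjoint.smul (by simp [IsSelfAdjoint]) hh
  have := norm_unitary_le (selfAdjoint.expUnitary ⟨(t : ℂ) • h, h1⟩)
  rwa [selfAdjoint.expUnitary_coe, smul_smul] at this

theorem exp_smul_eq_cfc {h : 𝔸} (hh : IsSelfAdjoint h) (z : ℂ) :
    NormedSpace.exp (z • h) = cfc (fun w : ℂ => Complex.exp (z * w)) h := by
  have hn : IsStarNormal h := hh.isStarNormal
  have hn' : IsStarNormal (z • h) := inferInstance
  rw [← CFC.complex_exp_eq_normedSpace_exp (a := z • h) hn']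
  exact (cfc_comp_smul z Complex.exp h (Complex.continuous_exp.continuousOn) hn).symm

/-- The spectrum is real, so the terms have modulus `‖c m‖` there and the series converges uniformly
on it; functional calculus is continuous for uniform convergence. -/
theorem hasSum_realFC {S : Set ℝ} {G : ℝ → ℂ} {c : ℤ → ℂ} {τ : ℝ}
    (hc : Summable fun m : ℤ => ‖c m‖)
    (hG : ∀ x ∈ S, HasSum (fun m : ℤ => c m * Complex.exp (Complex.I * ((m * τ : ℝ) : ℂ) * x)) (G x))
    {h : 𝔸} (hh : IsSelfAdjoint h) (hS : spectrum ℝ h ⊆ S) :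
    HasSum (fun m : ℤ => c m • NormedSpace.exp ((Complex.I * ((m * τ : ℝ) : ℂ)) • h))
      (realFC G h) := by
  have hcont : ∀ m : ℤ, Continuous fun w : ℂ =>
      c m * Complex.exp (Complex.I * ((m * τ : ℝ) : ℂ) * w) := fun m => by fun_prop
  have hunif := tendstoUniformlyOn_tsum (s := spectrum ℂ h) hc (f := fun (m : ℤ) (w : ℂ) =>
      c m * Complex.exp (Complex.I * ((m * τ : ℝ) : ℂ) * w)) (by
    intro m z hz
    rw [← (spectrum_re_mem hh hS hz).2, norm_mul, mul_assoc, ← Complex.ofReal_mul,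
      mul_comm Complex.I, Complex.norm_exp_ofReal_mul_I, mul_one])
  have hunif2 : TendstoUniformlyOn (fun (t : Finset ℤ) (w : ℂ) => ∑ m ∈ t,
      c m * Complex.exp (Complex.I * ((m * τ : ℝ) : ℂ) * w)) (fun z => G z.re) atTop
      (spectrum ℂ h) := by
    refine hunif.congr_right fun z hz => ?_
    have hz' := spectrum_re_mem hh hS hz
    have := (hG _ hz'.1).tsum_eq
    rwa [hz'.2] at this
  have ht := tendsto_cfc_fun hunif2 (Eventually.of_forall fun t =>
    (continuous_finsetSum t fun m _ => hcont m).continuousOn)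
  rw [HasSum, SummationFilter.unconditional_filter]
  refine ht.congr fun t => ?_
  have hsum : (fun w : ℂ => ∑ m ∈ t, c m * Complex.exp (Complex.I * ((m * τ : ℝ) : ℂ) * w)) =
      ∑ m ∈ t, fun w : ℂ => c m * Complex.exp (Complex.I * ((m * τ : ℝ) : ℂ) * w) := by
    ext; simp
  rw [hsum, cfc_sum _ h t fun m _ => (hcont m).continuousOn]
  refine Finset.sum_congr rfl fun m _ => ?_
  rw [cfc_const_mul _ _ _ (by fun_prop), exp_smul_eq_cfc hh]

theorem continuousOn_realFC {G : ℝ → ℂ} {S : Set ℝ} (hG : ContinuousOn G S) {h : 𝔸}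
    (hh : IsSelfAdjoint h) (hS : spectrum ℝ h ⊆ S) :
    ContinuousOn (fun z : ℂ => G z.re) (spectrum ℂ h) :=
  hG.comp Complex.continuous_re.continuousOn fun _ hz => (spectrum_re_mem hh hS hz).1

theorem map_realFC {𝔹 : Type*} [CStarAlgebra 𝔹] (f : 𝔸 →⋆ₐ[ℂ] 𝔹) {G : ℝ → ℂ} {S : Set ℝ}
    (hG : ContinuousOn G S) {h : 𝔸} (hh : IsSelfAdjoint h) (hS : spectrum ℝ h ⊆ S) :
    f (realFC G h) = realFC G (f h) :=
  StarAlgHom.map_cfc f _ h (continuousOn_realFC hG hh hS) (TwistedAlg.continuous_starAlgHom f)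
    hh.isStarNormal (hh.map f).isStarNormal

theorem spectrum_map_subset {𝔹 : Type*} [CStarAlgebra 𝔹] (f : 𝔸 →⋆ₐ[ℂ] 𝔹) (h : 𝔸) :
    spectrum ℝ (f h) ⊆ spectrum ℝ h :=
  AlgHom.spectrum_apply_subset ((f : 𝔸 →ₐ[ℂ] 𝔹).restrictScalars ℝ) h

/-- Smooth functional calculus preserves smooth families of self-adjoint elements, with bounds on
the derivatives that depend only on the function and on bounds for the family. -/
theorem exists_bound_realFC {S U : Set ℝ} (hS : IsCompact S) (hU : IsOpen U) (hSU : S ⊆ U)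
    {G : ℝ → ℂ} (hG : ContDiffOn ℝ (⊤ : ℕ∞) G U) (M : ℕ → ℝ) :
    ∃ M' : ℕ → ℝ, ∀ {E : Type} {𝔸 : Type u} [NormedAddCommGroup E] [NormedSpace ℝ E]
      [CStarAlgebra 𝔸] [Nontrivial 𝔸] (H : E → 𝔸), ContDiff ℝ (⊤ : ℕ∞) H →
      (∀ l x, ‖iteratedFDeriv ℝ l H x‖ ≤ M l) → (∀ x, IsSelfAdjoint (H x)) →
      (∀ x, spectrum ℝ (H x) ⊆ S) →
      ContDiff ℝ (⊤ : ℕ∞) (fun x => realFC G (H x)) ∧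
        ∀ l x, ‖iteratedFDeriv ℝ l (fun x => realFC G (H x)) x‖ ≤ M' l := by
  -- The series is chosen before the algebra and the family `H`, which makes the resulting bounds
  -- uniform in both.
  obtain ⟨c, τ, hc, hGs⟩ := exists_exponential_series hS hU hSU hG
  set Q : ℕ → ℝ := fun k => Real.exp (∑ l ∈ Finset.range (k + 1),
    l.factorial * Real.exp (∑ j ∈ Finset.range (l + 1), M j))
  -- The `m`-th term is differentiated at time `t = mτ`. Its polynomial growth in `m` is beaten by
  -- the rapid decrease of `c`, after a binomial expansion of `(|mτ| + 2)^k`.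
  set v : ℕ → ℤ → ℝ := fun k m => ‖c m‖ * (k.factorial * (|m * τ| + 2) ^ k * Q k)
  have hv : ∀ k, Summable (v k) := by
    intro k
    have h1 : Summable fun m : ℤ => (k.factorial * Q k) * ∑ i ∈ Finset.range (k + 1),
        (|(m : ℝ)| ^ i * ‖c m‖) * (|τ| ^ i * 2 ^ (k - i) * (k.choose i)) :=
      (summable_sum fun i _ => (hc i).mul_right _).mul_left _
    refine h1.congr fun m => ?_
    simp only [v]
    rw [abs_mul, add_pow, Finset.mul_sum, Finset.mul_sum, Finset.sum_mul, Finset.mul_sum]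
    refine Finset.sum_congr rfl fun i _ => ?_
    rw [mul_pow]; ring
  refine ⟨fun k => ∑' m, v k m, fun {E 𝔸} _ _ _ _ H hH hM hsa hsp => ?_⟩
  have hexp := contDiff_exp_smul_and_bound hH hM fun t x => norm_exp_smul_le (hsa x) t
  have heq : (fun x => realFC G (H x)) = fun x => ∑' m : ℤ,
      c m • NormedSpace.exp ((Complex.I * ((m * τ : ℝ) : ℂ)) • H x) := by
    funext x
    exact (hasSum_realFC (by simpa using hc 0) hGs (hsa x) (hsp x)).tsum_eq.symm
  have hcd : ∀ m : ℤ, ContDiff ℝ (⊤ : ℕ∞) fun x =>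
      c m • NormedSpace.exp ((Complex.I * ((m * τ : ℝ) : ℂ)) • H x) :=
    fun m => (hexp _).1.const_smul _
  have hb : ∀ (k : ℕ) (m : ℤ) (x : E), ‖iteratedFDeriv ℝ k (fun x =>
      c m • NormedSpace.exp ((Complex.I * ((m * τ : ℝ) : ℂ)) • H x)) x‖ ≤ v k m := by
    intro k m x
    rw [iteratedFDeriv_const_smul_apply'
      (((hexp (m * τ)).1.of_le (by exact_mod_cast le_top)).contDiffAt), norm_smul]
    exact mul_le_mul_of_nonneg_left ((hexp (m * τ)).2 k x) (norm_nonneg _)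
  rw [heq]
  refine ⟨contDiff_tsum hcd (fun k _ => hv k) fun k m x _ => hb k m x, fun k x => ?_⟩
  rw [iteratedFDeriv_tsum_apply hcd (fun k _ => hv k) (fun k m x _ => hb k m x)
    (by exact_mod_cast le_top)]
  exact tsum_of_norm_bounded (hv k).hasSum fun m => hb k m x

end FunctionalCalculus

/-! ### Products of projectively commuting unitaries -/

section GroupLemmas

variable {Γ : Type*} [Group Γ]

theorem prod_ofFn_mul_of_commute {M : Type*} [Monoid M] {d : ℕ} (u w : Fin d → M)
    (h : ∀ i j, Commute (u i) (w j)) :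
    (List.ofFn fun j => u j * w j).prod = (List.ofFn u).prod * (List.ofFn w).prod := by
  induction d with
  | zero => simp
  | succ d ih =>
    simp only [List.ofFn_succ, List.prod_cons]
    rw [ih (fun j => u j.succ) (fun j => w j.succ) fun i j => h _ _]
    have hc : Commute (List.ofFn fun j : Fin d => u j.succ).prod (w 0) := by
      refine Commute.list_prod_left _ _ fun a ha => ?_
      obtain ⟨j, rfl⟩ := List.mem_ofFn.1 ha
      exact h _ _
    simp only [mul_assoc]
    rw [← mul_assoc (w 0), ← hc.eq, mul_assoc]

theorem prod_ofFn_eq_single {M : Type*} [Monoid M] {d : ℕ} (f : Fin d → M) (k : Fin d)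
    (h : ∀ j, j ≠ k → f j = 1) : (List.ofFn f).prod = f k := by
  induction d with
  | zero => exact k.elim0
  | succ d ih =>
    rw [List.ofFn_succ, List.prod_cons]
    rcases Fin.eq_zero_or_eq_succ k with rfl | ⟨k, rfl⟩
    · have : (List.ofFn fun j : Fin d => f j.succ).prod = 1 := by
        refine List.prod_eq_one fun a ha => ?_
        obtain ⟨j, rfl⟩ := List.mem_ofFn.1 ha
        exact h _ (Fin.succ_ne_zero j)
      rw [this, mul_one]
    · rw [h 0 (Fin.succ_ne_zero k).symm, one_mul]
      exact ih (fun j => f j.succ) k fun j hj => h _ fun e => hj (Fin.succ_injective _ e)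

/-- The ordered product `g_1^{x_1} ⋯ g_d^{x_d}`. -/
def ordProd {d : ℕ} (g : Fin d → Γ) (x : Fin d → ℤ) : Γ := (List.ofFn fun j => g j ^ x j).prod

theorem map_ordProd {Δ : Type*} [Group Δ] (f : Γ →* Δ) {d : ℕ} (g : Fin d → Γ) (x : Fin d → ℤ) :
    f (ordProd g x) = ordProd (fun j => f (g j)) x := by
  simp only [ordProd, map_list_prod, List.map_ofFn]
  congr 2
  funext j
  simp

theorem ordProd_mul_left_of_commute {d : ℕ} (c g : Fin d → Γ) (h : ∀ i j, Commute (c i) (g j))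
    (x : Fin d → ℤ) : ordProd (fun j => c j * g j) x = ordProd c x * ordProd g x := by
  simp only [ordProd]
  rw [← prod_ofFn_mul_of_commute _ _ fun i j => (h i j).zpow_zpow _ _]
  congr 2
  funext j
  exact (h j j).mul_zpow _

theorem ordProd_add {d : ℕ} (g : Fin d → Γ) (h : ∀ i j, Commute (g i) (g j)) (x y : Fin d → ℤ) :
    ordProd g (x + y) = ordProd g x * ordProd g y := by
  simp only [ordProd]
  rw [← prod_ofFn_mul_of_commute _ _ fun i j => (h i j).zpow_zpow _ _]
  congr 2
  funext j
  exact zpow_add _ _ _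

theorem ordProd_single {d : ℕ} (g : Fin d → Γ) (j : Fin d) :
    ordProd g (Pi.single j 1) = g j := by
  rw [ordProd, prod_ofFn_eq_single _ j fun i hi => by rw [Pi.single_eq_of_ne hi, zpow_zero],
    Pi.single_eq_same, zpow_one]

end GroupLemmas

/-! ### Unitaries modulo scalars. -/

section Scalars

variable {A : Type*} [CStarAlgebra A]

/-- The scalars of modulus one, as unitary elements. -/
def scalarUnitary : Circle →* unitary A where
  toFun z := ⟨(z : ℂ) • 1, by
    have h : star (z : ℂ) * z = 1 := by
      rw [Complex.star_def, ← Complex.normSq_eq_conj_mul_self, Circle.normSq_coe]; simp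
    rw [Unitary.mem_iff]
    constructor
    · rw [star_smul, smul_mul_smul_comm, h, star_one, one_mul, one_smul]
    · rw [star_smul, smul_mul_smul_comm, mul_comm, h, star_one, one_mul, one_smul]⟩
  map_one' := Subtype.ext (by simp)
  map_mul' z w := Subtype.ext (by simp [smul_smul, mul_comm])

theorem coe_scalarUnitary_mul (z : Circle) (v : unitary A) :
    ((scalarUnitary z * v : unitary A) : A) = (z : ℂ) • (v : A) := by
  simp [scalarUnitary]

theorem scalarUnitary_commute (z : Circle) (v : unitary A) : Commute (scalarUnitary z) v :=
  Subtype.ext (by simp [scalarUnitary])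

/-- Scalars are central. In the quotient by them the generators commute, so identities between
monomials up to a phase become identities in a group, and the phases need not be computed. -/
instance scalarUnitary_range_normal : (scalarUnitary (A := A)).range.Normal where
  conj_mem := by
    rintro _ ⟨z, rfl⟩ g
    exact ⟨z, by rw [← (scalarUnitary_commute z g).eq, mul_inv_cancel_right]⟩

theorem mk_scalarUnitary_mul (z : Circle) (v : unitary A) :
    (QuotientGroup.mk (scalarUnitary z * v) : unitary A ⧸ (scalarUnitary (A := A)).range) =
      QuotientGroup.mk v :=
  QuotientGroup.eq.2 ⟨z⁻¹, by
    rw [mul_inv_rev, mul_assoc, ← map_inv, (scalarUnitary_commute _ v).eq, inv_mul_cancel_left]⟩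

theorem exists_scalar_of_mk_eq {v w : unitary A}
    (h : (QuotientGroup.mk v : unitary A ⧸ (scalarUnitary (A := A)).range) = QuotientGroup.mk w) :
    ∃ z : Circle, (v : A) = (z : ℂ) • (w : A) := by
  obtain ⟨z, hz⟩ := QuotientGroup.eq.1 h.symm
  refine ⟨z, ?_⟩
  rw [← coe_scalarUnitary_mul, (scalarUnitary_commute z w).eq, hz, mul_inv_cancel_left]

end Scalars

/-! ### Monomials -/

namespace TwistedAlg

variable {N : ℕ} {d : ℕ} {X : Type u} [TopologicalSpace X] [CompactSpace X]
  {T : Fin d → C(X, X)} {φ : Matrix (Fin d) (Fin d) ℝ} {m : ℕ}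

/-- The phase in the definition of `u_x`. -/
def monomialPhase (φ : Matrix (Fin d) (Fin d) ℝ) (x : Fin d → ℤ) : Circle :=
  Circle.exp (-(1 / 2) * ∑ i : Fin d, ∑ j ∈ Finset.Ioi i, φ i j * x i * x j)

/-- The monomials, as unitary elements. -/
def umonomial (x : Fin d → ℤ) : unitary (TwistedAlg N T φ m) :=
  scalarUnitary (monomialPhase φ x) * ordProd ugen x

theorem coe_umonomial (x : Fin d → ℤ) :
    ((umonomial x : unitary (TwistedAlg N T φ m)) : TwistedAlg N T φ m) = monomial x := by
  rw [umonomial, coe_scalarUnitary_mul, monomial, monomialPhase, Circle.coe_exp]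
  congr 2
  push_cast
  ring

theorem monomial_zero : (monomial 0 : TwistedAlg N T φ m) = 1 := by
  simp [monomial]

theorem mk_umonomial (x : Fin d → ℤ) :
    (QuotientGroup.mk (umonomial x : unitary (TwistedAlg N T φ m)) :
      unitary (TwistedAlg N T φ m) ⧸ scalarUnitary.range) =
    ordProd (fun j => QuotientGroup.mk (ugen j)) x := by
  rw [umonomial, mk_scalarUnitary_mul]
  exact map_ordProd (QuotientGroup.mk' _) _ _

theorem commute_mk_ugen (i j : Fin d) :
    Commute (QuotientGroup.mk (ugen i : unitary (TwistedAlg N T φ m)) :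
      unitary (TwistedAlg N T φ m) ⧸ scalarUnitary.range) (QuotientGroup.mk (ugen j)) := by
  have : (ugen i * ugen j : unitary (TwistedAlg N T φ m)) =
      scalarUnitary (Circle.exp (φ i j)) * (ugen j * ugen i) := by
    refine Subtype.ext ?_
    rw [coe_scalarUnitary_mul, Circle.coe_exp, mul_comm _ Complex.I]
    exact gen_comm i j
  rw [Commute, SemiconjBy, ← QuotientGroup.mk_mul, ← QuotientGroup.mk_mul, this,
    mk_scalarUnitary_mul]

/-- Both sides have the same class modulo scalars, where ordered products of the commuting
generators are additive in the exponent. -/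
theorem exists_gen_mul_monomial (j : Fin d) (x : Fin d → ℤ) : ∃ z : Circle,
    (gen j * monomial x : TwistedAlg N T φ m) = (z : ℂ) • monomial (Pi.single j 1 + x) := by
  have h := exists_scalar_of_mk_eq (v := (ugen j * umonomial x : unitary (TwistedAlg N T φ m)))
    (w := umonomial (Pi.single j 1 + x)) (by
      rw [QuotientGroup.mk_mul, mk_umonomial, mk_umonomial, ordProd_add _ commute_mk_ugen,
        ordProd_single])
  simp only [Submonoid.coe_mul, coe_umonomial] at h
  exact h

theorem exists_star_gen_mul_monomial (j : Fin d) (x : Fin d → ℤ) : ∃ z : Circle,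
    (star (gen j) * monomial x : TwistedAlg N T φ m) =
      (z : ℂ) • monomial (-Pi.single j 1 + x) := by
  have h := exists_scalar_of_mk_eq
    (v := ((ugen j)⁻¹ * umonomial x : unitary (TwistedAlg N T φ m)))
    (w := umonomial (-Pi.single j 1 + x)) (by
      rw [QuotientGroup.mk_mul, mk_umonomial, mk_umonomial, QuotientGroup.mk_inv, inv_mul_eq_iff_eq_mul]
      conv_rhs => rw [← ordProd_single (fun j => QuotientGroup.mk (ugen j)) j]
      rw [← ordProd_add _ commute_mk_ugen, add_neg_cancel_left])
  simp only [Submonoid.coe_mul, coe_umonomial] at h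
  exact h

theorem monomial_mul_star (x : Fin d → ℤ) :
    (monomial x * star (monomial x) : TwistedAlg N T φ m) = 1 := by
  rw [← coe_umonomial]; exact Unitary.mul_star_self_of_mem (umonomial x).2

theorem star_monomial_mul (x : Fin d → ℤ) :
    (star (monomial x) * monomial x : TwistedAlg N T φ m) = 1 := by
  rw [← coe_umonomial]; exact Unitary.star_mul_self_of_mem (umonomial x).2

theorem norm_monomial_le (x : Fin d → ℤ) [Nontrivial (TwistedAlg N T φ m)] :
    ‖(monomial x : TwistedAlg N T φ m)‖ ≤ 1 := by
  rw [← coe_umonomial]; exact norm_unitary_le _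

/-! ### Density of the polynomials -/

/-- The defining relation moves a function to the right of `gen j`; a left inverse of the dynamics
is what allows the opposite move. -/
theorem gen_mul_fn {T' : Fin d → C(X, X)} (hT : ∀ j, (T' j).comp (T j) = ContinuousMap.id X)
    (f : MatFun N X) (j : Fin d) :
    gen j * fn f = (fn (f.comp (T' j)) * gen j : TwistedAlg N T φ m) := by
  rw [fn_gen, ContinuousMap.comp_assoc, hT, ContinuousMap.comp_id]

theorem star_gen_mul_fn (f : MatFun N X) (j : Fin d) :
    star (gen j) * fn f = (fn (f.comp (T j)) * star (gen j) : TwistedAlg N T φ m) := by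
  have h := fn_gen (T := T) (φ := φ) (m := m) f j
  have hu : (gen j : TwistedAlg N T φ m) ∈ unitary _ := gen_mem_unitary j
  calc star (gen j) * fn f = star (gen j) * (fn f * gen j) * star (gen j) := by
        rw [mul_assoc, mul_assoc, Unitary.mul_star_self_of_mem hu, mul_one]
    _ = star (gen j) * gen j * fn (f.comp (T j)) * star (gen j) := by rw [h]; simp only [mul_assoc]
    _ = _ := by rw [Unitary.star_mul_self_of_mem hu, one_mul]

/-- A closed subspace which contains all `f u_x` is everything. -/
theorem submodule_eq_top {T' : Fin d → C(X, X)}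
    (hT : ∀ j, (T' j).comp (T j) = ContinuousMap.id X) (M : Submodule ℂ (TwistedAlg N T φ m))
    (hM : IsClosed (M : Set (TwistedAlg N T φ m))) (h : ∀ f x, fn f * monomial x ∈ M) : M = ⊤ := by
  set M₀ : Submodule ℂ (TwistedAlg N T φ m) :=
    Submodule.span ℂ (Set.range fun p : MatFun N X × (Fin d → ℤ) => fn p.1 * monomial p.2)
  set M₁ : Submodule ℂ (TwistedAlg N T φ m) := M₀.topologicalClosure
  have hmem : ∀ f x, fn f * monomial x ∈ M₀ := fun f x => Submodule.subset_span ⟨(f, x), rfl⟩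
  have hclosed : IsClosed (M₁ : Set (TwistedAlg N T φ m)) := M₀.isClosed_topologicalClosure
  have hle : M₁ ≤ M := M₀.topologicalClosure_minimal
    (Submodule.span_le.2 (by rintro _ ⟨p, rfl⟩; exact h _ _)) hM
  have hinv : ∀ a : TwistedAlg N T φ m, (∀ f x, a * (fn f * monomial x) ∈ M₀) →
      ∀ b ∈ M₁, a * b ∈ M₁ := by
    intro a ha b hb
    have h0 : M₀ ≤ M₀.comap (LinearMap.mulLeft ℂ a) :=
      Submodule.span_le.2 (by rintro _ ⟨p, rfl⟩; exact ha _ _)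
    have hcl : IsClosed (M₁.comap (LinearMap.mulLeft ℂ a) : Set (TwistedAlg N T φ m)) :=
      hclosed.preimage (continuous_const.mul continuous_id)
    exact M₀.topologicalClosure_minimal
      (t := M₁.comap (LinearMap.mulLeft ℂ a))
      (fun c hc => M₀.le_topologicalClosure (h0 hc)) hcl hb
  -- The elements that, together with their adjoints, multiply the closed span `M₁` into itself form
  -- a closed ⋆-subalgebra. It contains the generators, hence is everything, and `1 ∈ M₁` concludes.
  let St : StarSubalgebra ℂ (TwistedAlg N T φ m) :=
    { carrier := {a | (∀ b ∈ M₁, a * b ∈ M₁) ∧ ∀ b ∈ M₁, star a * b ∈ M₁}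
      mul_mem' := fun {a b} ha hb => ⟨fun c hc => by rw [mul_assoc]; exact ha.1 _ (hb.1 _ hc),
        fun c hc => by rw [star_mul, mul_assoc]; exact hb.2 _ (ha.2 _ hc)⟩
      add_mem' := fun {a b} ha hb =>
        ⟨fun c hc => by rw [add_mul]; exact M₁.add_mem (ha.1 _ hc) (hb.1 _ hc),
          fun c hc => by rw [star_add, add_mul]; exact M₁.add_mem (ha.2 _ hc) (hb.2 _ hc)⟩
      algebraMap_mem' := fun z => ⟨fun c hc => by
          rw [← Algebra.smul_def]; exact M₁.smul_mem _ hc,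
        fun c hc => by
          rw [← algebraMap_star_comm, ← Algebra.smul_def]; exact M₁.smul_mem _ hc⟩
      star_mem' := fun {a} ha => ⟨ha.2, by rw [star_star]; exact ha.1⟩ }
  have hSt : IsClosed (St : Set (TwistedAlg N T φ m)) := by
    have : (St : Set (TwistedAlg N T φ m)) =
        (⋂ b ∈ M₁, {a | a * b ∈ M₁}) ∩ ⋂ b ∈ M₁, {a | star a * b ∈ M₁} := by
      ext a; simp [St]
    rw [this]
    exact (isClosed_biInter fun b _ => hclosed.preimage (continuous_id.mul continuous_const)).inter
      (isClosed_biInter fun b _ => hclosed.preimage (continuous_star.mul continuous_const))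
  have htop := eq_top_of_isClosed St hSt
    (fun f => by
      have hf : ∀ g : MatFun N X, ∀ b ∈ M₁, fn g * b ∈ M₁ := fun g => hinv _ fun f' x => by
        rw [← mul_assoc, ← map_mul]; exact hmem _ _
      exact ⟨hf f, by rw [← map_star]; exact hf _⟩)
    (fun j => by
      refine ⟨hinv _ fun f x => ?_, hinv _ fun f x => ?_⟩
      · obtain ⟨z, hz⟩ := exists_gen_mul_monomial (N := N) (T := T) (φ := φ) (m := m) j x
        rw [← mul_assoc, gen_mul_fn hT, mul_assoc, hz, mul_smul_comm]
        exact M₀.smul_mem _ (hmem _ _)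
      · obtain ⟨z, hz⟩ := exists_star_gen_mul_monomial (N := N) (T := T) (φ := φ) (m := m) j x
        rw [← mul_assoc, star_gen_mul_fn, mul_assoc, hz, mul_smul_comm]
        exact M₀.smul_mem _ (hmem _ _))
  have h1 : (1 : TwistedAlg N T φ m) ∈ M₁ := by
    have := M₀.le_topologicalClosure (hmem 1 0)
    rwa [map_one, monomial_zero, one_mul] at this
  refine eq_top_iff.2 fun a _ => hle ?_
  have ha : a ∈ St := htop ▸ StarSubalgebra.mem_top
  simpa using ha.1 1 h1

end TwistedAlg

namespace TwistedAlg

/-! ### The torus action on polynomials -/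

section

variable {N : ℕ} {d : ℕ} {X : Type u} [TopologicalSpace X] [CompactSpace X]
  {T : Fin d → C(X, X)} {φ : Matrix (Fin d) (Fin d) ℝ} {m : ℕ}

/-- The scalars `c j` are central and can be pulled out of the ordered product. This serves both the
torus action and, with `c = 1`, the map to finite volume. -/
theorem map_monomial {N' : ℕ} {X' : Type u} [TopologicalSpace X'] [CompactSpace X']
    {T' : Fin d → C(X', X')} {m' : ℕ} (f : TwistedAlg N T φ m →⋆ₐ[ℂ] TwistedAlg N' T' φ m')
    (c : Fin d → Circle) (hf : ∀ j, f (gen j) = (c j : ℂ) • gen j) (x : Fin d → ℤ) :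
    f (monomial x) = ((ordProd c x : Circle) : ℂ) • monomial x := by
  set Φ : unitary (TwistedAlg N T φ m) →* unitary (TwistedAlg N' T' φ m') :=
    (Unitary.map (StarMonoidHom.ofClass f)).toMonoidHom
  have hΦ : ∀ v : unitary (TwistedAlg N T φ m), ((Φ v : unitary _) : TwistedAlg N' T' φ m') = f v :=
    fun _ => rfl
  have hsc : ∀ z : Circle, Φ (scalarUnitary z) = scalarUnitary z :=
    fun z => Subtype.ext (by rw [hΦ]; simp [scalarUnitary])
  have hgen : ∀ j, Φ (ugen j) = scalarUnitary (c j) * ugen j :=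
    fun j => Subtype.ext (by rw [hΦ, coe_scalarUnitary_mul]; exact hf j)
  rw [← coe_umonomial, ← hΦ, umonomial, map_mul, hsc, map_ordProd]
  simp only [hgen]
  rw [ordProd_mul_left_of_commute _ _ fun i j => scalarUnitary_commute _ _,
    ← map_ordProd scalarUnitary, ← mul_assoc, (scalarUnitary_commute _ (scalarUnitary _)).eq,
    mul_assoc, coe_scalarUnitary_mul]
  congr 1
  exact coe_umonomial x

end

variable {N : ℕ} {d : ℕ} {X : Type u} [TopologicalSpace X] [CompactSpace X]
  {T : Fin d → C(X, X)} {φ : Matrix (Fin d) (Fin d) ℝ}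

/-- The character `θ ↦ e^{-i x·θ}`. -/
def character (x : Fin d → ℤ) (θ : Fin d → ℝ) : ℂ :=
  Complex.exp (-Complex.I * ∑ j, (x j * θ j : ℂ))

theorem norm_character (x : Fin d → ℤ) (θ : Fin d → ℝ) : ‖character x θ‖ = 1 := by
  have : character x θ = Complex.exp (((-∑ j, (x j * θ j) : ℝ) : ℂ) * Complex.I) := by
    rw [character]; congr 1; push_cast; ring
  rw [this, Complex.norm_exp_ofReal_mul_I]

theorem character_add (x y : Fin d → ℤ) (θ : Fin d → ℝ) :
    character (x + y) θ = character x θ * character y θ := by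
  simp only [character]
  rw [← Complex.exp_add, ← mul_add, ← Finset.sum_add_distrib]
  congr 3
  funext j
  simp; ring

theorem character_zero (θ : Fin d → ℝ) : character 0 θ = 1 := by simp [character]

theorem contDiff_character (x : Fin d → ℤ) : ContDiff ℝ (⊤ : ℕ∞) (character x) := by
  unfold character
  refine ContDiff.cexp (contDiff_const.mul (ContDiff.sum fun j _ => contDiff_const.mul ?_))
  exact Complex.ofRealCLM.contDiff.comp (contDiff_apply ℝ ℝ j)

theorem gauge_monomial (θ : Fin d → ℝ) (x : Fin d → ℤ) :
    gauge θ (monomial x : TwistedAlg N T φ 0) = character x θ • monomial x := by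
  rw [map_monomial (gauge θ) (fun j => Circle.exp (-θ j)) (fun j => by
    rw [gauge_gen, Circle.coe_exp, mul_comm])]
  congr 1
  have hp : ((∏ j, Circle.exp (-θ j) ^ x j : Circle) : ℂ) =
      ∏ j, ((Circle.exp (-θ j) ^ x j : Circle) : ℂ) := map_prod Circle.coeHom _ _
  rw [ordProd, List.prod_ofFn, hp, character, Finset.mul_sum, Complex.exp_sum]
  refine Finset.prod_congr rfl fun j _ => ?_
  rw [Circle.coe_zpow, Circle.coe_exp, ← Complex.exp_int_mul]
  congr 1
  push_cast; ring

theorem gauge_fn_mul_monomial (θ : Fin d → ℝ) (f : MatFun N X) (x : Fin d → ℤ) :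
    gauge θ (fn f * monomial x : TwistedAlg N T φ 0) = character x θ • (fn f * monomial x) := by
  rw [map_mul, gauge_fn, gauge_monomial, mul_smul_comm]

theorem norm_gauge_le (θ : Fin d → ℝ) (a : TwistedAlg N T φ 0) : ‖gauge θ a‖ ≤ ‖a‖ :=
  norm_starAlgHom_le _ a

theorem gauge_add (θ η : Fin d → ℝ) (a : TwistedAlg N T φ 0) :
    gauge (θ + η) a = gauge θ (gauge η a) := by
  have : gauge (θ + η) = (gauge θ).comp (gauge η : TwistedAlg N T φ 0 →⋆ₐ[ℂ] _) := by
    refine hom_ext (fun f => by rw [StarAlgHom.comp_apply, gauge_fn, gauge_fn, gauge_fn]) fun j => ?_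
    rw [StarAlgHom.comp_apply, gauge_gen, gauge_gen, map_smul, gauge_gen, smul_smul,
      ← Complex.exp_add]
    congr 2
    simp; ring
  rw [this, StarAlgHom.comp_apply]

theorem gauge_zero (a : TwistedAlg N T φ 0) : gauge 0 a = a := by
  have : gauge 0 = StarAlgHom.id ℂ (TwistedAlg N T φ 0) :=
    hom_ext (fun f => by rw [gauge_fn]; rfl) fun j => by rw [gauge_gen]; simp
  rw [this]; rfl

/-! ### Fourier coefficients in the unconstrained algebra, and their completeness. -/

section Fourier

variable {T' : Fin d → C(X, X)} (hT : ∀ j, (T' j).comp (T j) = ContinuousMap.id X)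

include hT in
-- On `f u_x` the orbit is a character times a constant. The automorphisms are contractions
-- uniformly in `θ`, so continuity survives norm limits.
theorem continuous_gauge (a : TwistedAlg N T φ 0) : Continuous fun θ : Fin d → ℝ => gauge θ a := by
  let M : Submodule ℂ (TwistedAlg N T φ 0) :=
    { carrier := {a | Continuous fun θ : Fin d → ℝ => gauge θ a}
      add_mem' := fun {a b} ha hb => by
        simp only [Set.mem_ofPred_eq, map_add] at ha hb ⊢; exact ha.add hb
      zero_mem' := by simp only [Set.mem_ofPred_eq, map_zero]; exact continuous_const
      smul_mem' := fun c a ha => by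
        simp only [Set.mem_ofPred_eq, map_smul] at ha ⊢; exact ha.const_smul c }
  have hM : IsClosed (M : Set (TwistedAlg N T φ 0)) := by
    refine isClosed_of_closure_subset fun a ha => ?_
    refine continuous_of_uniform_approx_of_continuous fun V hV => ?_
    obtain ⟨ε, hε, hV⟩ := Metric.mem_uniformity_dist.1 hV
    obtain ⟨b, hb, hab⟩ := Metric.mem_closure_iff.1 ha ε hε
    refine ⟨fun θ => gauge θ b, hb, fun θ => hV ?_⟩
    rw [dist_eq_norm, ← map_sub]
    exact (norm_gauge_le θ _).trans_lt (by rwa [← dist_eq_norm])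
  have htop := submodule_eq_top hT M hM fun f x => by
    change Continuous fun θ : Fin d → ℝ => gauge θ (fn f * monomial x)
    simp only [gauge_fn_mul_monomial]
    exact (contDiff_character x).continuous.smul continuous_const
  exact (htop ▸ Submodule.mem_top : a ∈ M)

/-- The cube `[0, 2π]^d`, a fundamental domain of the torus. -/
def torusBox (d : ℕ) : Set (Fin d → ℝ) := Set.Icc (0 : Fin d → ℝ) fun _ => 2 * Real.pi

theorem fourierElt_eq (a : TwistedAlg N T φ 0) (x : Fin d → ℤ) :
    fourierElt a x = (((2 * Real.pi) ^ d : ℝ)⁻¹ •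
      ∫ θ in torusBox d, character (-x) θ • gauge θ a) * star (monomial x) := by
  have h : ∀ θ : Fin d → ℝ, character (-x) θ = Complex.exp (Complex.I * ∑ j, (x j * θ j : ℂ)) := by
    intro θ
    rw [character]
    congr 1
    simp
  simp only [fourierElt, h, torusBox]

include hT in
theorem integrableOn_gauge (a : TwistedAlg N T φ 0) (x : Fin d → ℤ) :
    IntegrableOn (fun θ => character x θ • gauge θ a) (torusBox d) :=
  (((contDiff_character x).continuous.smul (continuous_gauge hT a)).continuousOn).integrableOn_compact
    isCompact_Icc

theorem volume_torusBox : (volume (torusBox d)).toReal = (2 * Real.pi) ^ d := by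
  rw [torusBox, Real.volume_Icc_pi_toReal (fun _ => by simp; positivity)]
  simp

theorem norm_fourierElt_le (a : TwistedAlg N T φ 0) (x : Fin d → ℤ)
    [Nontrivial (TwistedAlg N T φ 0)] : ‖fourierElt a x‖ ≤ ‖a‖ := by
  rw [fourierElt_eq]
  refine (norm_mul_le _ _).trans ?_
  rw [norm_star]
  refine (mul_le_of_le_one_right (norm_nonneg _) (norm_monomial_le x)).trans ?_
  have hpos : (0 : ℝ) < (2 * Real.pi) ^ d := by positivity
  rw [norm_smul, norm_inv, Real.norm_of_nonneg hpos.le, inv_mul_le_iff₀ hpos, mul_comm,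
    ← volume_torusBox]
  refine norm_setIntegral_le_of_norm_le_const (isCompact_Icc.measure_lt_top) fun θ _ => ?_
  rw [norm_smul, norm_character, one_mul]
  exact norm_gauge_le θ a

include hT in
theorem fourierElt_add (a b : TwistedAlg N T φ 0) (x : Fin d → ℤ) :
    fourierElt (a + b) x = fourierElt a x + fourierElt b x := by
  simp only [fourierElt_eq, map_add, smul_add]
  rw [integral_add (integrableOn_gauge hT a _) (integrableOn_gauge hT b _), smul_add, add_mul]

theorem fourierElt_smul (c : ℂ) (a : TwistedAlg N T φ 0) (x : Fin d → ℤ) :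
    fourierElt (c • a) x = c • fourierElt a x := by
  simp only [fourierElt_eq, map_smul]
  simp only [smul_comm _ c]
  rw [integral_smul, smul_comm _ c, smul_mul_assoc]

theorem integral_character (x : Fin d → ℤ) :
    ∫ θ in torusBox d, character x θ = if x = 0 then (((2 * Real.pi) ^ d : ℝ) : ℂ) else 0 := by
  have h1 : ∀ n : ℤ, ∫ t in Set.Icc 0 (2 * Real.pi), Complex.exp (-Complex.I * (n * (t : ℂ))) =
      if n = 0 then ((2 * Real.pi : ℝ) : ℂ) else 0 := by
    intro n
    rw [integral_Icc_eq_integral_Ioc, ← intervalIntegral.integral_of_le (by positivity)]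
    split_ifs with hn
    · subst hn; simp
    · have hc : -Complex.I * (n : ℂ) ≠ 0 := by simp [hn]
      simp only [← mul_assoc]
      rw [integral_exp_mul_complex hc]
      have : Complex.exp (-Complex.I * n * ((2 * Real.pi : ℝ) : ℂ)) = 1 := by
        rw [Complex.exp_eq_one_iff]
        exact ⟨-n, by push_cast; ring⟩
      rw [this]; simp
  have h2 : ∀ θ : Fin d → ℝ, character x θ = ∏ j, Complex.exp (-Complex.I * (x j * (θ j : ℂ))) := by
    intro θ
    rw [character, Finset.mul_sum, Complex.exp_sum]
  have h3 : (volume : Measure (Fin d → ℝ)).restrict (torusBox d) =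
      Measure.pi fun _ => volume.restrict (Set.Icc 0 (2 * Real.pi)) := by
    rw [torusBox, ← Set.pi_univ_Icc, volume_pi, Measure.restrict_pi_pi]
    rfl
  simp only [h2]
  rw [h3, integral_fintype_prod_eq_prod (f := fun j (t : ℝ) =>
    Complex.exp (-Complex.I * (x j * (t : ℂ))))]
  simp only [h1]
  split_ifs with hx
  · subst hx; simp
  · obtain ⟨j, hj⟩ := Function.ne_iff.1 hx
    exact Finset.prod_eq_zero (Finset.mem_univ j) (by simpa using hj)

/-- Orthogonality of characters; with continuity and density, this determines the coefficient maps.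
-/
theorem fourierElt_fn_mul_monomial (f : MatFun N X) (x y : Fin d → ℤ) :
    fourierElt (fn f * monomial y : TwistedAlg N T φ 0) x = if y = x then fn f else 0 := by
  rw [fourierElt_eq]
  simp only [gauge_fn_mul_monomial, smul_smul, ← character_add]
  rw [integral_smul_const, integral_character]
  by_cases h : y = x
  · subst h
    rw [if_pos (by simp), if_pos rfl, Complex.coe_smul, smul_smul,
      inv_mul_cancel₀ (by positivity), one_smul, mul_assoc, monomial_mul_star, mul_one]
  · have h' : ¬ (-x + y = 0) := fun e => h (by rw [neg_add_eq_zero] at e; exact e.symm)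
    rw [if_neg h', if_neg h]; simp

/-- `a ↦ Φ_x(a)`, as a continuous linear map. -/
def fourierCLM (hT : ∀ j, (T' j).comp (T j) = ContinuousMap.id X)
    [Nontrivial (TwistedAlg N T φ 0)] (x : Fin d → ℤ) :
    TwistedAlg N T φ 0 →L[ℂ] TwistedAlg N T φ 0 :=
  LinearMap.mkContinuous
    { toFun := fun a => fourierElt a x
      map_add' := fun a b => fourierElt_add hT a b x
      map_smul' := fun c a => fourierElt_smul c a x } 1 fun a => by
    rw [one_mul]; exact norm_fourierElt_le a x

theorem fourierCLM_apply [Nontrivial (TwistedAlg N T φ 0)] (x : Fin d → ℤ)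
    (a : TwistedAlg N T φ 0) : fourierCLM hT x a = fourierElt a x := rfl

theorem norm_fn_eq (hinj : Function.Injective (fn : MatFun N X →⋆ₐ[ℂ] TwistedAlg N T φ 0))
    (f : MatFun N X) : ‖(fn f : TwistedAlg N T φ 0)‖ = ‖f‖ :=
  NonUnitalStarAlgHom.norm_map fn hinj f

include hT in
-- An injective ⋆-homomorphism is isometric, so the copy of `C_N(X)` is closed and it suffices to
-- look at the dense span of the `f u_x`.
theorem fourierElt_mem_range [Nontrivial (TwistedAlg N T φ 0)]
    (hinj : Function.Injective (fn : MatFun N X →⋆ₐ[ℂ] TwistedAlg N T φ 0))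
    (a : TwistedAlg N T φ 0) (x : Fin d → ℤ) :
    ∃ f : MatFun N X, fn f = fourierElt a x := by
  let R : Submodule ℂ (TwistedAlg N T φ 0) :=
    LinearMap.range ((fn : MatFun N X →⋆ₐ[ℂ] TwistedAlg N T φ 0) : MatFun N X →ₗ[ℂ] _)
  have hR : IsClosed (R : Set (TwistedAlg N T φ 0)) := by
    have hiso : Isometry (fn : MatFun N X →⋆ₐ[ℂ] TwistedAlg N T φ 0) :=
      AddMonoidHomClass.isometry_of_norm _ (norm_fn_eq hinj)
    exact hiso.isClosedEmbedding.isClosed_range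
  have htop := submodule_eq_top hT
    (R.comap (fourierCLM (φ := φ) (N := N) hT x).toLinearMap)
    (hR.preimage (fourierCLM hT x).continuous) fun f y => by
      change fourierElt (fn f * monomial y) x ∈ R
      rw [fourierElt_fn_mul_monomial]
      split_ifs
      · exact ⟨f, rfl⟩
      · exact R.zero_mem
  have ha := (Submodule.eq_top_iff'.1 htop) a
  obtain ⟨f, hf⟩ := ha
  exact ⟨f, hf⟩

include hT in
theorem fn_coeff [Nontrivial (TwistedAlg N T φ 0)]
    (hinj : Function.Injective (fn : MatFun N X →⋆ₐ[ℂ] TwistedAlg N T φ 0))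
    (a : TwistedAlg N T φ 0) (x : Fin d → ℤ) : fn (coeff a x) = fourierElt a x :=
  Function.invFun_eq (fourierElt_mem_range hT hinj a x)

include hT in
/-- An element all of whose Fourier coefficients vanish is zero. -/
theorem eq_zero_of_fourierElt (a : TwistedAlg N T φ 0) (h : ∀ x, fourierElt a x = 0) : a = 0 := by
  have hint : ∀ x, ∫ θ in torusBox d, character x θ • gauge θ a = 0 := by
    intro x
    have := h (-x)
    rw [fourierElt_eq, neg_neg] at this
    have h2 := congrArg (· * monomial (-x)) this
    simp only [mul_assoc, star_monomial_mul, mul_one, zero_mul] at h2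
    exact (smul_eq_zero.1 h2).resolve_left (by positivity)
  set Φ : Submodule ℂ ((Fin d → ℝ) → ℂ) := Submodule.span ℂ (Set.range character)
  have hΦ : ∀ p ∈ Φ, Continuous p ∧ ∫ θ in torusBox d, p θ • gauge θ a = 0 := by
    intro p hp
    induction hp using Submodule.span_induction with
    | mem p hp =>
      obtain ⟨x, rfl⟩ := hp
      exact ⟨(contDiff_character x).continuous, hint x⟩
    | zero => exact ⟨continuous_const, by simp⟩
    | add p q _ _ hp hq =>
      refine ⟨hp.1.add hq.1, ?_⟩
      have hi : ∀ r : (Fin d → ℝ) → ℂ, Continuous r →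
          IntegrableOn (fun θ => r θ • gauge θ a) (torusBox d) := fun r hr =>
        (hr.smul (continuous_gauge hT a)).continuousOn.integrableOn_compact isCompact_Icc
      simp only [Pi.add_apply, add_smul]
      rw [integral_add (hi p hp.1) (hi q hq.1), hp.2, hq.2, add_zero]
    | smul c p _ hp =>
      refine ⟨hp.1.const_smul c, ?_⟩
      simp only [Pi.smul_apply, smul_assoc]
      rw [integral_smul, hp.2, smul_zero]
  have hmul : ∀ p ∈ Φ, ∀ q ∈ Φ, p * q ∈ Φ := by
    intro p hp q hq
    have := Submodule.mul_mem_mul hp hq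
    rw [Submodule.span_mul_span] at this
    refine Submodule.span_mono ?_ this
    rintro _ ⟨_, ⟨x, rfl⟩, _, ⟨y, rfl⟩, rfl⟩
    exact ⟨x + y, by funext θ; exact character_add x y θ⟩
  have hone : (1 : (Fin d → ℝ) → ℂ) ∈ Φ :=
    Submodule.subset_span ⟨0, by funext θ; exact character_zero θ⟩
  -- Trigonometric polynomials form an algebra and integrate to zero against the orbit. This
  -- includes all powers of `c`, a kernel whose unique maximum on the box is `(π, …, π)`, an
  -- interior point, unlike the peaks of `1 + cos`.
  set c : (Fin d → ℝ) → ℝ := fun θ => ∏ j, (1 - Real.cos (θ j))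
  have hfac : ∀ j : Fin d, (fun θ : Fin d → ℝ => (1 - Real.cos (θ j) : ℂ)) ∈ Φ := by
    intro j
    have : (fun θ : Fin d → ℝ => (1 - Real.cos (θ j) : ℂ)) = 1 -
        (1 / 2 : ℂ) • (character (Pi.single j 1) + character (Pi.single j (-1))) := by
      funext θ
      have hs : ∀ n : ℤ, character (Pi.single j n) θ = Complex.exp (-Complex.I * (n * θ j)) := by
        intro n
        rw [character, Finset.sum_eq_single j]
        · simp
        · intro i _ hi; simp [Pi.single_eq_of_ne hi]
        · simp
      simp only [Pi.sub_apply, Pi.one_apply, Pi.smul_apply, Pi.add_apply, hs, smul_eq_mul]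
      rw [Complex.ofReal_cos, Complex.cos]
      push_cast
      ring_nf
    rw [this]
    exact Φ.sub_mem hone (Φ.smul_mem _ (Φ.add_mem (Submodule.subset_span ⟨_, rfl⟩)
      (Submodule.subset_span ⟨_, rfl⟩)))
  have hprod : ∀ s : Finset (Fin d),
      (fun θ : Fin d → ℝ => ∏ j ∈ s, (1 - Real.cos (θ j) : ℂ)) ∈ Φ := by
    intro s
    induction s using Finset.induction_on with
    | empty => simp only [Finset.prod_empty]; exact hone
    | insert j s hj ih =>
      simp only [Finset.prod_insert hj]
      exact hmul _ (hfac j) _ ih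
  have hcpow : ∀ n : ℕ, (fun θ => ((c θ ^ n : ℝ) : ℂ)) ∈ Φ := by
    intro n
    induction n with
    | zero => simp only [pow_zero, Complex.ofReal_one]; exact hone
    | succ n ih =>
      have h1 := hmul _ ih _ (hprod Finset.univ)
      refine (congrArg (· ∈ Φ) ?_).mp h1
      funext θ
      simp [c, pow_succ]
  have hzero : ∀ n : ℕ, ∫ θ in torusBox d, c θ ^ n • gauge θ a = 0 := by
    intro n
    have := (hΦ _ (hcpow n)).2
    simpa only [Complex.coe_smul] using this
  have hcos : ∀ t : ℝ, 0 ≤ 1 - Real.cos t := fun t => by linarith [Real.cos_le_one t]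
  have hcos2 : ∀ t : ℝ, 1 - Real.cos t ≤ 2 := fun t => by linarith [Real.neg_one_le_cos t]
  have hcpi : c (fun _ => Real.pi) = 2 ^ d := by simp [c]; norm_num
  -- The normalized powers of `c` concentrate at the peak, so the vanishing integrals converge to
  -- the orbit at `(π, …, π)`. That value is zero, and rotating back gives `a = 0`.
  have hlim := tendsto_setIntegral_pow_smul_of_unique_maximum_of_isCompact_of_continuousOn
    (μ := volume) (s := torusBox d) (c := c) (x₀ := fun _ => Real.pi) (g := fun θ => gauge θ a)
    isCompact_Icc (by fun_prop) (fun θ hθ hne => by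
      obtain ⟨j, hj⟩ := Function.ne_iff.1 hne
      have hlt : 1 - Real.cos (θ j) < 2 := by
        refine lt_of_le_of_ne (hcos2 _) fun e => hj ?_
        have h1 : Real.cos (θ j) = -1 := by linarith
        obtain ⟨k, hk⟩ := Real.cos_eq_neg_one_iff.1 h1
        have h0 := hθ.1 j
        have h2 := hθ.2 j
        simp only [Pi.zero_apply] at h0
        have hpi := Real.pi_pos
        have hk1 : (k : ℝ) < 1 := by nlinarith
        have hk0 : (-1 : ℝ) < k := by nlinarith
        have hk' : k = 0 := by
          have a1 : k < 1 := by exact_mod_cast hk1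
          have a2 : -1 < k := by exact_mod_cast hk0
          omega
        rw [← hk, hk']; simp
      rw [hcpi]
      calc c θ = (1 - Real.cos (θ j)) * ∏ i ∈ Finset.univ.erase j, (1 - Real.cos (θ i)) :=
            (Finset.mul_prod_erase _ _ (Finset.mem_univ j)).symm
        _ ≤ (1 - Real.cos (θ j)) * ∏ i ∈ Finset.univ.erase j, (2 : ℝ) := by
            refine mul_le_mul_of_nonneg_left ?_ (hcos _)
            exact Finset.prod_le_prod (fun i _ => hcos _) fun i _ => hcos2 _
        _ < 2 * ∏ i ∈ Finset.univ.erase j, (2 : ℝ) :=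
            mul_lt_mul_of_pos_right hlt (by positivity)
        _ = 2 ^ d := by
            rw [Finset.mul_prod_erase Finset.univ (fun _ => (2 : ℝ)) (Finset.mem_univ j)]; simp)
    (fun θ _ => Finset.prod_nonneg fun j _ => hcos _) (by rw [hcpi]; positivity)
    (by
      refine subset_closure ?_
      rw [torusBox, ← Set.pi_univ_Icc, interior_pi_set Set.finite_univ]
      intro j _
      change Real.pi ∈ interior (Set.Icc (0 : ℝ) (2 * Real.pi))
      rw [interior_Icc]
      exact ⟨Real.pi_pos, by linarith [Real.pi_pos]⟩)
    (continuous_gauge hT a).continuousOn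
  simp only [hzero, smul_zero] at hlim
  have hpi := tendsto_nhds_unique hlim tendsto_const_nhds
  have := gauge_add (-fun _ => Real.pi) (fun _ => Real.pi) a
  rw [neg_add_cancel, gauge_zero, hpi, map_zero] at this
  exact this

end Fourier

end TwistedAlg

namespace TwistedAlg

/-! ### Smooth elements and decay of Fourier coefficients -/

theorem iteratedDeriv_cexp_neg_I (k : ℕ) :
    iteratedDeriv k (fun t : ℝ => Complex.exp (-Complex.I * t)) =
      fun t : ℝ => (-Complex.I) ^ k * Complex.exp (-Complex.I * t) := by
  induction k with
  | zero => funext t; simp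
  | succ k ih =>
    rw [iteratedDeriv_succ, ih]
    funext t
    have h : HasDerivAt (fun t : ℝ => Complex.exp (-Complex.I * t))
        (Complex.exp (-Complex.I * t) * (-Complex.I * 1)) t :=
      (Complex.ofRealCLM.hasDerivAt.const_mul (-Complex.I)).cexp
    rw [(h.const_mul _).deriv, pow_succ]
    ring

/-- The character is `exp(-i·)` composed with a linear functional of norm at most `d ‖x‖` for the
supremum norm. -/
theorem norm_iteratedFDeriv_character_le {d : ℕ} (k : ℕ) (x : Fin d → ℤ) (θ : Fin d → ℝ) :
    ‖iteratedFDeriv ℝ k (character x) θ‖ ≤ (d * ‖x‖) ^ k := by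
  set ℓ : (Fin d → ℝ) →L[ℝ] ℝ := ∑ j, (x j : ℝ) • ContinuousLinearMap.proj j
  have hℓ : ∀ θ, ℓ θ = ∑ j, (x j : ℝ) * θ j := fun θ => by simp [ℓ]
  have hnorm : ‖ℓ‖ ≤ d * ‖x‖ := by
    refine ℓ.opNorm_le_bound (by positivity) fun θ => ?_
    rw [hℓ]
    calc ‖∑ j, (x j : ℝ) * θ j‖ ≤ ∑ _j : Fin d, ‖x‖ * ‖θ‖ := by
          refine norm_sum_le_of_le _ fun j _ => ?_
          rw [norm_mul]
          refine mul_le_mul ?_ (norm_le_pi_norm θ j) (norm_nonneg _) (norm_nonneg _)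
          rw [Int.norm_cast_real]
          exact norm_le_pi_norm x j
      _ = d * ‖x‖ * ‖θ‖ := by simp [mul_assoc]
  have hcomp : character x = (fun t : ℝ => Complex.exp (-Complex.I * t)) ∘ ℓ := by
    funext θ
    simp only [character, Function.comp, hℓ]
    push_cast
    rfl
  have hcd : ContDiff ℝ k fun t : ℝ => Complex.exp (-Complex.I * t) :=
    (contDiff_const.mul Complex.ofRealCLM.contDiff).cexp
  rw [hcomp, ContinuousLinearMap.iteratedFDeriv_comp_right ℓ hcd θ le_rfl]
  refine (ContinuousMultilinearMap.norm_compContinuousLinearMap_le _ _).trans ?_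
  rw [norm_iteratedFDeriv_eq_norm_iteratedDeriv, iteratedDeriv_cexp_neg_I, Finset.prod_const,
    Finset.card_univ, Fintype.card_fin]
  have h1 : ‖(-Complex.I) ^ k * Complex.exp (-Complex.I * (ℓ θ : ℂ))‖ = 1 := by
    rw [norm_mul, norm_pow, norm_neg, Complex.norm_I, one_pow, one_mul,
      show -Complex.I * (ℓ θ : ℂ) = ((-ℓ θ : ℝ) : ℂ) * Complex.I by push_cast; ring,
      Complex.norm_exp_ofReal_mul_I]
  rw [h1, one_mul]
  exact pow_le_pow_left₀ (norm_nonneg _) hnorm k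

/-! ### Smooth orbits of an action of `ℝ^d` and their derivations. -/

section Orbits

variable {d : ℕ} {𝔸 : Type*} [CStarAlgebra 𝔸] {g : (Fin d → ℝ) → 𝔸 →⋆ₐ[ℂ] 𝔸}

/-- The orbit of `a` is smooth, with derivatives bounded by `M`. -/
def OrbitBound (g : (Fin d → ℝ) → 𝔸 →⋆ₐ[ℂ] 𝔸) (M : ℕ → ℝ) (a : 𝔸) : Prop :=
  ContDiff ℝ (⊤ : ℕ∞) (fun θ : Fin d → ℝ => g θ a) ∧
    ∀ k θ, ‖iteratedFDeriv ℝ k (fun θ : Fin d → ℝ => g θ a) θ‖ ≤ M k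

theorem OrbitBound.norm_le {M : ℕ → ℝ} {a : 𝔸} (h : OrbitBound g M a) (h0 : ∀ a, g 0 a = a) :
    ‖a‖ ≤ M 0 := by
  have := h.2 0 0
  rwa [norm_iteratedFDeriv_zero, h0] at this

theorem OrbitBound.mono {M M' : ℕ → ℝ} {a : 𝔸} (h : OrbitBound g M a)
    (hM : ∀ k, M k ≤ M' k) : OrbitBound g M' a :=
  ⟨h.1, fun k θ => (h.2 k θ).trans (hM k)⟩

/-- The bound for products obtained from Leibniz' rule. -/
def leibnizBound (M M' : ℕ → ℝ) (k : ℕ) : ℝ :=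
  ∑ i ∈ Finset.range (k + 1), (k.choose i : ℝ) * M i * M' (k - i)

theorem OrbitBound.mul {M M' : ℕ → ℝ} {a b : 𝔸} (ha : OrbitBound g M a)
    (hb : OrbitBound g M' b) : OrbitBound g (leibnizBound M M') (a * b) := by
  have h : (fun θ : Fin d → ℝ => g θ (a * b)) = fun θ => g θ a * g θ b := by
    funext θ; exact map_mul _ _ _
  rw [OrbitBound, h]
  refine ⟨ha.1.mul hb.1, fun k θ => ?_⟩
  refine (norm_iteratedFDeriv_mul_le ha.1 hb.1 θ (by exact_mod_cast le_top)).trans ?_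
  refine Finset.sum_le_sum fun i _ => ?_
  have h0 : 0 ≤ M i := (norm_nonneg _).trans (ha.2 i θ)
  exact mul_le_mul (mul_le_mul_of_nonneg_left (ha.2 i θ) (by positivity)) (hb.2 _ θ)
    (norm_nonneg _) (by positivity)

theorem orbitBound_one [Nontrivial 𝔸] : OrbitBound g (fun _ => 1) (1 : 𝔸) := by
  have h : (fun θ : Fin d → ℝ => g θ (1 : 𝔸)) = fun _ => 1 := by
    funext θ; exact map_one _
  rw [OrbitBound, h]
  refine ⟨contDiff_const, fun k θ => ?_⟩
  rcases Nat.eq_zero_or_pos k with rfl | hk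
  · rw [norm_iteratedFDeriv_zero, norm_one]
  · rw [iteratedFDeriv_const_of_ne hk.ne']; simp

theorem orbitBound_prod [Nontrivial 𝔸] {n : ℕ} {M : Fin n → ℕ → ℝ} {a : Fin n → 𝔸}
    (h : ∀ i, OrbitBound g (M i) (a i)) :
    OrbitBound g ((List.ofFn M).foldr leibnizBound fun _ => 1) (List.ofFn a).prod := by
  induction n with
  | zero => simpa using orbitBound_one
  | succ n ih =>
    rw [List.ofFn_succ, List.ofFn_succ, List.prod_cons, List.foldr_cons]
    exact (h 0).mul (ih fun i => h i.succ)

/-- A ⋆-homomorphism, as a continuous real-linear map. -/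
def realCLM (f : 𝔸 →⋆ₐ[ℂ] 𝔸) : 𝔸 →L[ℝ] 𝔸 :=
  ((⟨(f : 𝔸 →ₐ[ℂ] 𝔸).toLinearMap, continuous_starAlgHom f⟩ : 𝔸 →L[ℂ] 𝔸)).restrictScalars ℝ

theorem realCLM_apply (f : 𝔸 →⋆ₐ[ℂ] 𝔸) (a : 𝔸) : realCLM f a = f a := rfl

/-- The derivative of the orbit of `a` in the `j`-th direction. -/
def orbitDeriv (g : (Fin d → ℝ) → 𝔸 →⋆ₐ[ℂ] 𝔸) (j : Fin d) (a : 𝔸) : 𝔸 :=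
  _root_.deriv (fun t : ℝ => g (Pi.single j t) a) 0

theorem hasDerivAt_orbit {a : 𝔸} (ha : ContDiff ℝ (⊤ : ℕ∞) fun θ : Fin d → ℝ => g θ a)
    (j : Fin d) : HasDerivAt (fun t : ℝ => g (Pi.single j t) a) (orbitDeriv g j a) 0 := by
  have h : DifferentiableAt ℝ (fun t : ℝ => g (Pi.single j t) a) 0 := by
    have h1 : Differentiable ℝ fun θ : Fin d → ℝ => g θ a := ha.differentiable (by simp)
    exact (h1.comp (ContinuousLinearMap.single ℝ (fun _ : Fin d => ℝ) j).differentiable) 0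
  exact h.hasDerivAt

/-- The group law transports the derivative of the orbit at `0` to the point `θ`. -/
theorem map_orbitDeriv (hadd : ∀ θ η a, g (θ + η) a = g θ (g η a)) {a : 𝔸}
    (ha : ContDiff ℝ (⊤ : ℕ∞) fun θ : Fin d → ℝ => g θ a) (j : Fin d) (θ : Fin d → ℝ) :
    g θ (orbitDeriv g j a) = fderiv ℝ (fun θ : Fin d → ℝ => g θ a) θ (Pi.single j 1) := by
  have h1 : Differentiable ℝ fun θ : Fin d → ℝ => g θ a := ha.differentiable (by simp)
  have h2 : HasDerivAt (fun t : ℝ => g (θ + Pi.single j t) a) (g θ (orbitDeriv g j a)) 0 := by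
    have := (realCLM (g θ)).hasFDerivAt.comp_hasDerivAt (0 : ℝ) (hasDerivAt_orbit ha j)
    refine this.congr_of_eventuallyEq (Filter.Eventually.of_forall fun t => ?_)
    exact hadd θ _ a
  have h3 : HasDerivAt (fun t : ℝ => θ + Pi.single j t : ℝ → Fin d → ℝ) (Pi.single j 1) 0 :=
    ((ContinuousLinearMap.single ℝ (fun _ : Fin d => ℝ) j).hasDerivAt).const_add θ
  have h4 := (h1 (θ + Pi.single j 0)).hasFDerivAt.comp_hasDerivAt (0 : ℝ) h3
  rw [Pi.single_zero, add_zero] at h4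
  exact h2.unique h4

/-- The orbit of `∂_j a` is a directional derivative of the orbit of `a` along a vector of norm `1`,
which shifts the bounds by one order and costs no constant. -/
theorem OrbitBound.deriv (hadd : ∀ θ η a, g (θ + η) a = g θ (g η a)) {M : ℕ → ℝ} {a : 𝔸}
    (ha : OrbitBound g M a) (j : Fin d) : OrbitBound g (fun k => M (k + 1)) (orbitDeriv g j a) := by
  set L : ((Fin d → ℝ) →L[ℝ] 𝔸) →L[ℝ] 𝔸 :=
    ContinuousLinearMap.apply ℝ 𝔸 (Pi.single j 1 : Fin d → ℝ)
  have hL : ‖L‖ ≤ 1 := by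
    refine L.opNorm_le_bound zero_le_one fun f => ?_
    rw [one_mul]
    refine (f.le_opNorm _).trans ?_
    rw [Pi.norm_single, norm_one, mul_one]
  have h : (fun θ : Fin d → ℝ => g θ (orbitDeriv g j a)) =
      fun θ => L (fderiv ℝ (fun θ : Fin d → ℝ => g θ a) θ) := by
    funext θ; exact map_orbitDeriv hadd ha.1 j θ
  have hcd : ContDiff ℝ (⊤ : ℕ∞) (fderiv ℝ fun θ : Fin d → ℝ => g θ a) :=
    ha.1.fderiv_right (by simp)
  rw [OrbitBound, h]
  refine ⟨L.contDiff.comp hcd, fun k θ => ?_⟩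
  refine (L.norm_iteratedFDeriv_comp_left hcd.contDiffAt (by exact_mod_cast le_top)).trans ?_
  refine (mul_le_of_le_one_left (norm_nonneg _) hL).trans ?_
  rw [norm_iteratedFDeriv_fderiv]
  exact ha.2 _ _

theorem OrbitBound.deriv_iterate (hadd : ∀ θ η a, g (θ + η) a = g θ (g η a)) {M : ℕ → ℝ} {a : 𝔸}
    (ha : OrbitBound g M a) (j : Fin d) (n : ℕ) :
    OrbitBound g (fun k => M (k + n)) ((orbitDeriv g j)^[n] a) := by
  induction n with
  | zero => exact ha
  | succ n ih =>
    rw [Function.iterate_succ_apply']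
    exact (ih.deriv hadd j).mono fun k => by rw [add_right_comm, add_assoc]

theorem OrbitBound.foldr_deriv (hadd : ∀ θ η a, g (θ + η) a = g θ (g η a)) {M : ℕ → ℝ} {a : 𝔸}
    (ha : OrbitBound g M a) (α : Fin d → ℕ) (l : List (Fin d)) :
    OrbitBound g (fun k => M (k + (l.map α).sum))
      (l.foldr (fun j b => (orbitDeriv g j)^[α j] b) a) := by
  induction l with
  | nil => simpa using ha
  | cons j l ih =>
    rw [List.foldr_cons]
    refine (ih.deriv_iterate hadd j (α j)).mono fun k => le_of_eq ?_
    rw [List.map_cons, List.sum_cons, add_assoc]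

/-- A map which intertwines the action with a character intertwines the derivation with the
multiplication by `-i x_j`. -/
theorem intertwine_orbitDeriv {x : Fin d → ℤ} (Φ : 𝔸 →L[ℂ] 𝔸)
    (hΦ : ∀ θ a, Φ (g θ a) = character x θ • Φ a) {a : 𝔸}
    (ha : ContDiff ℝ (⊤ : ℕ∞) fun θ : Fin d → ℝ => g θ a) (j : Fin d) :
    Φ (orbitDeriv g j a) = (-Complex.I * (x j : ℂ)) • Φ a := by
  have h1 : HasDerivAt (fun t : ℝ => Φ (g (Pi.single j t) a)) (Φ (orbitDeriv g j a)) 0 :=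
    (Φ.restrictScalars ℝ).hasFDerivAt.comp_hasDerivAt (0 : ℝ) (hasDerivAt_orbit ha j)
  have h2 : (fun t : ℝ => Φ (g (Pi.single j t) a)) =
      fun t : ℝ => Complex.exp (-Complex.I * (x j * (t : ℂ))) • Φ a := by
    funext t
    rw [hΦ, character, Finset.sum_eq_single j]
    · simp
    · intro i _ hi; simp [Pi.single_eq_of_ne hi]
    · simp
  have h3 : HasDerivAt (fun t : ℝ => Complex.exp (-Complex.I * (x j * (t : ℂ))))
      (Complex.exp (-Complex.I * (x j * ((0 : ℝ) : ℂ))) * (-Complex.I * (x j * 1))) 0 :=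
    ((Complex.ofRealCLM.hasDerivAt.const_mul _).const_mul (-Complex.I)).cexp
  rw [h2] at h1
  rw [h1.unique (h3.smul_const _)]
  simp

/-- Orbits of rapidly convergent sums of eigenvectors are smooth. -/
theorem orbitBound_of_hasSum {v : (Fin d → ℤ) → 𝔸} (hv : ∀ θ x, g θ (v x) = character x θ • v x)
    {a : 𝔸} (ha : HasSum v a) {D : ℕ → (Fin d → ℤ) → ℝ} (hD : ∀ k, Summable (D k))
    (hvD : ∀ k x, (d * ‖x‖) ^ k * ‖v x‖ ≤ D k x) :
    OrbitBound g (fun k => ∑' x, D k x) a := by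
  have h : (fun θ : Fin d → ℝ => g θ a) = fun θ => ∑' x, character x θ • v x := by
    funext θ
    have := (realCLM (g θ)).hasSum ha
    simp only [realCLM_apply, hv] at this
    exact this.tsum_eq.symm
  have hcd : ∀ x, ContDiff ℝ (⊤ : ℕ∞) fun θ => character x θ • v x :=
    fun x => (contDiff_character x).smul contDiff_const
  have hb : ∀ (k : ℕ) (x : Fin d → ℤ) (θ : Fin d → ℝ),
      ‖iteratedFDeriv ℝ k (fun θ => character x θ • v x) θ‖ ≤ D k x := by
    intro k x θ
    set L : ℂ →L[ℝ] 𝔸 := (ContinuousLinearMap.toSpanSingleton ℂ (v x)).restrictScalars ℝ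
    have hL : ‖L‖ ≤ ‖v x‖ :=
      L.opNorm_le_bound (norm_nonneg _) fun c => by
        change ‖c • v x‖ ≤ _
        rw [norm_smul, mul_comm]
    refine (L.norm_iteratedFDeriv_comp_left (contDiff_character x).contDiffAt
      (by exact_mod_cast le_top)).trans ?_
    refine le_trans ?_ (hvD k x)
    rw [mul_comm]
    exact mul_le_mul (norm_iteratedFDeriv_character_le k x θ) hL (norm_nonneg _) (by positivity)
  rw [OrbitBound, h]
  refine ⟨contDiff_tsum hcd (fun k _ => hD k) fun k x θ _ => hb k x θ, fun k θ => ?_⟩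
  rw [iteratedFDeriv_tsum_apply hcd (fun k _ => hD k) (fun k x θ _ => hb k x θ)
    (by exact_mod_cast le_top)]
  exact tsum_of_norm_bounded (hD k).hasSum fun x => hb k x θ

end Orbits

variable {N : ℕ} {d : ℕ} {X : Type u} [TopologicalSpace X] [CompactSpace X]
  {T : Fin d → C(X, X)} {φ : Matrix (Fin d) (Fin d) ℝ}

/-- `a` is smooth, and the derivatives of its orbit are bounded by `M`. -/
def HasSmoothBound (M : ℕ → ℝ) (a : TwistedAlg N T φ 0) : Prop := OrbitBound gauge M a

theorem HasSmoothBound.isSmooth {M : ℕ → ℝ} {a : TwistedAlg N T φ 0} (h : HasSmoothBound M a) :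
    a.IsSmooth := h.1

theorem HasSmoothBound.norm_le {M : ℕ → ℝ} {a : TwistedAlg N T φ 0} (h : HasSmoothBound M a) :
    ‖a‖ ≤ M 0 := OrbitBound.norm_le h gauge_zero

theorem HasSmoothBound.deriv_iterate {M : ℕ → ℝ} {a : TwistedAlg N T φ 0}
    (ha : HasSmoothBound M a) (j : Fin d) (n : ℕ) :
    HasSmoothBound (fun k => M (k + n)) ((TwistedAlg.deriv j)^[n] a) :=
  OrbitBound.deriv_iterate gauge_add ha j n

theorem HasSmoothBound.foldr_deriv {M : ℕ → ℝ} {a : TwistedAlg N T φ 0} (ha : HasSmoothBound M a)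
    (α : Fin d → ℕ) (l : List (Fin d)) :
    HasSmoothBound (fun k => M (k + (l.map α).sum))
      (l.foldr (fun j b => (TwistedAlg.deriv j)^[α j] b) a) :=
  OrbitBound.foldr_deriv gauge_add ha α l

/-- The order of a multi-index. -/
def order (α : Fin d → ℕ) : ℕ := ((List.finRange d).map α).sum

theorem HasSmoothBound.multiDeriv {M : ℕ → ℝ} {a : TwistedAlg N T φ 0} (ha : HasSmoothBound M a)
    (α : Fin d → ℕ) :
    HasSmoothBound (fun k => M (k + order α)) (multiDeriv TwistedAlg.deriv α a) :=
  ha.foldr_deriv α _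

theorem norm_fn_mul_monomial_le (f : MatFun N X) (x : Fin d → ℤ) {m : ℕ}
    [Nontrivial (TwistedAlg N T φ m)] : ‖(fn f * monomial x : TwistedAlg N T φ m)‖ ≤ ‖f‖ :=
  (norm_mul_le _ _).trans ((mul_le_of_le_one_right (norm_nonneg _) (norm_monomial_le x)).trans
    (norm_starAlgHom_le fn f))

/-! ### Decay of coefficients of smooth elements, and convergence of Fourier series. -/

section Coefficients

variable {T' : Fin d → C(X, X)} (hT : ∀ j, (T' j).comp (T j) = ContinuousMap.id X)
  [Nontrivial (TwistedAlg N T φ 0)]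
  (hinj : Function.Injective (fn : MatFun N X →⋆ₐ[ℂ] TwistedAlg N T φ 0))

include hT in
-- Both sides are continuous and linear in `a`, so the check reduces to `f u_y`, where the
-- coefficient vanishes unless `y = x`.
theorem fourierElt_gauge (θ : Fin d → ℝ) (a : TwistedAlg N T φ 0) (x : Fin d → ℤ) :
    fourierElt (gauge θ a) x = character x θ • fourierElt a x := by
  let M : Submodule ℂ (TwistedAlg N T φ 0) :=
    { carrier := {a | fourierElt (gauge θ a) x = character x θ • fourierElt a x}
      add_mem' := fun {a b} ha hb => by
        rw [Set.mem_ofPred_eq] at ha hb ⊢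
        rw [map_add, fourierElt_add hT, fourierElt_add hT, smul_add, ha, hb]
      zero_mem' := by
        have h := fourierElt_smul (0 : ℂ) (0 : TwistedAlg N T φ 0) x
        rw [zero_smul, zero_smul] at h
        rw [Set.mem_ofPred_eq, map_zero, h, smul_zero]
      smul_mem' := fun c a ha => by
        rw [Set.mem_ofPred_eq] at ha ⊢
        rw [map_smul, fourierElt_smul, fourierElt_smul, ha, smul_comm] }
  have hM : IsClosed (M : Set (TwistedAlg N T φ 0)) :=
    isClosed_eq ((fourierCLM hT x).continuous.comp (continuous_starAlgHom (gauge θ)))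
      ((fourierCLM hT x).continuous.const_smul (character x θ))
  have htop := submodule_eq_top hT M hM fun f y => by
    change fourierElt (gauge θ (fn f * monomial y)) x =
      character x θ • fourierElt (fn f * monomial y) x
    rw [gauge_fn_mul_monomial, fourierElt_smul, fourierElt_fn_mul_monomial]
    split_ifs with h
    · rw [h]
    · simp
  exact (htop ▸ Submodule.mem_top : a ∈ M)

include hT in
theorem fourierElt_deriv {a : TwistedAlg N T φ 0} (ha : a.IsSmooth) (j : Fin d) (x : Fin d → ℤ) :
    fourierElt (a.deriv j) x = (-Complex.I * (x j : ℂ)) • fourierElt a x :=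
  intertwine_orbitDeriv (fourierCLM hT x) (fun θ a => fourierElt_gauge hT θ a x) ha j

include hT hinj in
theorem coeff_deriv {a : TwistedAlg N T φ 0} (ha : a.IsSmooth) (j : Fin d) (x : Fin d → ℤ) :
    coeff (a.deriv j) x = (-Complex.I * (x j : ℂ)) • coeff a x := by
  apply hinj
  rw [map_smul, fn_coeff hT hinj, fn_coeff hT hinj, fourierElt_deriv hT ha]

include hT hinj in
theorem coeff_deriv_iterate {M : ℕ → ℝ} {a : TwistedAlg N T φ 0} (ha : HasSmoothBound M a)
    (j : Fin d) (n : ℕ) (x : Fin d → ℤ) :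
    coeff ((TwistedAlg.deriv j)^[n] a) x = (-Complex.I * (x j : ℂ)) ^ n • coeff a x := by
  induction n with
  | zero => simp
  | succ n ih =>
    rw [Function.iterate_succ_apply', coeff_deriv hT hinj (ha.deriv_iterate j n).1, ih, smul_smul,
      pow_succ']

/-- The factor by which `∂^α` multiplies the coefficient at `x`. -/
def derivWeight (α : Fin d → ℕ) (x : Fin d → ℤ) : ℂ :=
  ((List.finRange d).map fun j => (-Complex.I * (x j : ℂ)) ^ α j).prod

include hT hinj in
theorem coeff_multiDeriv {M : ℕ → ℝ} {a : TwistedAlg N T φ 0} (ha : HasSmoothBound M a)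
    (α : Fin d → ℕ) (x : Fin d → ℤ) :
    coeff (multiDeriv TwistedAlg.deriv α a) x = derivWeight α x • coeff a x := by
  have : ∀ l : List (Fin d), coeff (l.foldr (fun j b => (TwistedAlg.deriv j)^[α j] b) a) x =
      (l.map fun j => (-Complex.I * (x j : ℂ)) ^ α j).prod • coeff a x := by
    intro l
    induction l with
    | nil => simp
    | cons j l ih =>
      rw [List.foldr_cons, coeff_deriv_iterate hT hinj (ha.foldr_deriv α l), ih, List.map_cons,
        List.prod_cons, smul_smul]
  exact this _

include hT hinj in
theorem norm_coeff_le (a : TwistedAlg N T φ 0) (x : Fin d → ℤ) : ‖coeff a x‖ ≤ ‖a‖ := by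
  rw [← norm_fn_eq hinj (coeff a x), fn_coeff hT hinj]
  exact norm_fourierElt_le a x

include hT hinj in
-- Up to a phase, `x_j^k a_x` is the coefficient of `∂_j^k a` at `x`, hence bounded by the norm of
-- that element; `j` is taken to be a coordinate of largest modulus.
theorem HasSmoothBound.norm_pow_mul_coeff_le {M : ℕ → ℝ} {a : TwistedAlg N T φ 0}
    (ha : HasSmoothBound M a) (k : ℕ) (x : Fin d → ℤ) : ‖x‖ ^ k * ‖coeff a x‖ ≤ M k := by
  have hj : ∀ j, ‖x j‖ ^ k * ‖coeff a x‖ ≤ M k := by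
    intro j
    have h1 := (norm_coeff_le hT hinj _ x).trans (ha.deriv_iterate j k).norm_le
    rwa [coeff_deriv_iterate hT hinj ha, norm_smul, norm_pow, norm_mul, norm_neg, Complex.norm_I,
      one_mul, Complex.norm_intCast, ← Int.norm_eq_abs, zero_add] at h1
  -- For `d = 0` there is no largest coordinate, and `‖x‖ ^ k` is `1` or `0` according to whether
  -- `k` vanishes.
  rcases isEmpty_or_nonempty (Fin d) with he | he
  · have hx : ‖x‖ = 0 := by rw [Subsingleton.elim x 0, norm_zero]
    rcases Nat.eq_zero_or_pos k with rfl | hk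
    · rw [pow_zero, one_mul]; exact (norm_coeff_le hT hinj a x).trans ha.norm_le
    · rw [hx, zero_pow hk.ne', zero_mul]; exact (norm_nonneg _).trans (ha.2 k 0)
  · obtain ⟨j, -, hjx⟩ := Finset.exists_max_image Finset.univ (fun j => ‖x j‖) Finset.univ_nonempty
    have : ‖x‖ = ‖x j‖ := le_antisymm
      ((pi_norm_le_iff_of_nonneg (norm_nonneg _)).2 fun i => hjx i (Finset.mem_univ i))
      (norm_le_pi_norm x j)
    rw [this]
    exact hj j

/-- The decay of the coefficients of elements with smooth bounds `M`. -/
def decayBound (M : ℕ → ℝ) (k : ℕ) : ℝ := 2 ^ k * (M 0 + M k)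

include hT hinj in
theorem HasSmoothBound.coeff_decay {M : ℕ → ℝ} {a : TwistedAlg N T φ 0}
    (ha : HasSmoothBound M a) (k : ℕ) (x : Fin d → ℤ) :
    (1 + ‖x‖) ^ k * ‖coeff a x‖ ≤ decayBound M k := by
  have h0 := ha.norm_pow_mul_coeff_le hT hinj 0 x
  have hk := ha.norm_pow_mul_coeff_le hT hinj k x
  rw [pow_zero, one_mul] at h0
  have h2 : (1 + ‖x‖) ^ k ≤ 2 ^ k * (1 + ‖x‖ ^ k) := by
    rcases le_total ‖x‖ 1 with h | h
    · calc (1 + ‖x‖) ^ k ≤ 2 ^ k := pow_le_pow_left₀ (by positivity) (by linarith) k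
        _ ≤ _ := le_mul_of_one_le_right (by positivity) (by linarith [pow_nonneg (norm_nonneg x) k])
    · calc (1 + ‖x‖) ^ k ≤ (2 * ‖x‖) ^ k := pow_le_pow_left₀ (by positivity) (by linarith) k
        _ = 2 ^ k * ‖x‖ ^ k := mul_pow _ _ _
        _ ≤ _ := mul_le_mul_of_nonneg_left (by linarith) (by positivity)
  calc _ ≤ 2 ^ k * (1 + ‖x‖ ^ k) * ‖coeff a x‖ := mul_le_mul_of_nonneg_right h2 (norm_nonneg _)
    _ = 2 ^ k * (‖coeff a x‖ + ‖x‖ ^ k * ‖coeff a x‖) := by ring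
    _ ≤ _ := mul_le_mul_of_nonneg_left (add_le_add h0 hk) (by positivity)

include hT hinj in
/-- An element with summable Fourier coefficients is the sum of its Fourier series. -/
theorem hasSum_fourier {a : TwistedAlg N T φ 0} (ha : Summable fun x => ‖coeff a x‖) :
    HasSum (fun x => fn (coeff a x) * monomial x) a := by
  have hs : Summable fun x => (fn (coeff a x) * monomial x : TwistedAlg N T φ 0) :=
    Summable.of_norm_bounded ha fun x => norm_fn_mul_monomial_le _ x
  -- The difference has vanishing coefficients, so completeness applies.
  have key : a - ∑' x, (fn (coeff a x) * monomial x : TwistedAlg N T φ 0) = 0 := by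
    refine eq_zero_of_fourierElt hT _ fun y => ?_
    have h1 := (fourierCLM hT y).hasSum hs.hasSum
    simp only [fourierCLM_apply, fourierElt_fn_mul_monomial] at h1
    have h3 : HasSum (fun x => if x = y then (fn (coeff a x) : TwistedAlg N T φ 0) else 0)
        (fn (coeff a y)) := by
      have h := hasSum_ite_eq y (fn (coeff a y) : TwistedAlg N T φ 0)
      have he : (fun x => if x = y then (fn (coeff a x) : TwistedAlg N T φ 0) else 0) =
          fun x => if x = y then fn (coeff a y) else 0 := by
        funext x
        split_ifs with hx
        · rw [hx]
        · rfl
      rwa [he]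
    rw [← fourierCLM_apply hT, map_sub, fourierCLM_apply, fourierCLM_apply, h1.unique h3,
      fn_coeff hT hinj, sub_self]
  rw [sub_eq_zero] at key
  have h := hs.hasSum
  rwa [← key] at h

end Coefficients
end TwistedAlg

/-! ### Covariant representations by matrices over a finite group -/

section ShiftMatrices

variable {𝔅 : Type*} [CStarAlgebra 𝔅] [PartialOrder 𝔅] [StarOrderedRing 𝔅]
  {Γ : Type*} [AddCommGroup Γ] [Fintype Γ] [DecidableEq Γ]

/-- The matrix `δ_g ↦ z_g δ_{g+s}`. -/
def shiftMatrix (𝔅 : Type*) [CStarAlgebra 𝔅] (s : Γ) (z : Γ → ℂ) : CStarMatrix Γ Γ 𝔅 :=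
  CStarMatrix.ofMatrix (Matrix.of fun g' g => if g' = g + s then z g • 1 else 0)

theorem shiftMatrix_apply (s : Γ) (z : Γ → ℂ) (g' g : Γ) :
    shiftMatrix 𝔅 s z g' g = if g' = g + s then z g • 1 else 0 := rfl

theorem shiftMatrix_mul (s s' : Γ) (z z' : Γ → ℂ) :
    shiftMatrix 𝔅 s z * shiftMatrix 𝔅 s' z' =
      shiftMatrix 𝔅 (s + s') fun g => z' g * z (g + s') := by
  refine CStarMatrix.ext fun g' g => ?_
  rw [CStarMatrix.mul_apply, Finset.sum_eq_single (g + s')]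
  · simp only [shiftMatrix_apply, if_true]
    rw [show g + s' + s = g + (s + s') by abel]
    split_ifs
    · rw [smul_mul_smul_comm, one_mul, mul_comm]
    · rw [zero_mul]
  · intro k _ hk
    simp only [shiftMatrix_apply, if_neg hk, mul_zero]
  · simp

theorem star_shiftMatrix (s : Γ) (z : Γ → ℂ) :
    star (shiftMatrix 𝔅 s z) = shiftMatrix 𝔅 (-s) fun g => star (z (g - s)) := by
  refine CStarMatrix.ext fun g' g => ?_
  rw [CStarMatrix.star_apply, shiftMatrix_apply, shiftMatrix_apply]
  by_cases h : g = g' + s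
  · rw [if_pos h, if_pos (by rw [h]; abel), star_smul, star_one, h, add_sub_cancel_right]
  · rw [if_neg h, if_neg (fun e => h (by rw [e]; abel)), star_zero]

theorem shiftMatrix_zero_one : shiftMatrix 𝔅 (0 : Γ) (fun _ => 1) = 1 := by
  refine CStarMatrix.ext fun g' g => ?_
  rw [shiftMatrix_apply, CStarMatrix.one_apply, add_zero, one_smul]

theorem star_circle_mul_self (z : Circle) : star (z : ℂ) * z = 1 := by
  rw [Complex.star_def, ← Complex.normSq_eq_conj_mul_self, Circle.normSq_coe]; simp

/-- The unitary `δ_g ↦ z_g δ_{g+s}`. -/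
def shiftUnitary (𝔅 : Type*) [CStarAlgebra 𝔅] [PartialOrder 𝔅] [StarOrderedRing 𝔅]
    (s : Γ) (z : Γ → Circle) : unitary (CStarMatrix Γ Γ 𝔅) :=
  ⟨shiftMatrix 𝔅 s fun g => (z g : ℂ), by
    rw [Unitary.mem_iff, star_shiftMatrix, shiftMatrix_mul, shiftMatrix_mul,
      ← shiftMatrix_zero_one]
    constructor
    · rw [neg_add_cancel]
      congr 1
      funext g
      rw [add_sub_cancel_right, mul_comm, star_circle_mul_self]
    · rw [add_neg_cancel]
      congr 1
      funext g
      rw [← sub_eq_add_neg, star_circle_mul_self]⟩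

theorem coe_shiftUnitary (s : Γ) (z : Γ → Circle) :
    (shiftUnitary 𝔅 s z : CStarMatrix Γ Γ 𝔅) = shiftMatrix 𝔅 s fun g => (z g : ℂ) := rfl

theorem shiftUnitary_mul (s s' : Γ) (z z' : Γ → Circle) :
    shiftUnitary 𝔅 s z * shiftUnitary 𝔅 s' z' =
      shiftUnitary 𝔅 (s + s') fun g => z' g * z (g + s') :=
  Subtype.ext (by
    rw [Submonoid.coe_mul, coe_shiftUnitary, coe_shiftUnitary, shiftMatrix_mul, coe_shiftUnitary]
    simp)

theorem shiftUnitary_zero_one : shiftUnitary 𝔅 (0 : Γ) (fun _ => 1) = 1 :=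
  Subtype.ext (by rw [coe_shiftUnitary]; simpa using shiftMatrix_zero_one)

/-- When the phase is constant along the orbits of its own shift, powers act separately on the step
and on the phase. -/
theorem shiftUnitary_pow {s : Γ} {z : Γ → Circle} (hz : ∀ g, z (g + s) = z g) (k : ℕ) :
    shiftUnitary 𝔅 s z ^ k = shiftUnitary 𝔅 (k • s) fun g => z g ^ k := by
  induction k with
  | zero => simp only [pow_zero, zero_smul]; exact shiftUnitary_zero_one.symm
  | succ k ih =>
    rw [pow_succ, ih, shiftUnitary_mul, succ_nsmul]
    congr 1
    funext g
    rw [hz, pow_succ']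

/-- The pairs of a weighted shift and its step. -/
def shiftSubgroup (𝔅 : Type*) [CStarAlgebra 𝔅] [PartialOrder 𝔅] [StarOrderedRing 𝔅] (Γ : Type*)
    [AddCommGroup Γ] [Fintype Γ] [DecidableEq Γ] :
    Subgroup (unitary (CStarMatrix Γ Γ 𝔅) × Multiplicative Γ) where
  carrier := {p | ∃ z : Γ → Circle, p.1 = shiftUnitary 𝔅 p.2.toAdd z}
  mul_mem' := by
    rintro ⟨v, s⟩ ⟨v', s'⟩ ⟨z, hz⟩ ⟨z', hz'⟩
    exact ⟨_, (congrArg₂ (· * ·) hz hz').trans (shiftUnitary_mul _ _ _ _)⟩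
  one_mem' := ⟨fun _ => 1, shiftUnitary_zero_one.symm⟩
  inv_mem' := by
    rintro ⟨v, s⟩ ⟨z, hz⟩
    refine ⟨fun g => (z (g - s.toAdd))⁻¹, (congrArg (·⁻¹) hz).trans ?_⟩
    change (shiftUnitary 𝔅 s.toAdd z)⁻¹ = shiftUnitary 𝔅 (-s.toAdd) fun g => (z (g - s.toAdd))⁻¹
    rw [inv_eq_iff_mul_eq_one, shiftUnitary_mul, add_neg_cancel, ← shiftUnitary_zero_one]
    congr 1
    funext g
    rw [← sub_eq_add_neg, inv_mul_cancel]

/-- Pairs of a weighted shift and its step form a subgroup, so the product of the generators is a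
weighted shift by the total step; its phase is irrelevant. -/
theorem exists_ordProd_shiftUnitary {d : ℕ} (s : Fin d → Γ) (z : Fin d → Γ → Circle)
    (x : Fin d → ℤ) : ∃ z' : Γ → Circle,
      ordProd (fun j => shiftUnitary 𝔅 (s j) (z j)) x = shiftUnitary 𝔅 (∑ j, x j • s j) z' := by
  set p : Fin d → unitary (CStarMatrix Γ Γ 𝔅) × Multiplicative Γ :=
    fun j => (shiftUnitary 𝔅 (s j) (z j), Multiplicative.ofAdd (s j))
  have hmem : ordProd p x ∈ shiftSubgroup 𝔅 Γ := by
    refine Subgroup.list_prod_mem _ fun a ha => ?_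
    obtain ⟨j, rfl⟩ := List.mem_ofFn.1 ha
    have hp : p j ∈ shiftSubgroup 𝔅 Γ := ⟨z j, rfl⟩
    exact Subgroup.zpow_mem _ hp _
  obtain ⟨z', hz'⟩ := hmem
  refine ⟨z', ?_⟩
  have h1 : (ordProd p x).1 = ordProd (fun j => shiftUnitary 𝔅 (s j) (z j)) x :=
    map_ordProd (MonoidHom.fst _ _) p x
  have h2 : (ordProd p x).2.toAdd = ∑ j, x j • s j := by
    have : (ordProd p x).2 = ordProd (fun j => Multiplicative.ofAdd (s j)) x :=
      map_ordProd (MonoidHom.snd _ _) p x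
    rw [this, ordProd, List.prod_ofFn, toAdd_prod]
    rfl
  rw [← h1, hz', h2]

/-- The block diagonal representation attached to a family of ⋆-endomorphisms. -/
def diagonalHom (σ : Γ → 𝔅 →⋆ₐ[ℂ] 𝔅) : 𝔅 →⋆ₐ[ℂ] CStarMatrix Γ Γ 𝔅 where
  toFun f := CStarMatrix.ofMatrix (Matrix.diagonal fun g => σ g f)
  map_one' := CStarMatrix.ext fun g' g => by
    simp only [map_one]
    exact congrFun (congrFun Matrix.diagonal_one g') g
  map_mul' a b := by
    refine CStarMatrix.ext fun g' g => ?_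
    simp only [map_mul]
    exact congrFun (congrFun (Matrix.diagonal_mul_diagonal _ _).symm g') g
  map_zero' := CStarMatrix.ext fun g' g => by simp
  map_add' a b := CStarMatrix.ext fun g' g => by
    simp only [CStarMatrix.ofMatrix_apply, CStarMatrix.add_apply, Matrix.diagonal_apply, map_add]
    split_ifs <;> simp
  commutes' c := CStarMatrix.ext fun g' g => by
    rw [CStarMatrix.algebraMap_apply]
    simp only [CStarMatrix.ofMatrix_apply, Matrix.diagonal_apply, AlgHomClass.commutes]
  map_star' a := CStarMatrix.ext fun g' g => by
    simp only [CStarMatrix.star_apply, CStarMatrix.ofMatrix_apply, Matrix.diagonal_apply, map_star]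
    by_cases h : g' = g
    · rw [if_pos h, if_pos h.symm, h]
    · rw [if_neg h, if_neg (Ne.symm h), star_zero]

theorem diagonalHom_apply (σ : Γ → 𝔅 →⋆ₐ[ℂ] 𝔅) (f : 𝔅) (g' g : Γ) :
    diagonalHom σ f g' g = if g' = g then σ g' f else 0 := rfl

theorem diagonalHom_mul_shiftMatrix_apply (σ : Γ → 𝔅 →⋆ₐ[ℂ] 𝔅) (f : 𝔅) (s : Γ) (z : Γ → ℂ)
    (g' g : Γ) : (diagonalHom σ f * shiftMatrix 𝔅 s z) g' g =
      if g' = g + s then z g • σ g' f else 0 := by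
  rw [CStarMatrix.mul_apply, Finset.sum_eq_single g']
  · rw [diagonalHom_apply, shiftMatrix_apply, if_pos rfl]
    split_ifs
    · rw [mul_smul_comm, mul_one]
    · rw [mul_zero]
  · intro k _ hk
    rw [diagonalHom_apply, if_neg (Ne.symm hk), zero_mul]
  · simp

theorem shiftMatrix_mul_diagonalHom_apply (σ : Γ → 𝔅 →⋆ₐ[ℂ] 𝔅) (f : 𝔅) (s : Γ) (z : Γ → ℂ)
    (g' g : Γ) : (shiftMatrix 𝔅 s z * diagonalHom σ f) g' g =
      if g' = g + s then z g • σ g f else 0 := by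
  rw [CStarMatrix.mul_apply, Finset.sum_eq_single g]
  · rw [diagonalHom_apply, shiftMatrix_apply, if_pos rfl]
    split_ifs
    · rw [smul_mul_assoc, one_mul]
    · rw [zero_mul]
  · intro k _ hk
    rw [diagonalHom_apply, if_neg hk, mul_zero]
  · simp

end ShiftMatrices

/-! ### A faithful representation of the finite-volume algebra -/

section FiniteRep

variable {d N L : ℕ} {Ω₀ : Type u} [TopologicalSpace Ω₀] [CompactSpace Ω₀]
  {φ : Matrix (Fin d) (Fin d) ℝ}

theorem nontrivial_matFun (hN : 0 < N) (X : Type u) [TopologicalSpace X] [Nonempty X] :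
    Nontrivial (MatFun N X) := by
  have : Nonempty (Fin N) := ⟨⟨0, hN⟩⟩
  infer_instance

/-- The translation of configurations at finite volume. -/
def finTranslate (g : Fin d → ZMod (2 * L + 1)) : C(FinConfig d Ω₀ L, FinConfig d Ω₀ L) where
  toFun w x := w (x - g)
  continuous_toFun := continuous_pi fun _ => continuous_apply _

theorem finShift_comp_finTranslate (g : Fin d → ZMod (2 * L + 1)) (j : Fin d) :
    (finShift j).comp (finTranslate g) =
      (finTranslate (g + Pi.single j 1) : C(FinConfig d Ω₀ L, _)) := by
  refine ContinuousMap.ext fun w => funext fun x => ?_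
  change w (x - Pi.single j 1 - g) = w (x - (g + Pi.single j 1))
  congr 1; abel

theorem finTranslate_comp_neg (g : Fin d → ZMod (2 * L + 1)) :
    (finTranslate g).comp (finTranslate (-g)) = ContinuousMap.id (FinConfig d Ω₀ L) := by
  refine ContinuousMap.ext fun w => funext fun x => ?_
  change w (x - g - -g) = w x
  congr 1; abel

/-- The translations of functions of the configuration at finite volume. -/
def finTranslateHom (N : ℕ) (g : Fin d → ZMod (2 * L + 1)) :
    MatFun N (FinConfig d Ω₀ L) →⋆ₐ[ℂ] MatFun N (FinConfig d Ω₀ L) :=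
  ContinuousMap.compStarAlgHom' ℂ (Mat N) (finTranslate g)

theorem finTranslateHom_apply (g : Fin d → ZMod (2 * L + 1)) (f : MatFun N (FinConfig d Ω₀ L)) :
    finTranslateHom N g f = f.comp (finTranslate g) := rfl

theorem norm_finTranslateHom (g : Fin d → ZMod (2 * L + 1)) (f : MatFun N (FinConfig d Ω₀ L)) :
    ‖finTranslateHom N g f‖ = ‖f‖ := by
  refine le_antisymm (norm_starAlgHom_le _ f) ?_
  have h : finTranslateHom N (-g) (finTranslateHom N g f) = f := by
    rw [finTranslateHom_apply, finTranslateHom_apply, ContinuousMap.comp_assoc,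
      finTranslate_comp_neg, ContinuousMap.comp_id]
  calc ‖f‖ = ‖finTranslateHom N (-g) (finTranslateHom N g f)‖ := by rw [h]
    _ ≤ _ := norm_starAlgHom_le _ _

/-- The phases of the generators in the representation by weighted shifts. -/
def shiftPhase (n : Fin d → Fin d → ℤ) (j : Fin d) (g : Fin d → ZMod (2 * L + 1)) : Circle :=
  ZMod.toCircle (∑ k ∈ Finset.Iio j, (n j k : ZMod (2 * L + 1)) * g k)

/-- The phase of the `i`-th generator involves only the coordinates before `i`, as in a Landau
gauge. -/
theorem shiftPhase_add_single (n : Fin d → Fin d → ℤ) (i j : Fin d)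
    (g : Fin d → ZMod (2 * L + 1)) :
    shiftPhase n i (g + Pi.single j 1) =
      shiftPhase n i g * if j < i then ZMod.toCircle (n i j : ZMod (2 * L + 1)) else 1 := by
  have h : ∑ k ∈ Finset.Iio i, (n i k : ZMod (2 * L + 1)) *
        (g + Pi.single j 1 : Fin d → ZMod (2 * L + 1)) k =
      (∑ k ∈ Finset.Iio i, (n i k : ZMod (2 * L + 1)) * g k) +
        if j < i then (n i j : ZMod (2 * L + 1)) else 0 := by
    simp [mul_add, Finset.sum_add_distrib, Pi.single_apply]
  rw [shiftPhase, h, AddChar.map_add_eq_mul, shiftPhase]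
  split_ifs <;> simp

theorem toCircle_flux {n : Fin d → Fin d → ℤ}
    (hn : ∀ i j, φ i j = 2 * n i j * Real.pi / (2 * L + 1)) (i j : Fin d) :
    (ZMod.toCircle (n i j : ZMod (2 * L + 1)) : ℂ) = Complex.exp (Complex.I * (φ i j : ℂ)) := by
  rw [ZMod.toCircle_intCast, hn]
  congr 1
  push_cast
  ring

/-- The matrices over `C_N(Ω̂)` indexed by `(ℤ/(2L+1)ℤ)^d`. -/
abbrev ShiftAlg (N d L : ℕ) (Ω₀ : Type u) [TopologicalSpace Ω₀] : Type u :=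
  CStarMatrix (Fin d → ZMod (2 * L + 1)) (Fin d → ZMod (2 * L + 1)) (MatFun N (FinConfig d Ω₀ L))

variable [PartialOrder (MatFun N (FinConfig d Ω₀ L))]
  [StarOrderedRing (MatFun N (FinConfig d Ω₀ L))]

/-- The generators in the representation by weighted shifts. -/
def shiftGen (N : ℕ) (Ω₀ : Type u) [TopologicalSpace Ω₀] [CompactSpace Ω₀]
    [PartialOrder (MatFun N (FinConfig d Ω₀ L))] [StarOrderedRing (MatFun N (FinConfig d Ω₀ L))]
    (n : Fin d → Fin d → ℤ) (j : Fin d) :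
    unitary (ShiftAlg N d L Ω₀) :=
  shiftUnitary (MatFun N (FinConfig d Ω₀ L)) (Pi.single j 1) (shiftPhase n j)

/-- Of two distinct generators only the one with the larger index notices the shift by the other,
and it picks up the root of unity of the flux. The opposite order follows from antisymmetry.
Quantization is what makes the phases functions on `(ℤ/(2L+1))^d`. -/
theorem shiftGen_comm {n : Fin d → Fin d → ℤ} (hanti : ∀ i j, φ i j = -φ j i)
    (hn : ∀ i j, φ i j = 2 * n i j * Real.pi / (2 * L + 1)) (i j : Fin d) :
    (shiftGen N Ω₀ (L := L) n i : ShiftAlg N d L Ω₀) * (shiftGen N Ω₀ (L := L) n j : ShiftAlg N d L Ω₀) =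
      Complex.exp (Complex.I * (φ i j : ℂ)) •
        ((shiftGen N Ω₀ (L := L) n j : ShiftAlg N d L Ω₀) * (shiftGen N Ω₀ (L := L) n i : ShiftAlg N d L Ω₀)) := by
  simp only [shiftGen, coe_shiftUnitary, shiftMatrix_mul]
  refine CStarMatrix.ext fun g' g => ?_
  rw [CStarMatrix.smul_apply, shiftMatrix_apply, shiftMatrix_apply,
    add_comm (Pi.single i 1 : Fin d → ZMod (2 * L + 1))]
  split_ifs
  · rw [smul_smul]
    congr 1
    rw [shiftPhase_add_single, shiftPhase_add_single]
    rcases lt_trichotomy i j with h | rfl | h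
    · have h' : Complex.exp (Complex.I * (φ i j : ℂ)) *
          (ZMod.toCircle (n j i : ZMod (2 * L + 1)) : ℂ) = 1 := by
        rw [toCircle_flux hn, ← Complex.exp_add, hanti i j]
        simp
      rw [if_neg h.not_gt, if_pos h]
      push_cast
      linear_combination (-(shiftPhase n j g : ℂ) * (shiftPhase n i g : ℂ)) * h'
    · have h0 : φ i i = 0 := by have := hanti i i; linarith
      simp [h0]
    · rw [if_neg h.not_gt, if_pos h]
      push_cast
      rw [toCircle_flux hn]
      ring
  · rw [smul_zero]

/-- The phase of the `j`-th generator does not depend on the `j`-th coordinate and is a `(2L+1)`-th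
root of unity. -/
theorem shiftGen_pow (n : Fin d → Fin d → ℤ) (j : Fin d) :
    (shiftGen N Ω₀ (L := L) n j) ^ (2 * L + 1) = 1 := by
  have h0 : ∀ a : ZMod (2 * L + 1), (2 * L + 1) • a = 0 := fun a => by
    rw [nsmul_eq_mul, ZMod.natCast_self, zero_mul]
  rw [shiftGen, shiftUnitary_pow fun g => by
    rw [shiftPhase_add_single, if_neg (lt_irrefl j), mul_one], ← shiftUnitary_zero_one]
  congr 1
  · funext i; exact h0 _
  · funext g
    rw [shiftPhase, ← AddChar.map_nsmul_eq_pow, h0, AddChar.map_zero_eq_one]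

/-- The representation of the finite-volume algebra by weighted shifts. -/
@[reducible] def shiftRep (hN : 0 < N) [Nonempty Ω₀] (n : Fin d → Fin d → ℤ)
    (hanti : ∀ i j, φ i j = -φ j i)
    (hn : ∀ i j, φ i j = 2 * n i j * Real.pi / (2 * L + 1)) :
    TwistedRep N (finShift (d := d) (Ω₀ := Ω₀) (L := L)) φ (2 * L + 1) where
  carrier := ShiftAlg N d L Ω₀
  nontriv := by
    have := nontrivial_matFun hN (FinConfig d Ω₀ L)
    refine ⟨⟨1, 0, fun h => ?_⟩⟩
    have h' := congrFun (congrFun h 0) 0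
    rw [CStarMatrix.one_apply, if_pos rfl] at h'
    exact one_ne_zero h'
  fn := diagonalHom (finTranslateHom N)
  gen := shiftGen N Ω₀ n
  gen_comm := shiftGen_comm hanti hn
  fn_gen f j := by
    refine CStarMatrix.ext fun g' g => ?_
    rw [shiftGen, coe_shiftUnitary, diagonalHom_mul_shiftMatrix_apply,
      shiftMatrix_mul_diagonalHom_apply]
    split_ifs with h
    · rw [h, finTranslateHom_apply, finTranslateHom_apply, ContinuousMap.comp_assoc,
        finShift_comp_finTranslate]
    · rfl
  gen_pow := shiftGen_pow n

/-- Each `f u_x` lives on the single shifted diagonal given by the class of `x`, so matrix entries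
separate the modes of the cube. -/
theorem exists_shiftRep_monomial (hN : 0 < N) [Nonempty Ω₀] (n : Fin d → Fin d → ℤ)
    (hanti : ∀ i j, φ i j = -φ j i)
    (hn : ∀ i j, φ i j = 2 * n i j * Real.pi / (2 * L + 1)) (x : Fin d → ℤ) :
    ∃ z : (Fin d → ZMod (2 * L + 1)) → Circle, ∀ (f : MatFun N (FinConfig d Ω₀ L)) g' g,
      (TwistedAlg.lift (shiftRep hN n hanti hn) (TwistedAlg.fn f * TwistedAlg.monomial x) :
        ShiftAlg N d L Ω₀) g' g =
        if g' = g + cls L x then (z g : ℂ) • finTranslateHom N g' f else 0 := by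
  set r := shiftRep (Ω₀ := Ω₀) hN n hanti hn
  set Φ : unitary (FinAlg N d Ω₀ L φ) →* unitary r.carrier :=
    (Unitary.map (StarMonoidHom.ofClass (TwistedAlg.lift r))).toMonoidHom
  obtain ⟨z, hz⟩ := exists_ordProd_shiftUnitary (𝔅 := MatFun N (FinConfig d Ω₀ L))
    (fun j : Fin d => (Pi.single j 1 : Fin d → ZMod (2 * L + 1))) (shiftPhase n) x
  have hs : ∑ j, x j • (Pi.single j 1 : Fin d → ZMod (2 * L + 1)) = cls L x := by
    funext i
    simp [Finset.sum_apply, cls, Pi.single_apply]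
  have h1 : TwistedAlg.lift r (TwistedAlg.monomial x) =
      ((TwistedAlg.monomialPhase φ x : Circle) : ℂ) • ((ordProd (shiftGen N Ω₀ n) x :
        unitary r.carrier) : r.carrier) := by
    rw [← TwistedAlg.coe_umonomial, TwistedAlg.umonomial, coe_scalarUnitary_mul,
      map_smul (TwistedAlg.lift r)]
    congr 1
    change ((Φ (ordProd TwistedAlg.ugen x) : unitary r.carrier) : r.carrier) = _
    rw [map_ordProd]
    rfl
  refine ⟨fun g => TwistedAlg.monomialPhase φ x * z g, fun f g' g => ?_⟩
  rw [map_mul, TwistedAlg.lift_fn, h1]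
  have h2 : ordProd (shiftGen N Ω₀ n) x = shiftUnitary (MatFun N (FinConfig d Ω₀ L)) (cls L x) z :=
    hs ▸ hz
  rw [h2, coe_shiftUnitary, mul_smul_comm]
  change ((TwistedAlg.monomialPhase φ x : Circle) : ℂ) •
    (diagonalHom (finTranslateHom N) f *
      shiftMatrix (MatFun N (FinConfig d Ω₀ L)) (cls L x) fun g => (z g : ℂ) :
        ShiftAlg N d L Ω₀) g' g = _
  rw [diagonalHom_mul_shiftMatrix_apply]
  split_ifs
  · rw [smul_smul, Circle.coe_mul]
  · rw [smul_zero]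

end FiniteRep

/-! ### Uniqueness of coefficients, and faithfulness of `C_N` in both algebras. -/

section Faithful

variable {d N L : ℕ} {Ω₀ : Type u} [TopologicalSpace Ω₀] [CompactSpace Ω₀]
  {φ : Matrix (Fin d) (Fin d) ℝ}

/-- Coordinate differences lie between `-2L` and `2L`, where `0` is the only multiple of `2L+1`. -/
theorem cls_injOn_cube {x y : Fin d → ℤ} (hx : x ∈ cube d L) (hy : y ∈ cube d L)
    (h : cls L x = cls L y) : x = y := by
  simp only [cube, Fintype.mem_piFinset, Finset.mem_Icc] at hx hy
  funext j
  have hj := congrFun h j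
  simp only [cls] at hj
  rw [ZMod.intCast_eq_intCast_iff_dvd_sub] at hj
  obtain ⟨k, hk⟩ := hj
  push_cast at hk
  have h1 := hx j
  have h2 := hy j
  have : k = 0 := by
    by_contra h0
    rcases lt_or_gt_of_ne h0 with h0 | h0
    · nlinarith
    · nlinarith
  subst this
  linarith

/-- In the representation by weighted shifts, the entry in row `cls L y` and column `0` is a phase
times a translate of `c y`. An entry is bounded by the norm of the matrix, and representations are
contractive. -/
theorem norm_le_norm_synth (hN : 0 < N) [Nonempty Ω₀] (hφ : IsQuantizedFlux L φ)
    (c : cube d L → MatFun N (FinConfig d Ω₀ L)) (y : cube d L) :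
    ‖c y‖ ≤ ‖(TwistedAlg.synth c : FinAlg N d Ω₀ L φ)‖ := by
  -- The C⋆-structure on matrices over `C_N(Ω̂)` needs an order on the entries; the spectral one is
  -- auxiliary and leaves no trace in the statement.
  let _ := CStarAlgebra.spectralOrder (MatFun N (FinConfig d Ω₀ L))
  let _ := CStarAlgebra.spectralOrderedRing (MatFun N (FinConfig d Ω₀ L))
  obtain ⟨hanti, hn⟩ := hφ
  choose n hn using hn
  set r := shiftRep (Ω₀ := Ω₀) hN n hanti hn
  choose z hz using exists_shiftRep_monomial (Ω₀ := Ω₀) hN n hanti hn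
  have h1 : (TwistedAlg.lift r (TwistedAlg.synth c) :
      ShiftAlg N d L Ω₀) (cls L (y : Fin d → ℤ)) 0 =
      (z y 0 : ℂ) • finTranslateHom N (cls L (y : Fin d → ℤ)) (c y) := by
    rw [TwistedAlg.synth, map_sum]
    have h2 : ∀ v : cube d L → ShiftAlg N d L Ω₀, ∀ g g', (∑ x, v x) g g' = ∑ x, v x g g' :=
      fun v g g' => map_sum (⟨⟨fun M => M g g', rfl⟩, fun _ _ => rfl⟩ :
        ShiftAlg N d L Ω₀ →+ MatFun N (FinConfig d Ω₀ L)) v _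
    refine (h2 _ _ _).trans ?_
    rw [Finset.sum_eq_single y]
    · rw [hz, zero_add, if_pos rfl]
    · intro x _ hx
      rw [hz, zero_add, if_neg]
      exact fun e => hx (Subtype.ext (cls_injOn_cube y.2 x.2 e).symm)
    · simp
  calc ‖c y‖ = ‖(z y 0 : ℂ) • finTranslateHom N (cls L (y : Fin d → ℤ)) (c y)‖ := by
        rw [norm_smul, Circle.norm_coe, one_mul, norm_finTranslateHom]
    _ ≤ ‖TwistedAlg.lift r (TwistedAlg.synth c)‖ := h1 ▸ CStarMatrix.norm_entry_le_norm
    _ ≤ _ := norm_starAlgHom_le _ _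

theorem synth_sub (c c' : cube d L → MatFun N (FinConfig d Ω₀ L)) :
    (TwistedAlg.synth (c - c') : FinAlg N d Ω₀ L φ) =
      TwistedAlg.synth c - TwistedAlg.synth c' := by
  simp only [TwistedAlg.synth, Pi.sub_apply, map_sub, sub_mul]
  exact Finset.sum_sub_distrib _ _

theorem synth_injective (hN : 0 < N) [Nonempty Ω₀] (hφ : IsQuantizedFlux L φ) :
    Function.Injective (TwistedAlg.synth :
      (cube d L → MatFun N (FinConfig d Ω₀ L)) → FinAlg N d Ω₀ L φ) := by
  intro c c' h
  funext y
  have h1 := norm_le_norm_synth hN hφ (c - c') y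
  rw [synth_sub, h, sub_self, norm_zero, norm_le_zero_iff] at h1
  exact sub_eq_zero.1 h1

theorem finCoeff_synth (hN : 0 < N) [Nonempty Ω₀] (hφ : IsQuantizedFlux L φ)
    (c : cube d L → MatFun N (FinConfig d Ω₀ L)) :
    (TwistedAlg.synth c : FinAlg N d Ω₀ L φ).finCoeff = c :=
  Function.leftInverse_invFun (synth_injective hN hφ) c

theorem fn_eq_synth (f : MatFun N (FinConfig d Ω₀ L)) :
    (TwistedAlg.fn f : FinAlg N d Ω₀ L φ) =
      TwistedAlg.synth (Pi.single ⟨0, zero_mem_cube d L⟩ f) := by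
  rw [TwistedAlg.synth, Finset.sum_eq_single ⟨0, zero_mem_cube d L⟩]
  · rw [Pi.single_eq_same, TwistedAlg.monomial_zero, mul_one]
  · intro x _ hx
    rw [Pi.single_eq_of_ne hx, map_zero, zero_mul]
  · simp

theorem fn_injective_finAlg (hN : 0 < N) [Nonempty Ω₀] (hφ : IsQuantizedFlux L φ) :
    Function.Injective (TwistedAlg.fn :
      MatFun N (FinConfig d Ω₀ L) →⋆ₐ[ℂ] FinAlg N d Ω₀ L φ) := by
  intro f f' h
  rw [fn_eq_synth, fn_eq_synth] at h
  simpa using congrFun (synth_injective hN hφ h) ⟨0, zero_mem_cube d L⟩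

theorem nontrivial_finAlg (hN : 0 < N) [Nonempty Ω₀] (hφ : IsQuantizedFlux L φ) :
    Nontrivial (FinAlg N d Ω₀ L φ) :=
  haveI := nontrivial_matFun hN (FinConfig d Ω₀ L)
  (fn_injective_finAlg hN hφ).nontrivial

variable [T2Space Ω₀]

/-- A periodic configuration depends only on the class of the site. -/
theorem perExtend_perRestrict (w : PerConfig d Ω₀ L) : perExtend (perRestrict w) = w := by
  -- Periodicity is extended from one coordinate step to its multiples, then to sums over
  -- coordinates.
  have hper : ∀ (x : Fin d → ℤ) (k : Fin d → ℤ),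
      w.1 (x + ((2 * L + 1 : ℕ) : ℤ) • k) = w.1 x := by
    have h1 : ∀ j x, w.1 (x + ((2 * L + 1 : ℕ) : ℤ) • Pi.single j 1) = w.1 x := fun j x => by
      have h := w.2 j
      rw [shift_iterate] at h
      have hx := congrFun h (x + ((2 * L + 1 : ℕ) : ℤ) • Pi.single j 1)
      simp only [shift, natCast_zsmul, add_sub_cancel_right] at hx
      rw [natCast_zsmul]
      exact hx.symm
    have h2 : ∀ j x, ∀ k : ℤ, w.1 (x + ((2 * L + 1 : ℕ) : ℤ) • k • Pi.single j 1) = w.1 x := by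
      intro j x k
      induction k with
      | zero => simp
      | succ k ih => rw [add_smul, one_smul, smul_add, ← add_assoc, h1, ih]
      | pred k ih =>
        rw [← h1, add_assoc, ← smul_add, sub_smul, one_smul, sub_add_cancel, ih]
    intro x k
    have h3 : ∀ s : Finset (Fin d),
        w.1 (x + ((2 * L + 1 : ℕ) : ℤ) • ∑ j ∈ s, k j • Pi.single j 1) = w.1 x := by
      intro s
      induction s using Finset.induction_on with
      | empty => simp
      | insert j s hj ih =>
        rw [Finset.sum_insert hj, smul_add, add_comm (_ • k j • _), ← add_assoc, h2, ih]
    have h4 : ∑ j, k j • (Pi.single j 1 : Fin d → ℤ) = k := by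
      funext i; simp [Finset.sum_apply, Pi.single_apply]
    rw [← h3 Finset.univ, h4]
  refine Subtype.ext (funext fun x => ?_)
  change w.1 (rep (cls L x)) = w.1 x
  have h5 : cls L (rep (cls L x)) = cls L x := cls_rep _
  have h6 : ∀ j, ((2 * L + 1 : ℕ) : ℤ) ∣ rep (cls L x) j - x j := fun j =>
    (ZMod.intCast_eq_intCast_iff_dvd_sub _ _ _).1 (congrFun h5 j).symm
  choose k hk using h6
  have h7 : rep (cls L x) = x + ((2 * L + 1 : ℕ) : ℤ) • k := by
    funext j
    rw [Pi.add_apply, Pi.smul_apply, smul_eq_mul, ← hk]; ring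
  rw [h7, hper]

theorem perExtendMap_surjective :
    Function.Surjective (perExtendMap : C(FinConfig d Ω₀ L, PerConfig d Ω₀ L)) :=
  fun w => ⟨perRestrict w, perExtend_perRestrict w⟩

/-- Injectivity is inherited from finite volume: periodic configurations are exactly the extensions
of finite-volume ones. -/
theorem fn_injective_perAlg (hN : 0 < N) [Nonempty Ω₀] (hφ : IsQuantizedFlux L φ) :
    Function.Injective (TwistedAlg.fn :
      MatFun N (PerConfig d Ω₀ L) →⋆ₐ[ℂ] PerAlg N d Ω₀ L φ) := by
  intro f f' h
  have h1 := congrArg finProj h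
  rw [finProj_fn, finProj_fn] at h1
  have h2 := fn_injective_finAlg hN hφ h1
  refine ContinuousMap.ext fun w => ?_
  obtain ⟨v, rfl⟩ := perExtendMap_surjective w
  exact congrArg (fun F : MatFun N (FinConfig d Ω₀ L) => F v) h2

theorem nontrivial_perAlg (hN : 0 < N) [Nonempty Ω₀] (hφ : IsQuantizedFlux L φ) :
    Nontrivial (PerAlg N d Ω₀ L φ) :=
  haveI : Nonempty (PerConfig d Ω₀ L) := ⟨perExtend (Classical.arbitrary _)⟩
  haveI := nontrivial_matFun hN (PerConfig d Ω₀ L)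
  (fn_injective_perAlg hN hφ).nontrivial

/-- The inverse shift on periodic configurations. -/
def perShiftInv (j : Fin d) : C(PerConfig d Ω₀ L, PerConfig d Ω₀ L) where
  toFun w := ⟨shift (-Pi.single j 1) w.1, fun i => by
    have h := w.2 i
    rw [shift_iterate] at h ⊢
    funext x
    have hx := congrFun h (x - -Pi.single j 1)
    simp only [shift] at hx ⊢
    rw [← hx, sub_right_comm]⟩
  continuous_toFun := ((continuous_shift _).comp continuous_subtype_val).subtype_mk _

theorem perShiftInv_comp (j : Fin d) :
    (perShiftInv j).comp (perShift j) = ContinuousMap.id (PerConfig d Ω₀ L) := by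
  refine ContinuousMap.ext fun w => Subtype.ext (funext fun x => ?_)
  change w.1 (x - -Pi.single j 1 - Pi.single j 1) = w.1 x
  rw [sub_neg_eq_add, add_sub_cancel_right]

end Faithful

/-! ### Reduction modulo `2L+1` -/

theorem rep_cls_of_mem_cube {d L : ℕ} {x : Fin d → ℤ} (hx : x ∈ cube d L) : rep (cls L x) = x :=
  cls_injOn_cube (rep_mem_cube _) hx (cls_rep _)

/-- A coordinate already in `[-L, L]` is unchanged, and any other is replaced by a smaller one.
Folding a mode into the cube thus never increases its derivative weights beyond the bound at `x`. -/
theorem norm_rep_cls_le {d L : ℕ} (x : Fin d → ℤ) : ‖rep (cls L x)‖ ≤ ‖x‖ := by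
  refine (pi_norm_le_iff_of_nonneg (norm_nonneg _)).2 fun j => le_trans ?_ (norm_le_pi_norm x j)
  have h1 := rep_mem_cube (cls L x)
  simp only [cube, Fintype.mem_piFinset, Finset.mem_Icc] at h1
  rw [Int.norm_eq_abs, Int.norm_eq_abs]
  by_cases hj : -(L : ℤ) ≤ x j ∧ x j ≤ L
  · have h2 : (x j : ZMod (2 * L + 1)).valMinAbs = x j :=
      (ZMod.valMinAbs_spec _ _).2 ⟨rfl, by constructor <;> push_cast <;> omega⟩
    rw [rep, cls, h2]
  · have h3 : |rep (cls L x) j| ≤ |x j| := by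
      have := h1 j
      rcases abs_cases (rep (cls L x) j) with h | h <;> rcases abs_cases (x j) with h' | h' <;> omega
    exact_mod_cast h3

theorem le_norm_of_notMem_cube {d L : ℕ} {x : Fin d → ℤ} (hx : x ∉ cube d L) : (L : ℝ) ≤ ‖x‖ := by
  simp only [cube, Fintype.mem_piFinset, Finset.mem_Icc, not_forall] at hx
  obtain ⟨j, hj⟩ := hx
  refine le_trans ?_ (norm_le_pi_norm x j)
  rw [Int.norm_eq_abs]
  have : (L : ℤ) ≤ |x j| := by rcases abs_cases (x j) with h' | h' <;> omega
  exact_mod_cast this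

section

variable {N d L : ℕ} {X : Type u} [TopologicalSpace X] [CompactSpace X]
  {T : Fin d → C(X, X)} {φ : Matrix (Fin d) (Fin d) ℝ}

/-- The ordered product depends only on the class modulo `2L+1`, since the generators have that
order; the symmetrizing prefactor accounts for the phase. -/
theorem exists_monomial_eq_rep (x : Fin d → ℤ) : ∃ z : Circle,
    (TwistedAlg.monomial x : TwistedAlg N T φ (2 * L + 1)) =
      (z : ℂ) • TwistedAlg.monomial (rep (cls L x)) := by
  have h1 : ∀ j, (TwistedAlg.ugen j : unitary (TwistedAlg N T φ (2 * L + 1))) ^ (2 * L + 1) = 1 :=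
    fun j => Subtype.ext (TwistedAlg.gen_pow j)
  have h2 : ordProd (TwistedAlg.ugen : Fin d → unitary (TwistedAlg N T φ (2 * L + 1))) x =
      ordProd TwistedAlg.ugen (rep (cls L x)) := by
    rw [ordProd, ordProd]
    congr 2
    funext j
    have h3 : cls L (rep (cls L x)) = cls L x := cls_rep _
    obtain ⟨k, hk⟩ := (ZMod.intCast_eq_intCast_iff_dvd_sub _ _ _).1 (congrFun h3 j)
    rw [eq_add_of_sub_eq' hk, zpow_add, zpow_mul, zpow_natCast, h1, one_zpow, mul_one]
  refine ⟨TwistedAlg.monomialPhase φ x * (TwistedAlg.monomialPhase φ (rep (cls L x)))⁻¹, ?_⟩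
  rw [← TwistedAlg.coe_umonomial, ← TwistedAlg.coe_umonomial, ← coe_scalarUnitary_mul,
    TwistedAlg.umonomial, TwistedAlg.umonomial, h2, ← mul_assoc, ← map_mul, inv_mul_cancel_right]

end

/-! ### The expansion over the cube, and multipliers of its coefficients. -/

section FiniteAlgebra

variable {d N L : ℕ} {Ω₀ : Type u} [TopologicalSpace Ω₀] [CompactSpace Ω₀]
  {φ : Matrix (Fin d) (Fin d) ℝ}

theorem synth_add (c c' : cube d L → MatFun N (FinConfig d Ω₀ L)) :
    (TwistedAlg.synth (c + c') : FinAlg N d Ω₀ L φ) =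
      TwistedAlg.synth c + TwistedAlg.synth c' := by
  simp only [TwistedAlg.synth, Pi.add_apply, map_add, add_mul]
  exact Finset.sum_add_distrib

theorem synth_smul (z : ℂ) (c : cube d L → MatFun N (FinConfig d Ω₀ L)) :
    (TwistedAlg.synth (z • c) : FinAlg N d Ω₀ L φ) = z • TwistedAlg.synth c := by
  simp only [TwistedAlg.synth, Pi.smul_apply, map_smul, smul_mul_assoc]
  exact Finset.smul_sum.symm

theorem synth_single (y : cube d L) (f : MatFun N (FinConfig d Ω₀ L)) :
    (TwistedAlg.synth (Pi.single y f) : FinAlg N d Ω₀ L φ) =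
      TwistedAlg.fn f * TwistedAlg.monomial y := by
  rw [TwistedAlg.synth, Finset.sum_eq_single y]
  · rw [Pi.single_eq_same]
  · intro x _ hx
    rw [Pi.single_eq_of_ne hx, map_zero, zero_mul]
  · simp

theorem fn_mul_monomial_eq_synth (x : Fin d → ℤ) : ∃ z : Circle,
    ∀ f : MatFun N (FinConfig d Ω₀ L),
      (TwistedAlg.fn f * TwistedAlg.monomial x : FinAlg N d Ω₀ L φ) =
        TwistedAlg.synth (Pi.single ⟨rep (cls L x), rep_mem_cube _⟩ ((z : ℂ) • f)) := by
  obtain ⟨z, hz⟩ := exists_monomial_eq_rep (N := N)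
    (T := finShift (d := d) (Ω₀ := Ω₀) (L := L)) (φ := φ) x
  refine ⟨z, fun f => ?_⟩
  rw [synth_single, hz, mul_smul_comm, map_smul, smul_mul_assoc]

theorem norm_synth_le (hN : 0 < N) [Nonempty Ω₀] (hφ : IsQuantizedFlux L φ)
    (c : cube d L → MatFun N (FinConfig d Ω₀ L)) :
    ‖(TwistedAlg.synth c : FinAlg N d Ω₀ L φ)‖ ≤ ∑ y, ‖c y‖ := by
  have := nontrivial_finAlg (Ω₀ := Ω₀) hN hφ
  rw [TwistedAlg.synth]
  refine (norm_sum_le _ _).trans (Finset.sum_le_sum fun y _ => ?_)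
  exact TwistedAlg.norm_fn_mul_monomial_le (T := finShift) (φ := φ) (c y) (y : Fin d → ℤ)

/-- The lower bound `norm_le_norm_synth` makes the range closed, and folding into the cube puts
every `f u_x` in it. -/
theorem synth_surjective (hN : 0 < N) [Nonempty Ω₀] (hφ : IsQuantizedFlux L φ) :
    Function.Surjective (TwistedAlg.synth :
      (cube d L → MatFun N (FinConfig d Ω₀ L)) → FinAlg N d Ω₀ L φ) := by
  let s : (cube d L → MatFun N (FinConfig d Ω₀ L)) →ₗ[ℂ] FinAlg N d Ω₀ L φ :=
    { toFun := TwistedAlg.synth, map_add' := synth_add, map_smul' := synth_smul }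
  have hcont : Continuous s := by
    refine continuous_finsetSum _ fun y _ => ?_
    have h : Continuous fun c : cube d L → MatFun N (FinConfig d Ω₀ L) => c y := continuous_apply y
    exact ((TwistedAlg.continuous_starAlgHom (TwistedAlg.fn :
      MatFun N (FinConfig d Ω₀ L) →⋆ₐ[ℂ] FinAlg N d Ω₀ L φ)).comp h).mul continuous_const
  have hanti : AntilipschitzWith 1 s := AddMonoidHomClass.antilipschitz_of_bound s fun c => by
    rw [NNReal.coe_one, one_mul]
    exact (pi_norm_le_iff_of_nonneg (norm_nonneg _)).2 fun y => norm_le_norm_synth hN hφ c y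
  have hclosed : IsClosed (LinearMap.range s : Set (FinAlg N d Ω₀ L φ)) :=
    hanti.isClosed_range (uniformContinuous_addMonoidHom_of_continuous hcont)
  have hT : ∀ j, ((fun j => finTranslate (-Pi.single j 1)) j).comp (finShift j) =
      ContinuousMap.id (FinConfig d Ω₀ L) := fun j => by
    refine ContinuousMap.ext fun w => funext fun x => ?_
    change w (x - -Pi.single j 1 - Pi.single j 1) = w x
    rw [sub_neg_eq_add, add_sub_cancel_right]
  have htop := TwistedAlg.submodule_eq_top hT (LinearMap.range s) hclosed fun f x => by
    obtain ⟨z, hz⟩ := fn_mul_monomial_eq_synth (N := N) (Ω₀ := Ω₀) (φ := φ) x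
    exact ⟨_, (hz f).symm⟩
  intro a
  exact (htop ▸ Submodule.mem_top : a ∈ LinearMap.range s)

theorem synth_finCoeff (hN : 0 < N) [Nonempty Ω₀] (hφ : IsQuantizedFlux L φ)
    (a : FinAlg N d Ω₀ L φ) : TwistedAlg.synth a.finCoeff = a :=
  Function.rightInverse_invFun (synth_surjective hN hφ) a

theorem finCoeff_add (hN : 0 < N) [Nonempty Ω₀] (hφ : IsQuantizedFlux L φ)
    (a b : FinAlg N d Ω₀ L φ) : (a + b).finCoeff = a.finCoeff + b.finCoeff := by
  apply synth_injective (φ := φ) hN hφ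
  rw [synth_add, synth_finCoeff hN hφ, synth_finCoeff hN hφ, synth_finCoeff hN hφ]

theorem finCoeff_smul (hN : 0 < N) [Nonempty Ω₀] (hφ : IsQuantizedFlux L φ)
    (z : ℂ) (a : FinAlg N d Ω₀ L φ) : (z • a).finCoeff = z • a.finCoeff := by
  apply synth_injective (φ := φ) hN hφ
  rw [synth_smul, synth_finCoeff hN hφ, synth_finCoeff hN hφ]

theorem norm_finCoeff_le (hN : 0 < N) [Nonempty Ω₀] (hφ : IsQuantizedFlux L φ)
    (a : FinAlg N d Ω₀ L φ) (y : cube d L) : ‖a.finCoeff y‖ ≤ ‖a‖ := by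
  have h := norm_le_norm_synth hN hφ a.finCoeff y
  rwa [synth_finCoeff hN hφ] at h

/-- The operator which multiplies the coefficients by `v`. -/
def finMultiplier (hN : 0 < N) [Nonempty Ω₀] (hφ : IsQuantizedFlux L φ) (v : (Fin d → ℤ) → ℂ) :
    FinAlg N d Ω₀ L φ →L[ℂ] FinAlg N d Ω₀ L φ :=
  LinearMap.mkContinuous
    { toFun := fun a => TwistedAlg.synth fun y => v y • a.finCoeff y
      map_add' := fun a b => by
        rw [finCoeff_add hN hφ, ← synth_add]
        congr 1; funext y; exact smul_add (v y) (a.finCoeff y) (b.finCoeff y)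
      map_smul' := fun z a => by
        rw [finCoeff_smul hN hφ, RingHom.id_apply, ← synth_smul]
        congr 1; funext y; exact smul_comm (v y) z (a.finCoeff y) } (∑ y : cube d L, ‖v y‖) fun a => by
    refine (norm_synth_le hN hφ _).trans ?_
    rw [Finset.sum_mul]
    refine Finset.sum_le_sum fun y _ => ?_
    rw [norm_smul]
    exact mul_le_mul_of_nonneg_left (norm_finCoeff_le hN hφ a y) (norm_nonneg _)

theorem finMultiplier_apply (hN : 0 < N) [Nonempty Ω₀] (hφ : IsQuantizedFlux L φ)
    (v : (Fin d → ℤ) → ℂ) (a : FinAlg N d Ω₀ L φ) :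
    finMultiplier hN hφ v a = TwistedAlg.synth fun y => v y • a.finCoeff y := rfl

/-- Aliasing: at finite volume a mode `x` is seen as its representative, so the weight is evaluated
there. All the error in the derivations comes from this. -/
theorem finMultiplier_fn_mul_monomial (hN : 0 < N) [Nonempty Ω₀] (hφ : IsQuantizedFlux L φ)
    (v : (Fin d → ℤ) → ℂ) (f : MatFun N (FinConfig d Ω₀ L)) (x : Fin d → ℤ) :
    finMultiplier hN hφ v (TwistedAlg.fn f * TwistedAlg.monomial x : FinAlg N d Ω₀ L φ) =
      v (rep (cls L x)) • (TwistedAlg.fn f * TwistedAlg.monomial x) := by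
  obtain ⟨z, hz⟩ := fn_mul_monomial_eq_synth (N := N) (Ω₀ := Ω₀) (φ := φ) x
  rw [hz, finMultiplier_apply, finCoeff_synth hN hφ, ← synth_smul]
  congr 1
  funext y
  rw [Pi.smul_apply]
  by_cases hy : y = ⟨rep (cls L x), rep_mem_cube _⟩
  · subst hy; rw [Pi.single_eq_same]
  · rw [Pi.single_eq_of_ne hy]
    have h0 : ∀ t : ℂ, t • (0 : MatFun N (FinConfig d Ω₀ L)) = 0 :=
      fun t => ContinuousMap.ext fun w => smul_zero t
    exact (h0 _).trans (h0 _).symm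

theorem multiDeriv_finDeriv (hN : 0 < N) [Nonempty Ω₀] (hφ : IsQuantizedFlux L φ)
    (α : Fin d → ℕ) (a : FinAlg N d Ω₀ L φ) :
    multiDeriv TwistedAlg.finDeriv α a = finMultiplier hN hφ (TwistedAlg.derivWeight α) a := by
  have h1 : ∀ (j : Fin d) (n : ℕ) (c : cube d L → MatFun N (FinConfig d Ω₀ L)),
      (TwistedAlg.finDeriv j)^[n] (TwistedAlg.synth c : FinAlg N d Ω₀ L φ) =
        TwistedAlg.synth fun y => (-Complex.I * ((y : Fin d → ℤ) j : ℂ)) ^ n • c y := by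
    intro j n c
    induction n with
    | zero => simp
    | succ n ih =>
      rw [Function.iterate_succ_apply', ih, TwistedAlg.finDeriv, finCoeff_synth hN hφ]
      simp only [smul_smul, pow_succ']
  have h2 : ∀ l : List (Fin d),
      l.foldr (fun j b => (TwistedAlg.finDeriv j)^[α j] b) a =
        TwistedAlg.synth fun y : cube d L =>
          (l.map fun j => (-Complex.I * ((y : Fin d → ℤ) j : ℂ)) ^ α j).prod • a.finCoeff y := by
    intro l
    induction l with
    | nil => simpa using (synth_finCoeff hN hφ a).symm
    | cons j l ih =>
      rw [List.foldr_cons, ih, h1]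
      simp only [smul_smul, List.map_cons, List.prod_cons]
  exact h2 _

end FiniteAlgebra

/-! ### Traces -/

theorem norm_ntr_le {N : ℕ} (M : Mat N) : ‖ntr M‖ ≤ ‖M‖ := by
  have hentry : ∀ i, ‖M i i‖ ≤ ‖M‖ := fun i => by
    have h1 := Matrix.l2_opNorm_mulVec M (PiLp.single 2 i (1 : ℂ))
    rw [PiLp.norm_single, norm_one, mul_one] at h1
    have h2 := (PiLp.norm_apply_le (p := 2) (WithLp.toLp 2 (M.mulVec (Pi.single i 1))) i)
    refine le_trans ?_ h1
    simpa using h2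
  rcases Nat.eq_zero_or_pos N with rfl | hN
  · simp [ntr]
  · rw [ntr, norm_mul, norm_inv, Complex.norm_natCast, inv_mul_le_iff₀ (by exact_mod_cast hN)]
    refine (norm_sum_le _ _).trans ((Finset.sum_le_sum fun i _ => hentry i).trans ?_)
    simp

section Trace

variable {N : ℕ} {X : Type u} [TopologicalSpace X] [CompactSpace X] [MeasurableSpace X]
  [OpensMeasurableSpace X] (μ : Measure X) [IsProbabilityMeasure μ]

theorem integrable_ntr (f : MatFun N X) : Integrable (fun w => ntr (f w)) μ := by
  have hc : Continuous fun w => ntr (f w) :=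
    continuous_const.mul (f.continuous.matrix_trace)
  exact (BoundedContinuousFunction.mkOfCompact ⟨_, hc⟩).integrable μ

theorem fnTrace_add (f g : MatFun N X) : fnTrace μ (f + g) = fnTrace μ f + fnTrace μ g := by
  rw [fnTrace, fnTrace, fnTrace, ← integral_add (integrable_ntr μ f) (integrable_ntr μ g)]
  congr 1
  funext w
  simp [ntr, mul_add]

theorem fnTrace_smul (z : ℂ) (f : MatFun N X) : fnTrace μ (z • f) = z * fnTrace μ f := by
  rw [fnTrace, fnTrace, ← integral_const_mul]
  congr 1
  funext w
  simp [ntr]; ring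

theorem norm_fnTrace_le (f : MatFun N X) : ‖fnTrace μ f‖ ≤ ‖f‖ := by
  refine (norm_integral_le_of_norm_le_const (C := ‖f‖) (.of_forall fun w =>
    (norm_ntr_le _).trans (f.norm_coe_le_norm w))).trans ?_
  simp

end Trace

/-! ### Lattice sums -/

theorem summable_inv_one_add_abs_sq : Summable fun t : ℤ => ((1 + |(t : ℝ)|) ^ 2)⁻¹ := by
  have h : Summable fun n : ℕ => ((1 + (n : ℝ)) ^ 2)⁻¹ := by
    have := (summable_nat_add_iff 1).2 (Real.summable_nat_pow_inv.2 (le_refl 2))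
    refine this.congr fun n => ?_
    push_cast
    rw [add_comm]
  refine Summable.of_nat_of_neg (h.congr fun n => ?_) (h.congr fun n => ?_) <;> simp

/-- The supremum norm dominates each coordinate, so the exponent `2d` leaves a square per coordinate
and the lattice sum is controlled by one-dimensional sums. -/
theorem inv_one_add_norm_pow_le {d : ℕ} (x : Fin d → ℤ) :
    ((1 + ‖x‖) ^ (2 * d))⁻¹ ≤ ∏ j, ((1 + |(x j : ℝ)|) ^ 2)⁻¹ := by
  rw [Finset.prod_inv_distrib]
  refine inv_anti₀ (Finset.prod_pos fun j _ => by positivity) ?_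
  have h : ∀ j ∈ Finset.univ, (1 + |(x j : ℝ)|) ^ 2 ≤ (1 + ‖x‖) ^ 2 := fun j _ => by
    have := norm_le_pi_norm x j
    rw [Int.norm_eq_abs] at this
    exact pow_le_pow_left₀ (by positivity) (by linarith) 2
  refine (Finset.prod_le_prod (fun j _ => by positivity) h).trans_eq ?_
  rw [Finset.prod_const, Finset.card_univ, Fintype.card_fin, pow_mul]

theorem sum_prod_le_tsum_pow {d : ℕ} {w : ℤ → ℝ} (hw : ∀ t, 0 ≤ w t) (hs : Summable w)
    (s : Finset (Fin d → ℤ)) : ∑ x ∈ s, ∏ j, w (x j) ≤ (∑' t, w t) ^ d := by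
  set t : Fin d → Finset ℤ := fun j => s.image fun x => x j
  have hst : s ⊆ Fintype.piFinset t := fun x hx =>
    Fintype.mem_piFinset.2 fun j => Finset.mem_image_of_mem _ hx
  calc ∑ x ∈ s, ∏ j, w (x j) ≤ ∑ x ∈ Fintype.piFinset t, ∏ j, w (x j) :=
        Finset.sum_le_sum_of_subset_of_nonneg hst fun x _ _ => Finset.prod_nonneg fun j _ => hw _
    _ = ∏ j, ∑ i ∈ t j, w i := (Finset.prod_univ_sum t fun _ => w).symm
    _ ≤ ∏ _j : Fin d, ∑' t, w t :=
        Finset.prod_le_prod (fun j _ => Finset.sum_nonneg fun i _ => hw i) fun j _ =>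
          hs.sum_le_tsum _ fun i _ => hw i
    _ = _ := by rw [Finset.prod_const, Finset.card_univ, Fintype.card_fin]

theorem summable_inv_one_add_norm_pow (d : ℕ) :
    Summable fun x : Fin d → ℤ => ((1 + ‖x‖) ^ (2 * d))⁻¹ :=
  summable_of_sum_le (fun x => by positivity) fun s =>
    (Finset.sum_le_sum fun x _ => inv_one_add_norm_pow_le x).trans
      (sum_prod_le_tsum_pow (fun t => by positivity) summable_inv_one_add_abs_sq s)

/-- The sum of `(1 + |x|)^{-2d}` over `ℤ^d`. -/
def latticeSum (d : ℕ) : ℝ := ∑' x : Fin d → ℤ, ((1 + ‖x‖) ^ (2 * d))⁻¹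

section Tails

variable {d : ℕ} {E : Type*} [NormedAddCommGroup E] {v : (Fin d → ℤ) → E} {D : ℝ}

theorem summable_norm_of_decay (hD : ∀ x, (1 + ‖x‖) ^ (2 * d) * ‖v x‖ ≤ D) :
    Summable fun x => ‖v x‖ := by
  refine Summable.of_nonneg_of_le (fun x => norm_nonneg _) (fun x => ?_)
    ((summable_inv_one_add_norm_pow d).mul_left D)
  rw [← div_eq_mul_inv, le_div_iff₀ (by positivity), mul_comm]
  exact hD x

/-- Outside the cube `1 + ‖x‖ ≥ 1 + L`, which pays for the factor `(1 + L)^{-p}`; the remaining `2d`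
powers make the sum converge. -/
theorem norm_le_of_hasSum_tail {L p : ℕ} {a : E} (ha : HasSum v a) (h0 : ∀ x ∈ cube d L, v x = 0)
    (hD : ∀ x, (1 + ‖x‖) ^ (p + 2 * d) * ‖v x‖ ≤ D) :
    ‖a‖ ≤ D * latticeSum d / (1 + L) ^ p := by
  have hD0 : 0 ≤ D := le_trans (by positivity) (hD 0)
  have hs := (summable_inv_one_add_norm_pow d).hasSum.mul_left (D / (1 + (L : ℝ)) ^ p)
  rw [mul_div_right_comm, latticeSum, ← ha.tsum_eq]
  refine tsum_of_norm_bounded hs fun x => ?_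
  by_cases hx : x ∈ cube d L
  · rw [h0 x hx, norm_zero]; positivity
  · rw [← div_eq_mul_inv, div_div, le_div_iff₀ (by positivity), mul_comm]
    refine le_trans (mul_le_mul_of_nonneg_right ?_ (norm_nonneg _)) (hD x)
    rw [pow_add]
    have := le_norm_of_notMem_cube hx
    gcongr

end Tails

/-! ### Products -/

/-- Telescoping, replacing one factor at a time; the norm bound on the second product is carried
along for the induction. -/
theorem norm_list_prod_sub_list_prod_le {A : Type*} [NormedRing A] [NormOneClass A] {n : ℕ}
    {a f : Fin n → A} {B ε : ℝ} (hB : 1 ≤ B) (ha : ∀ i, ‖a i‖ ≤ B) (hf : ∀ i, ‖f i‖ ≤ B)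
    (h : ∀ i, ‖a i - f i‖ ≤ ε) (hε : 0 ≤ ε) :
    ‖(List.ofFn a).prod - (List.ofFn f).prod‖ ≤ n * B ^ n * ε ∧ ‖(List.ofFn f).prod‖ ≤ B ^ n := by
  induction n with
  | zero => simp
  | succ n ih =>
    obtain ⟨h1, h2⟩ := ih (fun i => ha i.succ) (fun i => hf i.succ) fun i => h i.succ
    rw [List.ofFn_succ, List.ofFn_succ, List.prod_cons, List.prod_cons]
    set a' := (List.ofFn fun i : Fin n => a i.succ).prod
    set f' := (List.ofFn fun i : Fin n => f i.succ).prod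
    have hB0 : 0 ≤ B := zero_le_one.trans hB
    constructor
    · have e : a 0 * a' - f 0 * f' = a 0 * (a' - f') + (a 0 - f 0) * f' := by noncomm_ring
      rw [e]
      calc _ ≤ ‖a 0‖ * ‖a' - f'‖ + ‖a 0 - f 0‖ * ‖f'‖ :=
            (norm_add_le _ _).trans (add_le_add (norm_mul_le _ _) (norm_mul_le _ _))
        _ ≤ B * (n * B ^ n * ε) + ε * B ^ n :=
            add_le_add (mul_le_mul (ha 0) h1 (norm_nonneg _) hB0)
              (mul_le_mul (h 0) h2 (norm_nonneg _) hε)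
        _ ≤ B * (n * B ^ n * ε) + ε * B ^ (n + 1) := by
            gcongr
            exact Nat.le_succ n
        _ = _ := by push_cast; ring
    · rw [pow_succ']
      exact (norm_mul_le _ _).trans (mul_le_mul (hf 0) h2 (norm_nonneg _) hB0)

/-! ### Multi-derivatives -/

theorem norm_derivWeight_le {d : ℕ} (α : Fin d → ℕ) (x : Fin d → ℤ) :
    ‖TwistedAlg.derivWeight α x‖ ≤ (1 + ‖x‖) ^ TwistedAlg.order α := by
  have : ∀ l : List (Fin d), ‖(l.map fun j => (-Complex.I * (x j : ℂ)) ^ α j).prod‖ ≤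
      (1 + ‖x‖) ^ (l.map α).sum := by
    intro l
    induction l with
    | nil => simp
    | cons j l ih =>
      rw [List.map_cons, List.prod_cons, List.map_cons, List.sum_cons, pow_add, norm_mul]
      refine mul_le_mul ?_ ih (norm_nonneg _) (by positivity)
      rw [norm_pow, norm_mul, norm_neg, Complex.norm_I, one_mul, Complex.norm_intCast,
        ← Int.norm_eq_abs]
      have := norm_le_pi_norm x j
      gcongr
      linarith
  exact this _

/-! ### Transport of the disorder measure. -/

section Measures

variable {d : ℕ} {Ω₀ : Type u} {L : ℕ} [MeasurableSpace Ω₀]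

theorem measurable_perProj : Measurable (perProj L : Config d Ω₀ → PerConfig d Ω₀ L) :=
  Measurable.subtype_mk (measurable_pi_lambda _ fun _ => measurable_pi_apply _)

theorem measurable_perRestrict : Measurable (perRestrict : PerConfig d Ω₀ L → FinConfig d Ω₀ L) :=
  measurable_pi_lambda _ fun _ => (measurable_pi_apply _).comp measurable_subtype_coe

variable [TopologicalSpace Ω₀] [CompactSpace Ω₀] [T2Space Ω₀] [SecondCountableTopology Ω₀]
  [BorelSpace Ω₀] (P : Measure (Config d Ω₀)) [IsProbabilityMeasure P]

instance isProbabilityMeasure_perMeasure : IsProbabilityMeasure (perMeasure P L) :=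
  Measure.isProbabilityMeasure_map measurable_perProj.aemeasurable

instance isProbabilityMeasure_finMeasure : IsProbabilityMeasure (finMeasure P L) :=
  Measure.isProbabilityMeasure_map measurable_perRestrict.aemeasurable

theorem fnTrace_finMeasure {N : ℕ} (f : MatFun N (PerConfig d Ω₀ L)) :
    fnTrace (finMeasure P L) (f.comp perExtendMap) = fnTrace (perMeasure P L) f := by
  rw [fnTrace, finMeasure, integral_map measurable_perRestrict.aemeasurable]
  · rw [fnTrace]
    congr 1
    funext w
    change ntr (f (perExtend (perRestrict w))) = _
    rw [perExtend_perRestrict]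
  · have hc : Continuous fun w => ntr ((f.comp (perExtendMap (Ω₀ := Ω₀) (L := L))) w) :=
      continuous_const.mul ((f.comp perExtendMap).continuous.matrix_trace)
    exact hc.aestronglyMeasurable

end Measures

/-! ### Exact derivations against approximate ones. -/

section Comparison

variable {d N L : ℕ} {Ω₀ : Type u} [TopologicalSpace Ω₀] [CompactSpace Ω₀] [T2Space Ω₀]
  {φ : Matrix (Fin d) (Fin d) ℝ}

theorem finProj_monomial (x : Fin d → ℤ) :
    finProj (TwistedAlg.monomial x : PerAlg N d Ω₀ L φ) = TwistedAlg.monomial x := by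
  rw [TwistedAlg.map_monomial finProj (fun _ => 1) (fun j => by
    rw [finProj_gen, Circle.coe_one, one_smul]) x]
  have : ordProd (fun _ : Fin d => (1 : Circle)) x = 1 := by simp [ordProd]
  rw [this, Circle.coe_one, one_smul]

theorem norm_comp_perExtendMap_le (f : MatFun N (PerConfig d Ω₀ L)) :
    ‖f.comp (perExtendMap (d := d) (Ω₀ := Ω₀) (L := L))‖ ≤ ‖f‖ :=
  norm_starAlgHom_le (ContinuousMap.compStarAlgHom' ℂ (Mat N) perExtendMap) f

variable (hN : 0 < N) [Nonempty Ω₀] (hφ : IsQuantizedFlux L φ)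
include hN hφ

theorem hasSum_fourier_of_decay {h : PerAlg N d Ω₀ L φ} {D : ℝ}
    (hD : ∀ x, (1 + ‖x‖) ^ (2 * d) * ‖h.coeff x‖ ≤ D) :
    HasSum (fun x => TwistedAlg.fn (h.coeff x) * TwistedAlg.monomial x) h := by
  have := nontrivial_perAlg (Ω₀ := Ω₀) hN hφ
  exact TwistedAlg.hasSum_fourier perShiftInv_comp (fn_injective_perAlg hN hφ)
    (summable_norm_of_decay hD)

/-- The `k`-th derivative of the mode `x` costs `(d‖x‖)^k`, and `2d` further powers give
summability. The bound involves neither `L` nor `φ`. -/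
theorem hasSmoothBound_of_decay {h : PerAlg N d Ω₀ L φ} {C : ℕ → ℝ}
    (hC : ∀ k x, (1 + ‖x‖) ^ k * ‖h.coeff x‖ ≤ C k) :
    TwistedAlg.HasSmoothBound (fun k => ∑' x : Fin d → ℤ,
      d ^ k * C (k + 2 * d) * ((1 + ‖x‖) ^ (2 * d))⁻¹) h := by
  have := nontrivial_perAlg (Ω₀ := Ω₀) hN hφ
  refine TwistedAlg.orbitBound_of_hasSum
    (fun θ x => TwistedAlg.gauge_fn_mul_monomial θ (h.coeff x) x)
    (hasSum_fourier_of_decay hN hφ (hC _))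
    (fun k => (summable_inv_one_add_norm_pow d).mul_left _) fun k x => ?_
  rw [← div_eq_mul_inv, le_div_iff₀ (by positivity), mul_pow, mul_assoc, mul_assoc]
  refine mul_le_mul_of_nonneg_left (le_trans ?_ (hC (k + 2 * d) x)) (by positivity)
  rw [pow_add, mul_assoc, mul_comm (_ ^ (2 * d))]
  have h1 := TwistedAlg.norm_fn_mul_monomial_le (T := perShift (d := d) (Ω₀ := Ω₀) (L := L))
    (φ := φ) (m := 0) (h.coeff x) x
  have h2 : ‖x‖ ≤ 1 + ‖x‖ := by linarith
  gcongr

variable {M : ℕ → ℝ} {b : PerAlg N d Ω₀ L φ} (hb : TwistedAlg.HasSmoothBound M b)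
include hb

theorem HasSmoothBound.coeff_decay (k : ℕ) (x : Fin d → ℤ) :
    (1 + ‖x‖) ^ k * ‖b.coeff x‖ ≤ TwistedAlg.decayBound M k :=
  have := nontrivial_perAlg (Ω₀ := Ω₀) hN hφ
  TwistedAlg.HasSmoothBound.coeff_decay perShiftInv_comp (fn_injective_perAlg hN hφ) hb k x

theorem hasSum_finProj :
    HasSum (fun x => TwistedAlg.fn ((b.coeff x).comp perExtendMap) * TwistedAlg.monomial x)
      (finProj b) := by
  have h1 := (hasSum_fourier_of_decay hN hφ (HasSmoothBound.coeff_decay hN hφ hb _)).map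
    (finProj : PerAlg N d Ω₀ L φ →⋆ₐ[ℂ] FinAlg N d Ω₀ L φ)
    (TwistedAlg.continuous_starAlgHom finProj)
  refine h1.congr_fun fun x => ?_
  rw [Function.comp_apply, map_mul, finProj_fn, finProj_monomial]

theorem norm_finProj_term_le (x : Fin d → ℤ) :
    ‖(TwistedAlg.fn ((b.coeff x).comp perExtendMap) * TwistedAlg.monomial x :
      FinAlg N d Ω₀ L φ)‖ ≤ ‖b.coeff x‖ :=
  have := nontrivial_finAlg (Ω₀ := Ω₀) hN hφ
  (TwistedAlg.norm_fn_mul_monomial_le _ x).trans (norm_comp_perExtendMap_le _)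

/-- Both elements are series over the same modes, with weights taken at `x` and at its
representative. These agree on the cube; elsewhere each is at most `(1 + ‖x‖)` to the order of `α`,
whence the factor `2`. -/
theorem norm_multiDeriv_finProj_sub_le (α : Fin d → ℕ) (p : ℕ) :
    ‖finProj (multiDeriv TwistedAlg.deriv α b) - multiDeriv TwistedAlg.finDeriv α (finProj b)‖ ≤
      2 * TwistedAlg.decayBound M (TwistedAlg.order α + (p + 2 * d)) * latticeSum d /
        (1 + L) ^ p := by
  have := nontrivial_perAlg (Ω₀ := Ω₀) hN hφ
  have h1 := hasSum_finProj hN hφ (hb.multiDeriv α)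
  have h2 := (finMultiplier hN hφ (TwistedAlg.derivWeight α)).hasSum (hasSum_finProj hN hφ hb)
  rw [← multiDeriv_finDeriv hN hφ] at h2
  refine norm_le_of_hasSum_tail (h1.sub h2) (fun x hx => ?_) fun x => ?_
  all_goals
    have e : (TwistedAlg.fn (((multiDeriv TwistedAlg.deriv α b).coeff x).comp perExtendMap) *
        TwistedAlg.monomial x : FinAlg N d Ω₀ L φ) = TwistedAlg.derivWeight α x •
          (TwistedAlg.fn ((b.coeff x).comp perExtendMap) * TwistedAlg.monomial x) := by
      rw [TwistedAlg.coeff_multiDeriv perShiftInv_comp (fn_injective_perAlg hN hφ) hb,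
        ← smul_mul_assoc, ← map_smul]
      rfl
    rw [e, finMultiplier_fn_mul_monomial]
  · rw [rep_cls_of_mem_cube hx, sub_self]
  · have h3 := norm_finProj_term_le hN hφ hb x
    have h4 := HasSmoothBound.coeff_decay hN hφ hb (TwistedAlg.order α + (p + 2 * d)) x
    have h5 : ‖TwistedAlg.derivWeight α (rep (cls L x))‖ ≤ (1 + ‖x‖) ^ TwistedAlg.order α := by
      refine (norm_derivWeight_le α _).trans ?_
      have := norm_rep_cls_le (L := L) x
      gcongr
    have h6 := norm_derivWeight_le α x
    rw [← sub_smul, norm_smul]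
    calc _ ≤ (1 + ‖x‖) ^ (p + 2 * d) * ((2 * (1 + ‖x‖) ^ TwistedAlg.order α) * ‖b.coeff x‖) := by
          refine mul_le_mul_of_nonneg_left (mul_le_mul ?_ h3 (norm_nonneg _) (by positivity))
            (by positivity)
          refine (norm_sub_le _ _).trans ?_
          linarith
      _ = 2 * ((1 + ‖x‖) ^ (TwistedAlg.order α + (p + 2 * d)) * ‖b.coeff x‖) := by
          rw [pow_add _ (TwistedAlg.order α)]; ring
      _ ≤ _ := mul_le_mul_of_nonneg_left h4 zero_le_two

end Comparison

/-! ### Trace of the periodic algebra against trace at finite volume. -/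

section TraceComparison

variable {d N L : ℕ} {Ω₀ : Type u} [TopologicalSpace Ω₀] [CompactSpace Ω₀] [T2Space Ω₀]
  [SecondCountableTopology Ω₀] [MeasurableSpace Ω₀] [BorelSpace Ω₀]
  {φ : Matrix (Fin d) (Fin d) ℝ} (P : Measure (Config d Ω₀)) [IsProbabilityMeasure P]
  (hN : 0 < N) [Nonempty Ω₀] (hφ : IsQuantizedFlux L φ)

/-- The trace of the finite-volume algebra, as a continuous linear functional. -/
def finTraceCLM : FinAlg N d Ω₀ L φ →L[ℂ] ℂ :=
  LinearMap.mkContinuous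
    { toFun := finTrace P
      map_add' := fun a b => by
        simp only [finTrace]
        rw [finCoeff_add hN hφ]; exact fnTrace_add _ _ _
      map_smul' := fun z a => by
        simp only [finTrace]
        rw [finCoeff_smul hN hφ]; exact fnTrace_smul _ _ _ } 1 fun a => by
    rw [one_mul]
    exact (norm_fnTrace_le _ _).trans (norm_finCoeff_le hN hφ a _)

theorem finTraceCLM_apply (a : FinAlg N d Ω₀ L φ) : finTraceCLM P hN hφ a = finTrace P a := rfl

include hN hφ in
theorem norm_finTrace_le (a : FinAlg N d Ω₀ L φ) : ‖finTrace P a‖ ≤ ‖a‖ :=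
  (norm_fnTrace_le _ _).trans (norm_finCoeff_le hN hφ a _)

include hN hφ in
theorem norm_finTrace_sub_finTrace_le (a b : FinAlg N d Ω₀ L φ) :
    ‖finTrace P a - finTrace P b‖ ≤ ‖a - b‖ := by
  have h := norm_finTrace_le P hN hφ (a - b)
  rwa [← finTraceCLM_apply P hN hφ, map_sub] at h

include hN hφ in
-- In the cube only the mode `0` has a trace, and it is the same on both sides. The error comes from
-- modes outside the cube, which can be congruent to `0`.
theorem norm_perTrace_sub_finTrace_le {M : ℕ → ℝ} {b : PerAlg N d Ω₀ L φ}
    (hb : TwistedAlg.HasSmoothBound M b) (p : ℕ) :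
    ‖perTrace P b - finTrace P (finProj b)‖ ≤
      TwistedAlg.decayBound M (p + 2 * d) * latticeSum d / (1 + L) ^ p := by
  have h1 := (finTraceCLM P hN hφ).hasSum (hasSum_finProj hN hφ hb)
  -- The periodic trace is written as a series concentrated at `0`, so that the difference of traces
  -- is again a sum over `ℤ^d` vanishing on the cube.
  have h2 := hasSum_ite_eq (0 : Fin d → ℤ) (perTrace P b)
  have hcube : ∀ x (hx : x ∈ cube d L), finTrace P (TwistedAlg.fn ((b.coeff x).comp perExtendMap) *
      TwistedAlg.monomial x : FinAlg N d Ω₀ L φ) = if x = 0 then perTrace P b else 0 := by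
    intro x hx
    have h3 := synth_single (φ := φ) ⟨x, hx⟩ ((b.coeff x).comp
      (perExtendMap (d := d) (Ω₀ := Ω₀) (L := L)))
    rw [← h3, finTrace, finCoeff_synth hN hφ]
    split_ifs with h0
    · subst h0
      rw [Pi.single_eq_same, fnTrace_finMeasure]
      rfl
    · rw [Pi.single_eq_of_ne fun e => h0 (congrArg Subtype.val e).symm]
      simp [fnTrace, ntr]
  refine norm_le_of_hasSum_tail (h2.sub h1) (fun x hx => ?_) fun x => ?_
  · rw [finTraceCLM_apply, hcube x hx, sub_self]
  · rw [finTraceCLM_apply]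
    refine le_trans (mul_le_mul_of_nonneg_left ?_ (by positivity))
      (HasSmoothBound.coeff_decay hN hφ hb (p + 2 * d) x)
    split_ifs with h0
    · subst h0
      rw [hcube 0 (zero_mem_cube d L), if_pos rfl, sub_self, norm_zero]
      exact norm_nonneg _
    · rw [zero_sub, norm_neg]
      exact (norm_finTrace_le P hN hφ _).trans (norm_finProj_term_le hN hφ hb x)

end TraceComparison

/-! ### Comparison of the correlation functions -/

/-- The bound, up to the factor `(1 + L)^{-p}`, for the error in one multi-derivative. -/
def derivError (d p : ℕ) (M : ℕ → ℝ) (α : Fin d → ℕ) : ℝ :=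
  2 * TwistedAlg.decayBound M (TwistedAlg.order α + (p + 2 * d)) * latticeSum d

/-- A bound for the norms of the factors. -/
def factorBound {d n : ℕ} (p : ℕ) (M : Fin n → ℕ → ℝ) (α : Fin n → Fin d → ℕ) : ℝ :=
  1 + ∑ i, (M i (TwistedAlg.order (α i)) + derivError d p (M i) (α i))

/-- The bound, up to the factor `(1 + L)^{-p}`, for the error in the correlation function. -/
def corrError {d n : ℕ} (p : ℕ) (M : Fin n → ℕ → ℝ) (α : Fin n → Fin d → ℕ) : ℝ :=
  TwistedAlg.decayBound ((List.ofFn fun i k => M i (k + TwistedAlg.order (α i))).foldr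
      TwistedAlg.leibnizBound fun _ => 1) (p + 2 * d) * latticeSum d +
    n * factorBound p M α ^ n * ∑ i, derivError d p (M i) (α i)

/-- The intermediate quantity is the finite-volume trace of the image of the exact product: one
error compares traces of a single smooth element, the other replaces exact derivatives by
approximate ones inside the finite-volume algebra. -/
theorem norm_perTrace_prod_sub_finTrace_prod_le {d N L : ℕ} {Ω₀ : Type u} [TopologicalSpace Ω₀]
    [CompactSpace Ω₀] [T2Space Ω₀] [SecondCountableTopology Ω₀] [MeasurableSpace Ω₀]
    [BorelSpace Ω₀] {φ : Matrix (Fin d) (Fin d) ℝ} (P : Measure (Config d Ω₀))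
    [IsProbabilityMeasure P] (hN : 0 < N) [Nonempty Ω₀] (hφ : IsQuantizedFlux L φ) {n : ℕ}
    {M : Fin n → ℕ → ℝ} {b : Fin n → PerAlg N d Ω₀ L φ}
    (hb : ∀ i, TwistedAlg.HasSmoothBound (M i) (b i)) (α : Fin n → Fin d → ℕ) (p : ℕ) :
    ‖perTrace P (List.ofFn fun i => multiDeriv TwistedAlg.deriv (α i) (b i)).prod -
      finTrace P (List.ofFn fun i => multiDeriv TwistedAlg.finDeriv (α i) (finProj (b i))).prod‖ ≤
      corrError p M α / (1 + L) ^ p := by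
  have := nontrivial_perAlg (Ω₀ := Ω₀) hN hφ
  have := nontrivial_finAlg (Ω₀ := Ω₀) hN hφ
  have hL : (0 : ℝ) < (1 + (L : ℝ)) ^ p := by positivity
  have hL1 : (1 : ℝ) ≤ (1 + (L : ℝ)) ^ p := one_le_pow₀ (by simp)
  set a := fun i => multiDeriv TwistedAlg.deriv (α i) (b i)
  set f := fun i => multiDeriv TwistedAlg.finDeriv (α i) (finProj (b i))
  have ha : ∀ i, TwistedAlg.HasSmoothBound (fun k => M i (k + TwistedAlg.order (α i))) (a i) :=
    fun i => (hb i).multiDeriv (α i)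
  have hd : ∀ i, ‖finProj (a i) - f i‖ ≤ derivError d p (M i) (α i) / (1 + L) ^ p :=
    fun i => norm_multiDeriv_finProj_sub_le hN hφ (hb i) (α i) p
  -- The sign of the constant is read off from the estimate, which bounds a norm.
  have hE0 : ∀ i, 0 ≤ derivError d p (M i) (α i) := fun i => by
    have h := mul_nonneg ((norm_nonneg _).trans (hd i)) hL.le
    rwa [div_mul_cancel₀ _ hL.ne'] at h
  have hM0 : ∀ i, ‖a i‖ ≤ M i (TwistedAlg.order (α i)) := fun i => by
    have h := (ha i).norm_le
    rwa [zero_add] at h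
  have hEle : ∀ i, derivError d p (M i) (α i) / (1 + L) ^ p ≤ derivError d p (M i) (α i) :=
    fun i => div_le_self (hE0 i) hL1
  have hpa : ∀ i, ‖(finProj (a i) : FinAlg N d Ω₀ L φ)‖ ≤ M i (TwistedAlg.order (α i)) :=
    fun i => (norm_starAlgHom_le _ _).trans (hM0 i)
  have hterm : ∀ i, 0 ≤ M i (TwistedAlg.order (α i)) + derivError d p (M i) (α i) :=
    fun i => add_nonneg ((norm_nonneg _).trans (hM0 i)) (hE0 i)
  have hB : ∀ i, M i (TwistedAlg.order (α i)) + derivError d p (M i) (α i) ≤ factorBound p M α :=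
    fun i => by
      have := Finset.single_le_sum (fun i _ => hterm i) (Finset.mem_univ i)
      rw [factorBound]
      linarith
  have hB1 : 1 ≤ factorBound p M α := by
    have := Finset.sum_nonneg fun i (_ : i ∈ Finset.univ) => hterm i
    rw [factorBound]
    linarith
  have h1 := (norm_list_prod_sub_list_prod_le (a := fun i => finProj (a i)) (f := f)
    (ε := (∑ i, derivError d p (M i) (α i)) / (1 + L) ^ p) hB1
    (fun i => (hpa i).trans (by linarith [hB i, hE0 i]))
    (fun i => by
      have h2 : ‖f i‖ ≤ ‖(finProj (a i) : FinAlg N d Ω₀ L φ)‖ + ‖finProj (a i) - f i‖ :=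
        norm_le_norm_add_norm_sub _ _
      linarith [hB i, hd i, hEle i, hpa i])
    (fun i => (hd i).trans (div_le_div_of_nonneg_right
      (Finset.single_le_sum (fun i _ => hE0 i) (Finset.mem_univ i)) hL.le))
    (div_nonneg (Finset.sum_nonneg fun i _ => hE0 i) hL.le)).1
  have h2 := norm_perTrace_sub_finTrace_le P hN hφ (TwistedAlg.orbitBound_prod ha) p
  have h3 : finProj (List.ofFn a).prod = (List.ofFn fun i => finProj (a i)).prod := by
    rw [map_list_prod, List.map_ofFn]
    rfl
  rw [h3] at h2
  have h4 := norm_finTrace_sub_finTrace_le P hN hφ (List.ofFn fun i => finProj (a i)).prod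
    (List.ofFn f).prod
  have h5 := norm_sub_le_norm_sub_add_norm_sub (perTrace P (List.ofFn a).prod)
    (finTrace P (List.ofFn fun i => (finProj (a i) : FinAlg N d Ω₀ L φ)).prod)
    (finTrace P (List.ofFn f).prod)
  refine h5.trans ((add_le_add h2 (h4.trans h1)).trans_eq ?_)
  rw [corrError]
  ring

/-- From `1 + (2L+1)^d ≤ 2 (2(1+L))^d`; this converts decay in `L` of order `dK` into decay in the
volume of order `K`. -/
theorem one_add_card_cube_pow_le (d L K : ℕ) :
    (1 + ((cube d L).card : ℝ)) ^ K ≤ (2 ^ (d + 1)) ^ K * (1 + (L : ℝ)) ^ (d * K) := by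
  rw [pow_mul, ← mul_pow]
  refine pow_le_pow_left₀ (by positivity) ?_ K
  have h : (cube d L).card = (2 * L + 1) ^ d := by
    rw [cube, Fintype.card_piFinset, Finset.prod_const, Finset.card_univ, Fintype.card_fin,
      Int.card_Icc]
    congr 1
    omega
  have h1 : (1 : ℝ) ≤ (2 * (1 + (L : ℝ))) ^ d := one_le_pow₀ (by linarith [L.cast_nonneg (α := ℝ)])
  have h2 : (2 * (L : ℝ) + 1) ^ d ≤ (2 * (1 + (L : ℝ))) ^ d :=
    pow_le_pow_left₀ (by positivity) (by linarith) d
  rw [h]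
  push_cast
  calc _ ≤ 2 * (2 * (1 + (L : ℝ))) ^ d := by linarith
    _ = _ := by rw [mul_pow]; ring

end NCTorus

end

/-! ### The theorem: uniform choice of the constants. -/

open NCTorus
theorem mainTheorem4 {d N : ℕ} (hN : 0 < N) {Ω₀ : Type u} [TopologicalSpace Ω₀] [CompactSpace Ω₀]
    [TopologicalSpace.MetrizableSpace Ω₀] [MeasurableSpace Ω₀] [BorelSpace Ω₀]
    (P : Measure (Config d Ω₀)) (hP : IsDisorderMeasure P)
    {n : ℕ} (α : Fin n → Fin d → ℕ) (G : Fin n → ℝ → ℂ)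
    (S U : Set ℝ) (hS : IsCompact S) (hU : IsOpen U) (hSU : S ⊆ U)
    (hG : ∀ i, ContDiffOn ℝ (⊤ : ℕ∞) (G i) U)
    (C : ℕ → ℝ) (K : ℕ) :
    ∃ A : ℝ, ∀ (L : ℕ) (φ : Matrix (Fin d) (Fin d) ℝ), IsQuantizedFlux L φ →
      ∀ h : PerAlg N d Ω₀ L φ, IsSelfAdjoint h → h.IsSmooth →
        (∀ (k : ℕ) (x : Fin d → ℤ), (1 + ‖x‖) ^ k * ‖h.coeff x‖ ≤ C k) →
        spectrum ℝ h ⊆ S →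
        (∀ i, (realFC (G i) h).IsSmooth) ∧
        ‖perCorr P α G h - finCorr P α G (finProj h)‖ ≤ A / (1 + ((cube d L).card : ℝ)) ^ K := by
  have hprob := hP.prob
  have hne : Nonempty Ω₀ := by
    obtain ⟨w⟩ := nonempty_of_isProbabilityMeasure P
    exact ⟨w 0⟩
  -- A compact metric space is second countable, so continuous functions on the products are
  -- measurable for the product σ-algebra.
  let _ := TopologicalSpace.metrizableSpaceMetric Ω₀
  have hsc : SecondCountableTopology Ω₀ := inferInstance
  -- The bounds are fixed before `L`, `φ` and `h`; the universe is that of the universal algebras.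
  have hM := fun i => exists_bound_realFC.{u + 1} hS hU hSU (hG i) fun k =>
    ∑' x : Fin d → ℤ, d ^ k * C (k + 2 * d) * ((1 + ‖x‖) ^ (2 * d))⁻¹
  choose M hM using hM
  refine ⟨(2 ^ (d + 1)) ^ K * corrError (d * K) M α, fun L φ hφ h hsa _ hC hspec => ?_⟩
  have := nontrivial_perAlg (Ω₀ := Ω₀) hN hφ
  have hh := hasSmoothBound_of_decay hN hφ hC
  -- The orbit of `h` is a smooth family of self-adjoint elements with spectrum in `S`, and the
  -- orbit of `G(h)` is the functional calculus applied to it.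
  have hb : ∀ i, TwistedAlg.HasSmoothBound (M i) (realFC (G i) h) := fun i => by
    have h1 := hM i (fun θ : Fin d → ℝ => TwistedAlg.gauge θ h) hh.1 (fun k θ => hh.2 k θ)
      (fun θ => hsa.map (TwistedAlg.gauge θ))
      (fun θ => (spectrum_map_subset (TwistedAlg.gauge θ) h).trans hspec)
    have h2 : (fun θ : Fin d → ℝ => TwistedAlg.gauge θ (realFC (G i) h)) =
        fun θ => realFC (G i) (TwistedAlg.gauge θ h) := by
      funext θ
      exact map_realFC (TwistedAlg.gauge θ) ((hG i).continuousOn.mono hSU) hsa hspec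
    rw [TwistedAlg.HasSmoothBound, TwistedAlg.OrbitBound, h2]
    exact h1
  refine ⟨fun i => (hb i).isSmooth, ?_⟩
  have h1 := norm_perTrace_prod_sub_finTrace_prod_le P hN hφ hb α (d * K)
  -- A ⋆-homomorphism commutes with functional calculus, so both correlation functions come from the
  -- same elements `G(h)`.
  have h2 : finCorr P α G (finProj h) = finTrace P (List.ofFn fun i =>
      multiDeriv TwistedAlg.finDeriv (α i) (finProj (realFC (G i) h))).prod := by
    rw [finCorr]
    congr 3
    funext i
    rw [map_realFC finProj ((hG i).continuousOn.mono hSU) hsa hspec]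
  rw [perCorr, h2]
  have hL : (0 : ℝ) < (1 + (L : ℝ)) ^ (d * K) := by positivity
  have hA : 0 ≤ corrError (d * K) M α := by
    have h3 := mul_nonneg ((norm_nonneg _).trans h1) hL.le
    rwa [div_mul_cancel₀ _ hL.ne'] at h3
  refine h1.trans ?_
  rw [div_le_div_iff₀ hL (by positivity)]
  calc _ ≤ corrError (d * K) M α * ((2 ^ (d + 1)) ^ K * (1 + (L : ℝ)) ^ (d * K)) :=
        mul_le_mul_of_nonneg_left (one_add_card_cube_pow_le d L K) hA
    _ = _ := by ring
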